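/- Let $\mathbb{D}$ be the open unit disc and $dA=\frac{dx\,dy}{\pi}$ the normalized area measure on it. A radial weight is a non-negative function $\omega\in L^1(\mathbb{D})$ with $\omega(z)=\omega(|z|)$ for all $z\in\mathbb{D}$ and with $\widehat\omega(z)=\int_{|z|}^1\omega(s)\,ds>0$ for all $z\in\mathbb{D}$. Write $\omega\in\mathcal{D}$ if $\omega$ is a radial weight for which there are constants $C_1\ge1$, $K>1$ and $C_2>1$ such that $$\widehat\omega(r)\le C_1\,\widehat\omega\Big(\frac{1+r}{2}\Big)\quad\text{and}\quad \widehat\omega(r)\ge C_2\,\widehat\omega\Big(1-\frac{1-r}{K}\Big),\qquad 0\le r<1.$$ For $0<p<\infty$, $A^p_\omega$ is the space of analytic functions $g$ on $\mathbb{D}$ with $\|g\|_{A^p_\omega}^p=\int_{\mathbb{D}}|g|^p\,\omega\,dA<\infty$. For a radial weight $\nu$ let $\nu_{\log}(z)=\nu(z)\log\frac{e}{1-|z|}$, let $B^\nu_z$ be the reproducing kernel of $A^2_\nu$ at $z\in\mathbb{D}$, and for $f\in A^1_{\nu_{\log}}$ let $$h^\nu_f(g)(z)=\int_{\mathbb{D}}f(\zeta)\,\overline{g(\zeta)B^\nu_z(\zeta)}\,\nu(\zeta)\,dA(\zeta),\qquad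 z\in\mathbb{D},$$ be the small Hankel operator, defined for bounded analytic functions $g$ on $\mathbb{D}$, which are dense in $A^p_\omega$. It is said to be bounded from $A^p_\omega$ to $A^q_\nu$ if it extends to a bounded conjugate-linear operator $A^p_\omega\to A^q_\nu$; $\|h^\nu_f\|_{A^p_\omega\to A^q_\nu}$ is the norm of this extension, and is $\infty$ if there is none. Theorem. Let $1<q<p<\infty$ and $\omega,\nu\in\mathcal{D}$. For analytic $f$ on $\mathbb{D}$ and $n\in\mathbb{N}\cup\{0\}$ put $$I_n(f)=\int_{\mathbb{D}}|f^{(n)}(z)|^{\frac{pq}{p-q}}(1-|z|)^{n\frac{pq}{p-q}}\left(\frac{\widehat\nu(z)}{\widehat\omega(z)}\right)^{\frac{p}{p-q}}\frac{\widehat\omega(z)}{1-|z|}\,dA(z).$$ There exists $N=N(\omega,\nu,p,q)\in\mathbb{N}\cup\{0\}$ such that the following hold. (i) For every $f\in A^1_{\nu_{\log}}$ the following are equivalent: $h^\nu_f:A^p_\omega\to A^q_\nu$ is bounded; $I_n(f)<\infty$ for some $n\ge N$; $I_n(f)<\infty$ for all $n\ge N$. (ii) For each fixed $n\ge N$ there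 is a constant $C>0$, depending only on $\omega,\nu,p,q,n$, such that for every $f\in A^1_{\nu_{\log}}$ $$C^{-1}\Big(I_n(f)+\sum_{j=0}^{n-1}|f^{(j)}(0)|^{\frac{pq}{p-q}}\Big)\le\|h^\nu_f\|_{A^p_\omega\to A^q_\nu}^{\frac{pq}{p-q}}\le C\Big(I_n(f)+\sum_{j=0}^{n-1}|f^{(j)}(0)|^{\frac{pq}{p-q}}\Big).$$ -/

import Mathlib

open MeasureTheory Set
open scoped ENNReal NNReal ComplexConjugate

namespace SmallHankel

noncomputable section

/-- The open unit disc. -/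
abbrev disc : Set ℂ := Metric.ball (0 : ℂ) 1

/-- The normalized area measure `dx dy / π` on the unit disc. -/
def areaMeasure : Measure ℂ := (ENNReal.ofReal Real.pi)⁻¹ • volume.restrict disc

/-- The measure `ω dA` on the unit disc. -/
def weightMeasure (ω : ℂ → ℝ) : Measure ℂ :=
  areaMeasure.withDensity fun z => ENNReal.ofReal (ω z)

/-- The tail integral `∫_r^1 ω(s) ds`, as an extended non-negative number. -/
def tail (ω : ℂ → ℝ) (r : ℝ) : ℝ≥0∞ := ∫⁻ s in Ioo r 1, ENNReal.ofReal (ω (s : ℂ))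

/-- Radial weights: non-negative, radial, integrable functions on the disc whose tail integrals
are strictly positive. Only the values on the disc matter. -/
structure IsRadialWeight (ω : ℂ → ℝ) : Prop where
  nonneg : ∀ z ∈ disc, 0 ≤ ω z
  radial : ∀ z ∈ disc, ω z = ω ((‖z‖ : ℝ) : ℂ)
  integrable : IntegrableOn ω disc volume
  tail_pos : ∀ r : ℝ, 0 ≤ r → r < 1 → 0 < tail ω r

/-- The upper doubling condition. -/
def UpperDoubling (ω : ℂ → ℝ) : Prop :=
  ∃ C : ℝ≥0, 1 ≤ C ∧ ∀ r : ℝ, 0 ≤ r → r < 1 → tail ω r ≤ C * tail ω ((1 + r) / 2)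

/-- The lower (reverse) doubling condition. -/
def LowerDoubling (ω : ℂ → ℝ) : Prop :=
  ∃ (K : ℝ) (C : ℝ≥0), 1 < K ∧ 1 < C ∧
    ∀ r : ℝ, 0 ≤ r → r < 1 → C * tail ω (1 - (1 - r) / K) ≤ tail ω r

/-- The class `𝒟` of radial weights satisfying both doubling conditions. -/
structure IsDoublingWeight (ω : ℂ → ℝ) : Prop extends IsRadialWeight ω where
  upper : UpperDoubling ω
  lower : LowerDoubling ω

/-- The norm of `L^p_ω`, for a real exponent `p > 0`. -/
def weightedNorm (p : ℝ) (ω : ℂ → ℝ) (f : ℂ → ℂ) : ℝ≥0∞ :=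
  eLpNorm f (ENNReal.ofReal p) (weightMeasure ω)

/-- The weighted Bergman space `A^p_ω`: functions that are analytic on the disc and belong to
`L^p_ω`. Elements are functions on `ℂ`, of which only the values on the disc matter. -/
def bergmanSpace (p : ℝ) (ω : ℂ → ℝ) : Submodule ℂ (ℂ → ℂ) where
  carrier := {f | DifferentiableOn ℂ f disc ∧ MemLp f (ENNReal.ofReal p) (weightMeasure ω)}
  zero_mem' := ⟨differentiableOn_const 0, MemLp.zero⟩
  add_mem' hf hg := ⟨hf.1.add hg.1, hf.2.add hg.2⟩
  smul_mem' c _ hf := ⟨hf.1.const_smul c, hf.2.const_smul c⟩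

/-- The weight `ν_log`, that is `log (e / (1 - |z|)) ν(z)`. -/
def logWeight (ν : ℂ → ℝ) (z : ℂ) : ℝ := Real.log (Real.exp 1 / (1 - ‖z‖)) * ν z

/-- `K` is the reproducing kernel of the Hilbert space `A²_ν` at the point `z`. -/
def IsReproducingKernelAt (ν : ℂ → ℝ) (z : ℂ) (K : ℂ → ℂ) : Prop :=
  K ∈ bergmanSpace 2 ν ∧
    ∀ f ∈ bergmanSpace 2 ν, f z = ∫ ζ, f ζ * conj (K ζ) ∂(weightMeasure ν)

open Classical in
/-- The reproducing kernel `B^ν_z` of `A²_ν` at `z`; it is determined on the disc by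
`IsReproducingKernelAt`. -/
def bergmanKernel (ν : ℂ → ℝ) (z : ℂ) : ℂ → ℂ :=
  if h : ∃ K, IsReproducingKernelAt ν z K then h.choose else 0

/-- The small Hankel operator `h^ν_f(g)(z) = ∫ f conj(g B^ν_z) ν dA`, given by an integral that
converges absolutely for bounded analytic `g` and `f ∈ A¹_ν`. -/
def smallHankel (ν : ℂ → ℝ) (f g : ℂ → ℂ) (z : ℂ) : ℂ :=
  ∫ ζ, f ζ * conj (g ζ * bergmanKernel ν z ζ) ∂(weightMeasure ν)

/-- `T` extends the small Hankel operator from the bounded analytic functions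
(a dense subspace of `A^p_ω`) to a conjugate-linear map from `A^p_ω` to `A^q_ν`. -/
def ExtendsSmallHankel (p q : ℝ) (ω ν : ℂ → ℝ) (f : ℂ → ℂ)
    (T : bergmanSpace p ω →ₛₗ[starRingEnd ℂ] bergmanSpace q ν) : Prop :=
  ∀ g : bergmanSpace p ω, (∃ M : ℝ, ∀ z ∈ disc, ‖(g : ℂ → ℂ) z‖ ≤ M) →
    EqOn (T g : ℂ → ℂ) (smallHankel ν f g) disc

/-- The small Hankel operator extends to an operator from `A^p_ω` to `A^q_ν` whose norm is
at most `C`. -/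
def IsSmallHankelBound (p q : ℝ) (ω ν : ℂ → ℝ) (f : ℂ → ℂ) (C : ℝ≥0) : Prop :=
  ∃ T : bergmanSpace p ω →ₛₗ[starRingEnd ℂ] bergmanSpace q ν,
    ExtendsSmallHankel p q ω ν f T ∧
      ∀ g : bergmanSpace p ω, weightedNorm q ν (T g) ≤ C * weightedNorm p ω g

/-- `h^ν_f : A^p_ω → A^q_ν` is bounded. -/
def SmallHankelBounded (p q : ℝ) (ω ν : ℂ → ℝ) (f : ℂ → ℂ) : Prop :=
  ∃ C : ℝ≥0, IsSmallHankelBound p q ω ν f C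

/-- The operator norm of `h^ν_f : A^p_ω → A^q_ν`, the least bound; it is `∞` if the operator is
not bounded. -/
def smallHankelNorm (p q : ℝ) (ω ν : ℂ → ℝ) (f : ℂ → ℂ) : ℝ≥0∞ :=
  ⨅ (C : ℝ≥0) (_ : IsSmallHankelBound p q ω ν f C), (C : ℝ≥0∞)

/-- The integral of
`|f^(n)|^(pq/(p-q)) (1-|z|)^(npq/(p-q)) (ν̂/ω̂)^(p/(p-q)) ω̂/(1-|z|)` over the disc. -/
def symbolIntegral (p q : ℝ) (ω ν : ℂ → ℝ) (f : ℂ → ℂ) (n : ℕ) : ℝ≥0∞ :=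
  ∫⁻ z, ‖iteratedDeriv n f z‖ₑ ^ (p * q / (p - q)) *
    ENNReal.ofReal (1 - ‖z‖) ^ (n * (p * q / (p - q))) *
    (tail ν ‖z‖ / tail ω ‖z‖) ^ (p / (p - q)) *
    (tail ω ‖z‖ / ENNReal.ofReal (1 - ‖z‖)) ∂areaMeasure

end

end SmallHankel

open MeasureTheory Set
open scoped ENNReal NNReal ComplexConjugate

namespace SmallHankel

noncomputable section

/-! Write s = pq/(p-q) and ω̂, ν̂ for the tails. The two doubling conditions say that tails vary
between two powers of 1-r (`exists_tl_le_mul_pow`, `exists_tl_le_mul_rpow`), so that on dyadic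
annuli they behave like geometric sequences. Monomials are orthogonal for a radial weight, hence the
reproducing kernel is ∑ (z̄ζ)^k / M_k with M_k the even moments of ν. These moments, together with
their finite differences, are controlled by ν̂(1-1/(k+1)). Repeated summation by parts then bounds
the differentiated kernel series at w by 2^{j(n+1)} / ν̂(1-2^{-j}) whenever |1-w| ≥ 2^{-j}
(`exists_norm_kernel_le`). All kernels are thus dominated by the positive model `kern`, for which
Schur's test is a matter of geometric series (`exists_schur`).

Upper bound. Parseval on circles moves a derivative onto the symbol: the pairing of f with g·B_z
against ν dA equals the pairing of (z^n f)^(n) with g·B_z against a radial measure of density at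
most a constant times (1-|ζ|)^n ν̂/(1-|ζ|) (`integral_mul_conj_eq_pderiv`,
`invMeasure_radialPart_le`). Schur's test removes the kernel, and Hölder's inequality with exponents
p/q and p/(p-q) separates g from f and produces the weight of the symbol integral. The norm of g for
ω̂/(1-|z|) is controlled by its A^p_ω norm because integral means increase (`imean_mono`). A Hardy
inequality on rays replaces (z^n f)^(n) by f^(n) and the values f^(j)(0), j < n.

Lower bound. The derivative of the kernel is factored as (1-w)^{-γ} times (1-w)^γ ∂^n B, with w =
z̄ζ. Finite sums of the two factors over dyadic rectangles are the test functions on the two sides;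
their norms are bounded by Schur's test again. The pairing of their images is a double sum whose
diagonal consists of the numbers |f^(n)(z_k)|, and a choice of signs discards the off-diagonal part
(`exists_signs`). Optimal coefficients turn the estimate into S ≤ K‖h‖ S^{1-1/s} for the discrete
sum S, that is S ≤ (K‖h‖)^s (`exists_sum_rpow_le`). With sample points z_k at which |f^(n)|^s is at
least its mean over the rectangle, S controls the integral. The values f^(j)(0) come from testing on
the constant 1.

The order N has two sources: the weight of the symbol integral must be almost decreasing, and n ≥ γ,
where γ is dictated by the upper doubling of ω. -/

/-! ### Polar coordinates and radial measures. -/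

/-- The normalized arc measure, in the angular coordinate. -/
def circ : Measure ℝ := (ENNReal.ofReal (2 * Real.pi))⁻¹ • volume.restrict (Ioo (-Real.pi) Real.pi)

/-- Polar coordinates. -/
def polar (p : ℝ × ℝ) : ℂ := p.1 * Complex.exp (p.2 * Complex.I)

/-- The rotation invariant measure on the plane with radial part `ρ`. -/
def polarMeasure (ρ : Measure ℝ) : Measure ℂ := (ρ.prod circ).map polar

/-- The radial part of the measure `ω dA`. -/
def radialPart (ω : ℂ → ℝ) : Measure ℝ :=
  (volume.restrict (Ioo 0 1)).withDensity fun r => ENNReal.ofReal (2 * r * ω (r : ℂ))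

lemma continuous_polar : Continuous polar := by unfold polar; fun_prop

lemma measurable_polar : Measurable polar := continuous_polar.measurable

lemma norm_polar (r θ : ℝ) : ‖polar (r, θ)‖ = |r| := by
  simp [polar, Complex.norm_exp_ofReal_mul_I]

lemma polarCoord_symm_eq (p : ℝ × ℝ) : Complex.polarCoord.symm p = polar p := by
  rw [Complex.polarCoord_symm_apply, polar, Complex.exp_mul_I]
  simp

instance : IsProbabilityMeasure circ := ⟨by
  have h : ENNReal.ofReal (2 * Real.pi) ≠ 0 := by simp [Real.pi_pos]
  rw [circ, Measure.smul_apply, Measure.restrict_apply_univ, Real.volume_Ioo, smul_eq_mul,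
    show Real.pi - -Real.pi = 2 * Real.pi by ring, ENNReal.inv_mul_cancel h ENNReal.ofReal_ne_top]⟩

lemma ae_polar {P : ℂ → Prop} (h : ∀ᵐ z ∂(volume.restrict disc), P z) :
    ∀ᵐ p ∂((volume.restrict (Ioo (0 : ℝ) 1)).prod (volume.restrict (Ioo (-Real.pi) Real.pi))),
      P (polar p) := by
  have h0 := (ae_restrict_iff' (μ := volume) measurableSet_ball).1 h
  set N := toMeasurable volume {z | ¬ (z ∈ disc → P z)} with hN
  have hN0 : volume N = 0 := by rw [hN, measure_toMeasurable]; exact h0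
  have hNm : MeasurableSet N := measurableSet_toMeasurable _ _
  have h1 := Complex.lintegral_comp_polarCoord_symm (N.indicator 1)
  rw [lintegral_indicator_one hNm, hN0, lintegral_eq_zero_iff] at h1
  · rw [Measure.prod_restrict, ← Measure.volume_eq_prod]
    have hsub : Ioo (0 : ℝ) 1 ×ˢ Ioo (-Real.pi) Real.pi ⊆ polarCoord.target := by
      rw [polarCoord_target]
      exact prod_mono Ioo_subset_Ioi_self le_rfl
    have h2 := ae_restrict_of_ae_restrict_of_subset hsub h1
    filter_upwards [h2, ae_restrict_mem (measurableSet_Ioo.prod measurableSet_Ioo)] with p hp hp2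
    by_contra hcon
    have hp3 : polar p ∈ disc := by
      rw [mem_ball_zero_iff, show p = (p.1, p.2) from rfl, norm_polar, abs_of_pos hp2.1.1]
      exact hp2.1.2
    have hpN : polar p ∈ N := subset_toMeasurable _ _ (fun h => hcon (h hp3))
    rw [polarCoord_symm_eq, indicator_of_mem hpN] at hp
    have := hp2.1.1
    simp at hp
    linarith
  · apply Measurable.mul (by fun_prop)
    apply Measurable.comp (measurable_one.indicator hNm)
    simp_rw [funext polarCoord_symm_eq]
    exact measurable_polar

/-- In polar coordinates the weight does not depend on the angle. By Fubini almost every section in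
the angle is almost everywhere measurable, and every section is the radial profile itself, so one
good angle suffices. -/
lemma aemeasurable_radial {ω : ℂ → ℝ} (hω : IsRadialWeight ω) :
    AEMeasurable (fun r : ℝ => ω (r : ℂ)) (volume.restrict (Ioo (0 : ℝ) 1)) := by
  obtain ⟨F, hFm, hF⟩ := hω.integrable.aestronglyMeasurable
  have h1 := ae_polar hF
  have h2 : AEStronglyMeasurable (fun p : ℝ × ℝ => ω (p.1 : ℂ))
      ((volume.restrict (Ioo (0 : ℝ) 1)).prod (volume.restrict (Ioo (-Real.pi) Real.pi))) := by
    refine ⟨fun p => F (polar p), hFm.comp_measurable measurable_polar, ?_⟩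
    have h3 : ∀ᵐ p ∂((volume.restrict (Ioo (0 : ℝ) 1)).prod
        (volume.restrict (Ioo (-Real.pi) Real.pi))), p ∈ Ioo (0 : ℝ) 1 ×ˢ Ioo (-Real.pi) Real.pi := by
      rw [Measure.prod_restrict]
      exact ae_restrict_mem (measurableSet_Ioo.prod measurableSet_Ioo)
    filter_upwards [h1, h3] with p hp hp3
    rw [← hp]
    have hn : ‖polar p‖ = p.1 := by
      rw [show p = (p.1, p.2) from rfl, norm_polar, abs_of_pos hp3.1.1]
    have := hω.radial (polar p) (by rw [mem_ball_zero_iff, hn]; exact hp3.1.2)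
    rw [this, hn]
  have h4 := h2.prod_swap.prodMk_left
  have h5 : (ae (volume.restrict (Ioo (-Real.pi) Real.pi))).NeBot := by
    rw [ae_neBot, Ne, Measure.restrict_eq_zero, Real.volume_Ioo]
    simp [Real.pi_pos]
  obtain ⟨θ, hθ⟩ := h4.exists
  exact hθ.aemeasurable


/-- Since dx dy/π = 2r dr · dθ/(2π), a radial density g becomes 2 r g(r) on the radial side. It
serves both for the weights and for the weight of the symbol integral. -/
lemma setLIntegral_area_eq_polar (g : ℝ → ℝ≥0∞) (hg : AEMeasurable g (volume.restrict (Ioo 0 1)))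
    {E : Set ℂ} (hE : MeasurableSet E) (h : ℂ → ℝ≥0∞) (hgh : ∀ z ∈ disc, h z = g ‖z‖) :
    ∫⁻ z in E, h z ∂areaMeasure =
      polarMeasure ((volume.restrict (Ioo 0 1)).withDensity
        fun r => ENNReal.ofReal (2 * r) * g r) E := by
  have hpi : ENNReal.ofReal (2 * Real.pi) ≠ 0 := by simp [Real.pi_pos]
  have hS : ∫⁻ z in E, h z ∂areaMeasure =
      (ENNReal.ofReal Real.pi)⁻¹ * ∫⁻ z, (E ∩ disc).indicator h z := by
    rw [areaMeasure, Measure.restrict_smul, lintegral_smul_measure, Measure.restrict_restrict hE,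
      lintegral_indicator (hE.inter measurableSet_ball), smul_eq_mul]
  have hgm : AEMeasurable (fun r => ENNReal.ofReal (2 * r) * g r) (volume.restrict (Ioo 0 1)) :=
    AEMeasurable.mul (by fun_prop) hg
  rw [hS, ← Complex.lintegral_comp_polarCoord_symm, polarMeasure,
    Measure.map_apply measurable_polar hE, Measure.prod_apply (measurable_polar hE),
    lintegral_withDensity_eq_lintegral_mul₀ hgm
      (measurable_measure_prodMk_left (measurable_polar hE)).aemeasurable]
  have h1 : ∫⁻ p in polarCoord.target, ENNReal.ofReal p.1 •
      (E ∩ disc).indicator h (Complex.polarCoord.symm p) =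
      ∫⁻ p in Ioo (0 : ℝ) 1 ×ˢ Ioo (-Real.pi) Real.pi,
        (ENNReal.ofReal p.1 * g p.1) * (polar ⁻¹' E).indicator 1 p := by
    have hm : MeasurableSet (Ioo (0 : ℝ) 1 ×ˢ Ioo (-Real.pi) Real.pi) :=
      measurableSet_Ioo.prod measurableSet_Ioo
    rw [← lintegral_indicator (by rw [polarCoord_target]; exact measurableSet_Ioi.prod measurableSet_Ioo),
      ← lintegral_indicator hm]
    congr 1
    ext p
    by_cases hp : p ∈ polarCoord.target
    · rw [indicator_of_mem hp, polarCoord_symm_eq]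
      rw [polarCoord_target] at hp
      have hn : ‖polar p‖ = p.1 := by
        rw [show p = (p.1, p.2) from rfl, norm_polar, abs_of_pos hp.1]
      by_cases hp1 : p.1 < 1
      · rw [indicator_of_mem (show p ∈ Ioo (0 : ℝ) 1 ×ˢ Ioo (-Real.pi) Real.pi from
          ⟨⟨hp.1, hp1⟩, hp.2⟩)]
        have hd : polar p ∈ disc := by rw [mem_ball_zero_iff, hn]; exact hp1
        by_cases hpE : polar p ∈ E
        · rw [indicator_of_mem (show polar p ∈ E ∩ disc from ⟨hpE, hd⟩), hgh _ hd, hn,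
            indicator_of_mem (by exact hpE)]
          simp
        · rw [indicator_of_notMem (show polar p ∉ E ∩ disc from fun h => hpE h.1),
            indicator_of_notMem (by exact hpE)]
          simp
      · rw [indicator_of_notMem (show polar p ∉ E ∩ disc from ?_), indicator_of_notMem
          (show p ∉ Ioo (0 : ℝ) 1 ×ˢ Ioo (-Real.pi) Real.pi from fun h => hp1 h.1.2)]
        · simp
        · intro h
          have := h.2
          rw [mem_ball_zero_iff, hn] at this
          exact hp1 this
    · rw [indicator_of_notMem hp, indicator_of_notMem]
      intro h
      apply hp
      rw [polarCoord_target]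
      exact ⟨h.1.1, h.2⟩
  rw [h1, Measure.volume_eq_prod, ← Measure.prod_restrict, lintegral_prod]
  · rw [← lintegral_const_mul'' ]
    · apply lintegral_congr
      intro r
      have h2 : ∫⁻ y in Ioo (-Real.pi) Real.pi, ENNReal.ofReal r * g r * (polar ⁻¹' E).indicator 1 (r, y)
          = ENNReal.ofReal r * g r * volume.restrict (Ioo (-Real.pi) Real.pi)
            (Prod.mk r ⁻¹' (polar ⁻¹' E)) := by
        have hm' : Measurable fun y => (polar ⁻¹' E).indicator (1 : ℝ × ℝ → ℝ≥0∞) (r, y) :=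
          (measurable_one.indicator (measurable_polar hE)).comp measurable_prodMk_left
        rw [lintegral_const_mul _ hm', ← lintegral_indicator_one
            (measurable_prodMk_left (measurable_polar hE))]
        rfl
      have h3 : (ENNReal.ofReal Real.pi)⁻¹ = 2 * (ENNReal.ofReal (2 * Real.pi))⁻¹ := by
        rw [ENNReal.ofReal_mul (by norm_num), ENNReal.mul_inv (by simp) (by simp), ← mul_assoc]
        simp [ENNReal.mul_inv_cancel]
      rw [h2, circ]
      simp only [Pi.mul_apply, Measure.smul_apply, smul_eq_mul]
      rw [ENNReal.ofReal_mul (by norm_num : (0 : ℝ) ≤ 2), h3]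
      simp only [ENNReal.ofReal_ofNat]
      ring
    · apply AEMeasurable.lintegral_prod_right'
        (f := fun p : ℝ × ℝ => ENNReal.ofReal p.1 * g p.1 * (polar ⁻¹' E).indicator 1 p)
      apply AEMeasurable.mul
      · exact AEMeasurable.mul (by fun_prop) (hg.comp_fst)
      · exact (measurable_one.indicator (measurable_polar hE)).aemeasurable
  · apply AEMeasurable.mul
    · exact AEMeasurable.mul (by fun_prop) (hg.comp_fst)
    · exact (measurable_one.indicator (measurable_polar hE)).aemeasurable

lemma weightMeasure_eq_polarMeasure {ω : ℂ → ℝ} (hω : IsRadialWeight ω) :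
    weightMeasure ω = polarMeasure (radialPart ω) := by
  ext E hE
  rw [weightMeasure, withDensity_apply _ hE, setLIntegral_area_eq_polar
    (fun r => ENNReal.ofReal (ω (r : ℂ))) (aemeasurable_radial hω).ennreal_ofReal hE]
  · rw [radialPart]
    congr 2
    apply withDensity_congr_ae
    filter_upwards [ae_restrict_mem measurableSet_Ioo] with r hr
    exact (ENNReal.ofReal_mul (by linarith [hr.1])).symm
  · intro z hz
    rw [hω.radial z hz]

instance (ω : ℂ → ℝ) : SFinite (radialPart ω) := by unfold radialPart; infer_instance

lemma radialPart_univ_lt_top {ω : ℂ → ℝ} (hω : IsRadialWeight ω) : radialPart ω univ < ∞ := by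
  have h1 : weightMeasure ω univ = radialPart ω univ := by
    rw [weightMeasure_eq_polarMeasure hω, polarMeasure, Measure.map_apply measurable_polar .univ,
      preimage_univ, Measure.prod_apply .univ]
    simp
  rw [← h1, weightMeasure, withDensity_apply _ .univ, Measure.restrict_univ, areaMeasure,
    lintegral_smul_measure]
  exact ENNReal.mul_lt_top (by simp [Real.pi_pos]) hω.integrable.lintegral_lt_top

lemma isFiniteMeasure_radialPart {ω : ℂ → ℝ} (hω : IsRadialWeight ω) :
    IsFiniteMeasure (radialPart ω) := ⟨radialPart_univ_lt_top hω⟩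

lemma isFiniteMeasure_polarMeasure (ρ : Measure ℝ) [IsFiniteMeasure ρ] :
    IsFiniteMeasure (polarMeasure ρ) := by unfold polarMeasure; infer_instance

lemma isFiniteMeasure_weightMeasure {ω : ℂ → ℝ} (hω : IsRadialWeight ω) :
    IsFiniteMeasure (weightMeasure ω) := by
  have := isFiniteMeasure_radialPart hω
  rw [weightMeasure_eq_polarMeasure hω]
  exact isFiniteMeasure_polarMeasure _

lemma lintegral_polarMeasure (ρ : Measure ℝ) [SFinite ρ] {F : ℂ → ℝ≥0∞}
    (hF : AEMeasurable F (polarMeasure ρ)) :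
    ∫⁻ z, F z ∂(polarMeasure ρ) = ∫⁻ r, ∫⁻ θ, F (polar (r, θ)) ∂circ ∂ρ := by
  have h := hF.comp_measurable measurable_polar
  rw [polarMeasure, lintegral_map' hF measurable_polar.aemeasurable,
    lintegral_prod (fun p => F (polar p)) h]

lemma integral_polarMeasure (ρ : Measure ℝ) [SFinite ρ] {F : ℂ → ℂ}
    (hF : Integrable F (polarMeasure ρ)) :
    ∫ z, F z ∂(polarMeasure ρ) = ∫ r, ∫ θ, F (polar (r, θ)) ∂circ ∂ρ := by
  have h := hF.comp_measurable measurable_polar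
  rw [polarMeasure, integral_map measurable_polar.aemeasurable hF.aestronglyMeasurable,
    integral_prod (fun p => F (polar p)) h]

lemma ae_polarMeasure {ρ : Measure ℝ} [SFinite ρ] {P : ℂ → Prop} (hP : MeasurableSet {z | P z})
    (h : ∀ᵐ r ∂ρ, ∀ θ, P (polar (r, θ))) : ∀ᵐ z ∂(polarMeasure ρ), P z := by
  rw [polarMeasure, ae_map_iff measurable_polar.aemeasurable hP]
  refine (Measure.ae_prod_iff_ae_ae (p := fun x => P (polar x)) (measurable_polar hP)).2 ?_
  filter_upwards [h] with r hr
  exact .of_forall hr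

lemma ae_polarMeasure_mem_disc {ρ : Measure ℝ} [SFinite ρ] (hρ : ∀ᵐ r ∂ρ, r ∈ Ioo (0 : ℝ) 1) :
    ∀ᵐ z ∂(polarMeasure ρ), z ∈ disc := by
  apply ae_polarMeasure measurableSet_ball
  filter_upwards [hρ] with r hr θ
  rw [dist_zero_right, norm_polar, abs_of_pos hr.1]
  exact hr.2

lemma ae_radialPart (ω : ℂ → ℝ) : ∀ᵐ r ∂(radialPart ω), r ∈ Ioo (0 : ℝ) 1 :=
  (withDensity_absolutelyContinuous _ _).ae_le (ae_restrict_mem measurableSet_Ioo)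

lemma tail_antitone (ω : ℂ → ℝ) : Antitone (tail ω) := fun _ _ h =>
  lintegral_mono_set (Ioo_subset_Ioo_left h)

lemma radialPart_Ioo (ω : ℂ → ℝ) {x : ℝ} (hx : 0 ≤ x) :
    radialPart ω (Ioo x 1) = ∫⁻ r in Ioo x 1, ENNReal.ofReal (2 * r * ω (r : ℂ)) := by
  rw [radialPart, withDensity_apply _ measurableSet_Ioo, Measure.restrict_restrict measurableSet_Ioo,
    inter_eq_left.2 (Ioo_subset_Ioo_left hx)]

lemma ofReal_mul_tail_le {ω : ℂ → ℝ} (hω : IsRadialWeight ω) {x : ℝ} (hx : 0 ≤ x) :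
    ENNReal.ofReal (2 * x) * tail ω x ≤ radialPart ω (Ioo x 1) := by
  rw [radialPart_Ioo ω hx, tail, ← lintegral_const_mul' _ _ ENNReal.ofReal_ne_top]
  apply setLIntegral_mono' measurableSet_Ioo
  intro r hr
  rw [← ENNReal.ofReal_mul (by linarith)]
  apply ENNReal.ofReal_le_ofReal
  have := hω.nonneg (r : ℂ) (by
    rw [mem_ball_zero_iff, Complex.norm_real, Real.norm_eq_abs, abs_of_pos (by linarith [hr.1])]
    exact hr.2)
  gcongr
  exact hr.1.le

lemma radialPart_Ioo_le {ω : ℂ → ℝ} (hω : IsRadialWeight ω) {x : ℝ} (hx : 0 ≤ x) :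
    radialPart ω (Ioo x 1) ≤ 2 * tail ω x := by
  rw [radialPart_Ioo ω hx, tail, ← lintegral_const_mul' _ _ (by simp)]
  apply setLIntegral_mono' measurableSet_Ioo
  intro r hr
  have h0 : (2 : ℝ≥0∞) = ENNReal.ofReal 2 := by simp
  rw [h0, ← ENNReal.ofReal_mul (by linarith)]
  apply ENNReal.ofReal_le_ofReal
  have := hω.nonneg (r : ℂ) (by
    rw [mem_ball_zero_iff, Complex.norm_real, Real.norm_eq_abs, abs_of_pos (by linarith [hr.1])]
    exact hr.2)
  gcongr
  linarith [hr.2]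

/-- Integrability over the disc controls only the integral of r ω(r), which says nothing near r = 0.
The tail at 1/2 is finite by it, and upper doubling at 0 carries this to the tail at 0. -/
lemma tail_lt_top {ω : ℂ → ℝ} (hω : IsDoublingWeight ω) {x : ℝ} (hx : 0 ≤ x) : tail ω x < ∞ := by
  have h2 : tail ω (1 / 2) < ∞ := by
    have h := ofReal_mul_tail_le hω.toIsRadialWeight (x := 1 / 2) (by norm_num)
    simp only [one_div, ne_eq, OfNat.ofNat_ne_zero, not_false_eq_true, mul_inv_cancel₀,
      ENNReal.ofReal_one, one_mul] at h
    rw [one_div]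
    exact h.trans_lt ((measure_mono (subset_univ _)).trans_lt (radialPart_univ_lt_top hω.toIsRadialWeight))
  obtain ⟨C, -, hC⟩ := hω.upper
  refine (tail_antitone ω hx).trans_lt ((hC 0 le_rfl one_pos).trans_lt ?_)
  rw [add_zero]
  exact ENNReal.mul_lt_top ENNReal.coe_lt_top h2

/-! ### Doubling conditions as power bounds for the tails. -/

/-- The tail integral, as a real number. -/
def tl (ω : ℂ → ℝ) (r : ℝ) : ℝ := (tail ω r).toReal

lemma ofReal_tl {ω : ℂ → ℝ} (hω : IsDoublingWeight ω) {x : ℝ} (hx : 0 ≤ x) :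
    ENNReal.ofReal (tl ω x) = tail ω x := ENNReal.ofReal_toReal (tail_lt_top hω hx).ne

lemma tl_pos {ω : ℂ → ℝ} (hω : IsDoublingWeight ω) {x : ℝ} (hx : 0 ≤ x) (hx1 : x < 1) :
    0 < tl ω x := ENNReal.toReal_pos (hω.tail_pos x hx hx1).ne' (tail_lt_top hω hx).ne

lemma tl_anti {ω : ℂ → ℝ} (hω : IsDoublingWeight ω) {x y : ℝ} (hx : 0 ≤ x) (hxy : x ≤ y) :
    tl ω y ≤ tl ω x := ENNReal.toReal_mono (tail_lt_top hω hx).ne (tail_antitone ω hxy)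

/-- Upper doubling in the form of a power bound. -/
lemma exists_tl_le_mul_pow {ω : ℂ → ℝ} (hω : IsDoublingWeight ω) :
    ∃ (C : ℝ) (β : ℕ), 1 ≤ C ∧ ∀ x r : ℝ, 0 ≤ x → x ≤ r → r < 1 →
      tl ω x ≤ C * ((1 - x) / (1 - r)) ^ β * tl ω r := by
  obtain ⟨C, hC1, hC⟩ := hω.upper
  have hstep : ∀ r : ℝ, 0 ≤ r → r < 1 → tl ω r ≤ C * tl ω ((1 + r) / 2) := by
    intro r hr hr1
    have h1 := hC r hr hr1
    have h2 := ENNReal.toReal_mono (ENNReal.mul_lt_top ENNReal.coe_lt_top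
      (tail_lt_top hω (x := (1 + r) / 2) (by linarith))).ne h1
    simpa [tl, ENNReal.toReal_mul] using h2
  have hiter : ∀ (k : ℕ) (r : ℝ), 0 ≤ r → r < 1 →
      tl ω r ≤ (C : ℝ) ^ k * tl ω (1 - (1 - r) / 2 ^ k) := by
    intro k
    induction k with
    | zero => intro r _ _; simp
    | succ k ih =>
      intro r hr hr1
      have hp : (0 : ℝ) < 2 ^ k := by positivity
      have h3 : (1 - r) / 2 ^ k ≤ 1 := by
        rw [div_le_one hp]
        have : (1 : ℝ) ≤ 2 ^ k := one_le_pow₀ (by norm_num)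
        linarith
      have h4 : 0 < (1 - r) / 2 ^ k := div_pos (by linarith) hp
      have h5 := hstep (1 - (1 - r) / 2 ^ k) (by linarith) (by linarith)
      rw [show (1 + (1 - (1 - r) / 2 ^ k)) / 2 = 1 - (1 - r) / 2 ^ (k + 1) by
        rw [pow_succ]; field_simp; ring] at h5
      calc tl ω r ≤ (C : ℝ) ^ k * tl ω (1 - (1 - r) / 2 ^ k) := ih r hr hr1
        _ ≤ (C : ℝ) ^ k * (C * tl ω (1 - (1 - r) / 2 ^ (k + 1))) := by gcongr
        _ = _ := by ring
  obtain ⟨β, hβ⟩ : ∃ β : ℕ, (C : ℝ) ≤ 2 ^ β := 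
    (pow_unbounded_of_one_lt (C : ℝ) (by norm_num : (1 : ℝ) < 2)).imp fun _ h => h.le
  have hC1' : (1 : ℝ) ≤ C := by exact_mod_cast hC1
  refine ⟨2 ^ β, β, one_le_pow₀ (by norm_num), fun x r hx hxr hr => ?_⟩
  have hr0 : 0 < 1 - r := by linarith
  have hq : 1 ≤ (1 - x) / (1 - r) := by rw [le_div_iff₀ hr0]; linarith
  -- After k + 1 halvings of 1 - x the point r is passed, and 2^k is at most (1-x)/(1-r). As C ≤
  -- 2^β, the accumulated constant C^(k+1) is at most 2^β times the β-th power of this ratio.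
  obtain ⟨k, hk1, hk2⟩ := exists_nat_pow_near hq (by norm_num : (1 : ℝ) < 2)
  have h1 : tl ω (1 - (1 - x) / 2 ^ (k + 1)) ≤ tl ω r := by
    apply tl_anti hω (by linarith)
    have : (1 - x) / 2 ^ (k + 1) ≤ 1 - r := by
      rw [div_le_iff₀ (by positivity), mul_comm, ← div_le_iff₀ hr0]
      exact hk2.le
    linarith
  calc tl ω x ≤ (C : ℝ) ^ (k + 1) * tl ω (1 - (1 - x) / 2 ^ (k + 1)) :=
        hiter _ x hx (by linarith)
    _ ≤ ((2 : ℝ) ^ β) ^ (k + 1) * tl ω r := by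
        gcongr
        exact ENNReal.toReal_nonneg
    _ = 2 ^ β * ((2 : ℝ) ^ k) ^ β * tl ω r := by ring
    _ ≤ _ := by
        gcongr
        exact ENNReal.toReal_nonneg

/-- Lower doubling in the form of a power bound. -/
lemma exists_tl_le_mul_rpow {ω : ℂ → ℝ} (hω : IsDoublingWeight ω) :
    ∃ (C α : ℝ), 1 ≤ C ∧ 0 < α ∧ ∀ x r : ℝ, 0 ≤ x → x ≤ r → r < 1 →
      tl ω r ≤ C * ((1 - r) / (1 - x)) ^ α * tl ω x := by
  obtain ⟨K, C, hK, hC1, hC⟩ := hω.lower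
  have hC1' : (1 : ℝ) < C := by exact_mod_cast hC1
  have hK0 : 0 < K := by linarith
  have hstep : ∀ r : ℝ, 0 ≤ r → r < 1 → C * tl ω (1 - (1 - r) / K) ≤ tl ω r := by
    intro r hr hr1
    have h2 := ENNReal.toReal_mono (tail_lt_top hω hr).ne (hC r hr hr1)
    simpa [tl, ENNReal.toReal_mul] using h2
  have hiter : ∀ (k : ℕ) (r : ℝ), 0 ≤ r → r < 1 →
      (C : ℝ) ^ k * tl ω (1 - (1 - r) / K ^ k) ≤ tl ω r := by
    intro k
    induction k with
    | zero => intro r _ _; simp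
    | succ k ih =>
      intro r hr hr1
      have hp : (0 : ℝ) < K ^ k := by positivity
      have h3 : (1 - r) / K ^ k ≤ 1 := by
        rw [div_le_one hp]
        have : (1 : ℝ) ≤ K ^ k := one_le_pow₀ hK.le
        linarith
      have h4 : 0 < (1 - r) / K ^ k := div_pos (by linarith) hp
      have h5 := hstep (1 - (1 - r) / K ^ k) (by linarith) (by linarith)
      rw [show 1 - (1 - (1 - (1 - r) / K ^ k)) / K = 1 - (1 - r) / K ^ (k + 1) by
        rw [pow_succ]; field_simp; ring] at h5
      calc (C : ℝ) ^ (k + 1) * tl ω (1 - (1 - r) / K ^ (k + 1))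
          = (C : ℝ) ^ k * (C * tl ω (1 - (1 - r) / K ^ (k + 1))) := by ring
        _ ≤ (C : ℝ) ^ k * tl ω (1 - (1 - r) / K ^ k) := by gcongr
        _ ≤ _ := ih r hr hr1
  have hlK : 0 < Real.log K := Real.log_pos hK
  have hlC : 0 < Real.log C := Real.log_pos hC1'
  -- With this exponent K^α = C, so the k gains of a factor C amount to a power of the ratio of
  -- distances; one further factor C pays for the last incomplete step.
  set α := Real.log C / Real.log K with hα
  have hα0 : 0 < α := by positivity
  have hKα : K ^ α = C := by
    rw [Real.rpow_def_of_pos hK0, hα, mul_div_cancel₀ _ hlK.ne', Real.exp_log (by linarith)]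
  refine ⟨C, α, hC1'.le, hα0, fun x r hx hxr hr => ?_⟩
  have hr0 : 0 < 1 - r := by linarith
  have hx0 : 0 < 1 - x := by linarith
  have hq : 1 ≤ (1 - x) / (1 - r) := by rw [le_div_iff₀ hr0]; linarith
  obtain ⟨k, hk1, hk2⟩ := exists_nat_pow_near hq hK
  have h1 : tl ω r ≤ tl ω (1 - (1 - x) / K ^ k) := by
    have h3 : (1 - x) / K ^ k ≤ 1 := by
      rw [div_le_one (by positivity)]
      have : (1 : ℝ) ≤ K ^ k := one_le_pow₀ hK.le
      linarith
    apply tl_anti hω (by linarith)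
    have : 1 - r ≤ (1 - x) / K ^ k := by
      rwa [le_div_iff₀ (by positivity), mul_comm, ← le_div_iff₀ hr0]
    linarith
  have h2 := hiter k x hx (by linarith)
  have h3 : 1 ≤ C * ((1 - r) / (1 - x)) ^ α * (C : ℝ) ^ k := by
    have h5 : ((1 - x) / (1 - r)) ^ α ≤ C * (C : ℝ) ^ k := by
      calc ((1 - x) / (1 - r)) ^ α ≤ (K ^ (k + 1)) ^ α :=
            Real.rpow_le_rpow (by positivity) hk2.le hα0.le
        _ = C * (C : ℝ) ^ k := by
            rw [← Real.rpow_natCast, ← Real.rpow_mul hK0.le, mul_comm, Real.rpow_mul hK0.le, hKα,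
              Real.rpow_natCast, pow_succ]; ring
    have h6 : ((1 - x) / (1 - r)) ^ α * ((1 - r) / (1 - x)) ^ α = 1 := by
      rw [← Real.mul_rpow (by positivity) (by positivity)]
      rw [div_mul_div_cancel₀ hr0.ne', div_self hx0.ne', Real.one_rpow]
    calc 1 = ((1 - x) / (1 - r)) ^ α * ((1 - r) / (1 - x)) ^ α := h6.symm
      _ ≤ C * (C : ℝ) ^ k * ((1 - r) / (1 - x)) ^ α := by gcongr
      _ = _ := by ring
  have h7 : 0 ≤ tl ω r := ENNReal.toReal_nonneg
  calc tl ω r ≤ (C * ((1 - r) / (1 - x)) ^ α * (C : ℝ) ^ k) * tl ω r := le_mul_of_one_le_left h7 h3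
    _ = C * ((1 - r) / (1 - x)) ^ α * ((C : ℝ) ^ k * tl ω r) := by ring
    _ ≤ C * ((1 - r) / (1 - x)) ^ α * ((C : ℝ) ^ k * tl ω (1 - (1 - x) / K ^ k)) := by gcongr
    _ ≤ _ := by gcongr

/-! ### Taylor coefficients, Parseval's identity and differential operators. -/

lemma hasSum_integral_mul {α : Type*} [MeasurableSpace α] {μ : Measure α} {u : α → ℂ}
    (hu : Integrable u μ) {F : ℕ → α → ℂ} {G : α → ℂ} {b : ℕ → ℝ} (hb : Summable b)
    (hFm : ∀ k, AEStronglyMeasurable (F k) μ) (hFb : ∀ k, ∀ᵐ x ∂μ, ‖F k x‖ ≤ b k)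
    (hG : ∀ᵐ x ∂μ, HasSum (fun k => F k x) (G x)) :
    HasSum (fun k => ∫ x, u x * F k x ∂μ) (∫ x, u x * G x ∂μ) := by
  apply hasSum_integral_of_dominated_convergence (fun k x => ‖u x‖ * b k)
  · exact fun k => hu.aestronglyMeasurable.mul (hFm k)
  · intro k
    filter_upwards [hFb k] with x hx
    rw [norm_mul]
    gcongr
  · exact .of_forall fun x => hb.mul_left _
  · simp_rw [tsum_mul_left]
    exact hu.norm.mul_const _
  · filter_upwards [hG] with x hx
    exact hx.mul_left _

/-- Taylor coefficients at the origin. -/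
def coef (f : ℂ → ℂ) (k : ℕ) : ℂ := (k.factorial : ℂ)⁻¹ * iteratedDeriv k f 0

lemma hasSum_coef {f : ℂ → ℂ} (hf : DifferentiableOn ℂ f disc) {z : ℂ} (hz : z ∈ disc) :
    HasSum (fun k => coef f k * z ^ k) (f z) := by
  have h := Complex.hasSum_taylorSeries_on_ball (c := 0) (r := 1) (f := f) (by simpa [disc] using hf) (by simpa using hz)
  refine h.congr_fun fun k => ?_
  rw [coef, smul_eq_mul, smul_eq_mul, sub_zero]
  ring

lemma ofReal_mem_disc {r : ℝ} (hr : 0 ≤ r) (hr1 : r < 1) : (r : ℂ) ∈ disc := by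
  rwa [mem_ball_zero_iff, Complex.norm_real, Real.norm_eq_abs, abs_of_nonneg hr]

lemma polar_mem_disc {r : ℝ} (hr : 0 ≤ r) (hr1 : r < 1) (θ : ℝ) : polar (r, θ) ∈ disc := by
  rwa [mem_ball_zero_iff, norm_polar, abs_of_nonneg hr]

lemma summable_of_hasSum_disc {c : ℕ → ℂ} {G : ℂ → ℂ}
    (h : ∀ z ∈ disc, HasSum (fun k => c k * z ^ k) (G z)) {r : ℝ} (hr : 0 ≤ r) (hr1 : r < 1) :
    Summable fun k => ‖c k‖ * r ^ k := by
  have := (h r (ofReal_mem_disc hr hr1)).summable.norm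
  refine this.congr fun k => ?_
  rw [norm_mul, norm_pow, Complex.norm_real, Real.norm_eq_abs, abs_of_nonneg hr]

lemma differentiableOn_of_hasSum_disc {c : ℕ → ℂ} {G : ℂ → ℂ}
    (h : ∀ z ∈ disc, HasSum (fun k => c k * z ^ k) (G z)) : DifferentiableOn ℂ G disc := by
  intro z hz
  rw [mem_ball_zero_iff] at hz
  obtain ⟨r, hr, hr1⟩ := exists_between hz
  have hr0 : 0 ≤ r := (norm_nonneg z).trans hr.le
  have h1 : DifferentiableOn ℂ (fun w => ∑' k, c k * w ^ k) (Metric.ball 0 r) := by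
    apply Complex.differentiableOn_tsum_of_summable_norm (summable_of_hasSum_disc h hr0 hr1)
    · intro k
      fun_prop
    · exact Metric.isOpen_ball
    · intro k w hw
      rw [mem_ball_zero_iff] at hw
      rw [norm_mul, norm_pow]
      gcongr
  have hz' : z ∈ Metric.ball (0 : ℂ) r := by rwa [mem_ball_zero_iff]
  have h2 : DifferentiableAt ℂ G z := by
    apply ((h1.differentiableAt (Metric.isOpen_ball.mem_nhds hz'))).congr_of_eventuallyEq
    filter_upwards [Metric.isOpen_ball.mem_nhds hz'] with w hw
    exact (h w (Metric.ball_subset_ball hr1.le hw)).tsum_eq.symm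
  exact h2.differentiableWithinAt

lemma continuous_polar_right (r : ℝ) : Continuous fun θ : ℝ => polar (r, θ) :=
  continuous_polar.comp (by fun_prop)

lemma continuous_comp_polar {f : ℂ → ℂ} (hf : ContinuousOn f disc) {r : ℝ} (hr : 0 ≤ r)
    (hr1 : r < 1) : Continuous fun θ : ℝ => f (polar (r, θ)) :=
  hf.comp_continuous (continuous_polar_right r) fun θ => polar_mem_disc hr hr1 θ

lemma integrable_circ {g : ℝ → ℂ} (hg : Continuous g) : Integrable g circ := by
  unfold circ
  apply Integrable.smul_measure
  · exact (hg.integrableOn_Icc (a := -Real.pi) (b := Real.pi)).mono_set Ioo_subset_Icc_self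
  · simp [Real.pi_pos]

lemma integral_circ_eq (g : ℝ → ℂ) :
    ∫ θ, g θ ∂circ = ((2 * Real.pi : ℝ) : ℂ)⁻¹ * ∫ θ in (-Real.pi)..Real.pi, g θ := by
  rw [circ, integral_smul_measure, intervalIntegral.integral_of_le (by linarith [Real.pi_pos]),
    integral_Ioc_eq_integral_Ioo]
  rw [ENNReal.toReal_inv, ENNReal.toReal_ofReal (by positivity), Complex.real_smul]
  simp

lemma integral_circ_exp (m : ℤ) :
    ∫ θ, Complex.exp (m * θ * Complex.I) ∂circ = if m = 0 then 1 else 0 := by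
  rw [integral_circ_eq]
  split_ifs with hm
  · subst hm
    simp only [Int.cast_zero, zero_mul, Complex.exp_zero, intervalIntegral.integral_const]
    rw [Complex.real_smul, mul_one, show Real.pi - -Real.pi = 2 * Real.pi by ring]
    exact inv_mul_cancel₀ (by simp [Real.pi_ne_zero])
  · have h0 : (m * Complex.I : ℂ) ≠ 0 := by simp [hm]
    have h1 : ∀ θ : ℝ, Complex.exp (m * θ * Complex.I) = Complex.exp ((m * Complex.I) * θ) := by
      intro θ; ring_nf
    simp_rw [h1]
    rw [integral_exp_mul_complex h0]
    have : Complex.exp (m * Complex.I * (Real.pi : ℝ)) = Complex.exp (m * Complex.I * (-Real.pi : ℝ)) := by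
      rw [Complex.exp_eq_exp_iff_exists_int]
      exact ⟨m, by push_cast; ring⟩
    rw [this, sub_self, zero_div, mul_zero]

lemma integral_polar_pow_mul_conj (r : ℝ) (m k : ℕ) :
    ∫ θ, polar (r, θ) ^ m * conj (polar (r, θ)) ^ k ∂circ = if m = k then (r : ℂ) ^ (2 * k) else 0 := by
  have h1 : ∀ θ : ℝ, polar (r, θ) ^ m * conj (polar (r, θ)) ^ k =
      (r : ℂ) ^ (m + k) * Complex.exp (((m - k : ℤ) : ℂ) * θ * Complex.I) := by
    intro θ
    simp only [polar, map_mul, Complex.conj_ofReal, ← Complex.exp_conj, Complex.conj_I, mul_pow,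
      ← Complex.exp_nat_mul]
    rw [show (r : ℂ) ^ m * Complex.exp (m * (θ * Complex.I)) *
      ((r : ℂ) ^ k * Complex.exp (k * (θ * -Complex.I))) = r ^ (m + k) *
      (Complex.exp (m * (θ * Complex.I)) * Complex.exp (k * (θ * -Complex.I))) by ring,
      ← Complex.exp_add]
    congr 2
    push_cast
    ring
  simp_rw [h1]
  rw [integral_const_mul, integral_circ_exp]
  by_cases h : m = k
  · subst h; simp [two_mul]
  · have : (m - k : ℤ) ≠ 0 := by omega
    simp [h, this]

lemma integral_polar_mul_conj_pow {c : ℕ → ℂ} {G : ℂ → ℂ}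
    (h : ∀ z ∈ disc, HasSum (fun k => c k * z ^ k) (G z)) {r : ℝ} (hr : 0 ≤ r) (hr1 : r < 1)
    (k : ℕ) : ∫ θ, G (polar (r, θ)) * conj (polar (r, θ)) ^ k ∂circ = c k * (r : ℂ) ^ (2 * k) := by
  have h2 := hasSum_integral_mul (μ := circ) (u := fun θ => conj (polar (r, θ)) ^ k)
    (integrable_circ ((Complex.continuous_conj.comp (continuous_polar_right r)).pow k))
    (F := fun m θ => c m * polar (r, θ) ^ m) (G := fun θ => G (polar (r, θ)))
    (summable_of_hasSum_disc h hr hr1)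
    (fun m => ((continuous_polar_right r).pow m |>.const_smul (c m)).aestronglyMeasurable)
    (fun m => .of_forall fun θ => by
      rw [norm_mul, norm_pow, norm_polar, abs_of_nonneg hr])
    (.of_forall fun θ => h _ (polar_mem_disc hr hr1 θ))
  have h3 : ∀ m, ∫ θ, conj (polar (r, θ)) ^ k * (c m * polar (r, θ) ^ m) ∂circ =
      if m = k then c k * (r : ℂ) ^ (2 * k) else 0 := by
    intro m
    have : ∀ θ, conj (polar (r, θ)) ^ k * (c m * polar (r, θ) ^ m) =
      c m * (polar (r, θ) ^ m * conj (polar (r, θ)) ^ k) := fun θ => by ring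
    simp_rw [this]
    rw [integral_const_mul, integral_polar_pow_mul_conj]
    split_ifs with h
    · rw [h]
    · simp
  simp_rw [h3] at h2
  have h4 := h2.unique (hasSum_ite_eq k (c k * (r : ℂ) ^ (2 * k)))
  rw [← h4]
  simp_rw [mul_comm]

/-- Both sides are read off from the same Fourier coefficient on the circle of radius 1/2. -/
lemma coef_eq_of_hasSum {c : ℕ → ℂ} {G : ℂ → ℂ}
    (h : ∀ z ∈ disc, HasSum (fun k => c k * z ^ k) (G z)) (k : ℕ) : coef G k = c k := by
  have hG := differentiableOn_of_hasSum_disc h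
  have h1 := integral_polar_mul_conj_pow h (r := 1 / 2) (by norm_num) (by norm_num) k
  rw [integral_polar_mul_conj_pow (fun z hz => hasSum_coef hG hz) (r := 1 / 2) (by norm_num)
    (by norm_num) k] at h1
  exact mul_right_cancel₀ (by simp) h1

/-- Parseval's identity on circles. -/
lemma hasSum_integral_polar_mul_conj {f g : ℂ → ℂ} (hf : DifferentiableOn ℂ f disc)
    (hg : DifferentiableOn ℂ g disc) {r : ℝ} (hr : 0 ≤ r) (hr1 : r < 1) :
    HasSum (fun k => coef f k * conj (coef g k) * (r : ℂ) ^ (2 * k))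
      (∫ θ, f (polar (r, θ)) * conj (g (polar (r, θ))) ∂circ) := by
  have h2 := hasSum_integral_mul (μ := circ) (u := fun θ => f (polar (r, θ)))
    (integrable_circ (continuous_comp_polar hf.continuousOn hr hr1))
    (F := fun m θ => conj (coef g m * polar (r, θ) ^ m)) (G := fun θ => conj (g (polar (r, θ))))
    (summable_of_hasSum_disc (fun z hz => hasSum_coef hg hz) hr hr1)
    (fun m => (Complex.continuous_conj.comp
      ((continuous_polar_right r).pow m |>.const_smul (coef g m))).aestronglyMeasurable)
    (fun m => .of_forall fun θ => by
      rw [RCLike.norm_conj, norm_mul, norm_pow, norm_polar, abs_of_nonneg hr])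
    (.of_forall fun θ => Complex.hasSum_conj'.1 (by
      simpa using hasSum_coef hg (polar_mem_disc hr hr1 θ)))
  convert h2 using 2 with k
  have : ∀ θ, f (polar (r, θ)) * conj (coef g k * polar (r, θ) ^ k) =
      conj (coef g k) * (f (polar (r, θ)) * conj (polar (r, θ)) ^ k) := fun θ => by
    rw [map_mul, map_pow]; ring
  simp_rw [this]
  rw [integral_const_mul, integral_polar_mul_conj_pow (fun z hz => hasSum_coef hf hz) hr hr1]
  ring

lemma differentiableOn_iteratedDeriv {f : ℂ → ℂ} (hf : DifferentiableOn ℂ f disc) (n : ℕ) :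
    DifferentiableOn ℂ (iteratedDeriv n f) disc := by
  rw [iteratedDeriv_eq_iterate]
  exact ((hf.analyticOnNhd Metric.isOpen_ball).iterated_deriv n).differentiableOn

lemma coef_iteratedDeriv (f : ℂ → ℂ) (n k : ℕ) :
    coef (iteratedDeriv n f) k = (k + n).descFactorial n * coef f (k + n) := by
  have h1 : iteratedDeriv k (iteratedDeriv n f) = iteratedDeriv (k + n) f := by
    simp only [iteratedDeriv_eq_iterate, Function.iterate_add_apply]
  have h2 := Nat.factorial_mul_descFactorial (Nat.le_add_left n k)
  rw [Nat.add_sub_cancel] at h2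
  rw [coef, coef, h1, ← h2]
  have h3 : ((k.factorial : ℕ) : ℂ) ≠ 0 := by exact_mod_cast k.factorial_ne_zero
  have h4 : (((k + n).descFactorial n : ℕ) : ℂ) ≠ 0 := by
    have : (k + n).descFactorial n ≠ 0 := by
      rw [Ne, Nat.descFactorial_eq_zero_iff_lt]; omega
    exact_mod_cast this
  push_cast
  field_simp

lemma hasSum_pow_mul_iteratedDeriv {f : ℂ → ℂ} (hf : DifferentiableOn ℂ f disc) (n : ℕ) {z : ℂ}
    (hz : z ∈ disc) :
    HasSum (fun k => (k.descFactorial n * coef f k) * z ^ k) (z ^ n * iteratedDeriv n f z) := by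
  have h := (hasSum_coef (differentiableOn_iteratedDeriv hf n) hz).mul_left (z ^ n)
  rw [← hasSum_nat_add_iff' n, Finset.sum_eq_zero, sub_zero]
  · refine h.congr_fun fun k => ?_
    rw [coef_iteratedDeriv]
    ring
  · intro k hk
    rw [Nat.descFactorial_eq_zero_iff_lt.2 (Finset.mem_range.1 hk)]
    simp

/-- The derivative of order `n` of `z ^ n * f`. -/
def pderiv (n : ℕ) (f : ℂ → ℂ) (z : ℂ) : ℂ :=
  ∑ j ∈ Finset.range (n + 1), ((n.factorial * n.choose j : ℕ) / (j.factorial : ℂ)) *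
    (z ^ j * iteratedDeriv j f z)

/-- Vandermonde's identity for the binomial coefficient (k+n choose n) collects the terms of
`pderiv`. Unlike those of the plain derivative, the multipliers (k+1)⋯(k+n) never vanish, so this
operator can be inverted on every monomial. -/
lemma hasSum_pderiv {f : ℂ → ℂ} (hf : DifferentiableOn ℂ f disc) (n : ℕ) {z : ℂ}
    (hz : z ∈ disc) :
    HasSum (fun k => ((k + 1).ascFactorial n * coef f k) * z ^ k) (pderiv n f z) := by
  have h := hasSum_sum (s := Finset.range (n + 1)) fun j _ =>
    (hasSum_pow_mul_iteratedDeriv hf j hz).mul_left ((n.factorial * n.choose j : ℕ) / (j.factorial : ℂ))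
  refine h.congr_fun fun k => ?_
  rw [Nat.ascFactorial_eq_factorial_mul_choose, Nat.add_choose_eq,
    Finset.Nat.sum_antidiagonal_eq_sum_range_succ_mk]
  push_cast
  rw [Finset.mul_sum, Finset.sum_mul, Finset.sum_mul]
  apply Finset.sum_congr rfl
  intro j hj
  rw [Nat.descFactorial_eq_factorial_mul_choose, Nat.choose_symm (by simpa [Nat.lt_succ_iff] using hj)]
  have h3 : ((j.factorial : ℕ) : ℂ) ≠ 0 := by exact_mod_cast j.factorial_ne_zero
  push_cast
  field_simp

/-! ### Monotonicity of integral means and comparison of radial measures. -/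

lemma integrable_circ_real {g : ℝ → ℝ} (hg : Continuous g) : Integrable g circ := by
  unfold circ
  apply Integrable.smul_measure
  · exact (hg.integrableOn_Icc (a := -Real.pi) (b := Real.pi)).mono_set Ioo_subset_Icc_self
  · simp [Real.pi_pos]

lemma integral_circ_eq_real (g : ℝ → ℝ) :
    ∫ θ, g θ ∂circ = (2 * Real.pi)⁻¹ * ∫ θ in (-Real.pi)..Real.pi, g θ := by
  rw [circ, integral_smul_measure, intervalIntegral.integral_of_le (by linarith [Real.pi_pos]),
    integral_Ioc_eq_integral_Ioo]
  rw [ENNReal.toReal_inv, ENNReal.toReal_ofReal (by positivity), smul_eq_mul]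

lemma polar_add_two_pi (r θ : ℝ) : polar (r, θ + 2 * Real.pi) = polar (r, θ) := by
  simp only [polar]
  congr 1
  rw [Complex.exp_eq_exp_iff_exists_int]
  exact ⟨1, by push_cast; ring⟩

lemma integral_circ_polar_add (g : ℂ → ℝ) (r t : ℝ) :
    ∫ θ, g (polar (r, θ + t)) ∂circ = ∫ θ, g (polar (r, θ)) ∂circ := by
  have hper : Function.Periodic (fun θ => g (polar (r, θ))) (2 * Real.pi) := fun θ => by
    simp only [polar_add_two_pi]
  rw [integral_circ_eq_real, integral_circ_eq_real,
    intervalIntegral.integral_comp_add_right (fun θ => g (polar (r, θ)))]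
  congr 1
  have := hper.intervalIntegral_add_eq (-Real.pi + t) (-Real.pi)
  convert this using 2 <;> ring

lemma polar_mul_exp (r θ t : ℝ) : polar (r, t) * Complex.exp (θ * Complex.I) = polar (r, θ + t) := by
  simp only [polar]
  rw [mul_assoc, ← Complex.exp_add]
  congr 2
  push_cast
  ring

/-- The integral means of order `p`. -/
def imean (p : ℝ) (f : ℂ → ℂ) (r : ℝ) : ℝ := ∫ θ, ‖f (polar (r, θ))‖ ^ p ∂circ

lemma imean_nonneg (p : ℝ) (f : ℂ → ℂ) (r : ℝ) : 0 ≤ imean p f r :=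
  integral_nonneg fun θ => by positivity

/-- Let φ be the dual function conj f · |f|^(p-2) on the circle of radius r, and G(z) the mean of
φ(θ) f(z e^{iθ}). Then G is analytic, G(r) is the mean at r, and Hölder's inequality bounds G on |z|
= R by the 1/p-th power of the mean at R times the 1/q-th power of the mean at r. The maximum
principle transfers this to z = r, and the second factor is divided out. -/
lemma imean_mono {f : ℂ → ℂ} (hf : DifferentiableOn ℂ f disc) {p : ℝ} (hp : 1 < p) {r R : ℝ}
    (hr : 0 ≤ r) (hrR : r ≤ R) (hR : R < 1) : imean p f r ≤ imean p f R := by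
  have hr1 : r < 1 := hrR.trans_lt hR
  have hR0 : 0 ≤ R := hr.trans hrR
  have hp0 : 0 < p := by linarith
  set q := p.conjExponent with hq
  have hpq : p.HolderConjugate q := .conjExponent hp
  have hfc := hf.continuousOn
  set φ : ℝ → ℂ := fun θ => conj (f (polar (r, θ))) * ((‖f (polar (r, θ))‖ ^ (p - 2) : ℝ) : ℂ)
  have hφn : ∀ θ, ‖φ θ‖ = ‖f (polar (r, θ))‖ ^ (p - 1) := by
    intro θ
    simp only [φ, norm_mul, RCLike.norm_conj, Complex.norm_real, Real.norm_eq_abs]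
    rw [abs_of_nonneg (by positivity)]
    rcases eq_or_ne ‖f (polar (r, θ))‖ 0 with h | h
    · rw [h, zero_mul, Real.zero_rpow (by linarith)]
    · have h' : 0 < ‖f (polar (r, θ))‖ := lt_of_le_of_ne (norm_nonneg _) h.symm
      nth_rw 1 [← Real.rpow_one ‖f (polar (r, θ))‖]
      rw [← Real.rpow_add h']
      ring_nf
  have hfφ : ∀ θ, f (polar (r, θ)) * φ θ = ((‖f (polar (r, θ))‖ ^ p : ℝ) : ℂ) := by
    intro θ
    simp only [φ]
    rw [← mul_assoc, Complex.mul_conj, Complex.normSq_eq_norm_sq, ← Complex.ofReal_mul]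
    congr 1
    rcases eq_or_ne ‖f (polar (r, θ))‖ 0 with h | h
    · rw [h, Real.zero_rpow hp0.ne']; simp
    · have h' : 0 < ‖f (polar (r, θ))‖ := lt_of_le_of_ne (norm_nonneg _) h.symm
      rw [← Real.rpow_natCast, ← Real.rpow_add h']
      norm_num
  have hcr : Continuous fun θ => f (polar (r, θ)) := continuous_comp_polar hfc hr hr1
  have hφm : Measurable φ :=
    (Complex.continuous_conj.comp hcr).measurable.mul
      (Complex.measurable_ofReal.comp (hcr.norm.measurable.pow_const _))
  have hcr1 : Continuous fun θ => ‖f (polar (r, θ))‖ ^ (p - 1) :=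
    hcr.norm.rpow_const fun _ => .inr (by linarith)
  have hφi : Integrable φ circ := by
    refine (integrable_circ_real hcr1).mono' hφm.aestronglyMeasurable (.of_forall fun θ => ?_)
    rw [hφn]
  set G : ℂ → ℂ := fun z => ∫ θ, φ θ * f (z * Complex.exp (θ * Complex.I)) ∂circ
  have hnorm : ∀ (z : ℂ) (θ : ℝ), ‖z * Complex.exp (θ * Complex.I)‖ = ‖z‖ := by
    intro z θ
    rw [norm_mul, Complex.norm_exp_ofReal_mul_I, mul_one]
  have hGs : ∀ z ∈ disc, HasSum (fun k => (coef f k * ∫ θ, φ θ * Complex.exp (θ * Complex.I) ^ k ∂circ)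
      * z ^ k) (G z) := by
    intro z hz
    rw [mem_ball_zero_iff] at hz
    have h := hasSum_integral_mul hφi
      (F := fun k θ => coef f k * (z * Complex.exp (θ * Complex.I)) ^ k)
      (G := fun θ => f (z * Complex.exp (θ * Complex.I)))
      (summable_of_hasSum_disc (fun z hz => hasSum_coef hf hz) (norm_nonneg z) hz)
      (fun k => (by fun_prop : Continuous _).aestronglyMeasurable)
      (fun k => .of_forall fun θ => by rw [norm_mul, norm_pow, hnorm])
      (.of_forall fun θ => hasSum_coef hf (by rw [mem_ball_zero_iff, hnorm]; exact hz))
    refine h.congr_fun fun k => ?_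
    rw [mul_right_comm, ← integral_const_mul]
    congr 1
    ext θ
    ring
  have hGd := differentiableOn_of_hasSum_disc hGs
  have hGr : G r = (imean p f r : ℝ) := by
    simp only [G, imean]
    rw [← integral_complex_ofReal]
    congr 1
    ext θ
    rw [← hfφ, mul_comm, polar]
  have hb : ∀ z ∈ frontier (Metric.ball (0 : ℂ) R), ‖G z‖ ≤
      imean p f R ^ (1 / p) * imean p f r ^ (1 / q) := by
    intro z hz
    have hz' : ‖z‖ = R := by
      have := Metric.frontier_ball_subset_sphere hz
      simpa using this
    have hzp : z = polar (R, z.arg) := by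
      rw [polar, ← hz']; exact (Complex.norm_mul_exp_arg_mul_I z).symm
    have hpol : ∀ θ : ℝ, z * Complex.exp (θ * Complex.I) = polar (R, θ + z.arg) := by
      intro θ
      rw [← polar_mul_exp, ← hzp]
    have hcR : Continuous fun θ => f (polar (R, θ + z.arg)) :=
      (continuous_comp_polar hfc hR0 hR).comp (by fun_prop)
    have h1 : ‖G z‖ ≤ ∫ θ, ‖f (polar (R, θ + z.arg))‖ * ‖f (polar (r, θ))‖ ^ (p - 1) ∂circ := by
      refine (norm_integral_le_integral_norm _).trans (le_of_eq ?_)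
      congr 1
      ext θ
      rw [norm_mul, hφn, hpol, mul_comm]
    refine h1.trans ?_
    have hbd : ∀ g : ℝ → ℝ, Continuous g → (∀ θ, 0 ≤ g θ) → ∀ s : ℝ, 0 < s →
        MemLp g (ENNReal.ofReal s) circ := by
      intro g hg hg0 s hs
      rw [← integrable_norm_rpow_iff hg.aestronglyMeasurable (by simpa using hs) (by simp),
        ENNReal.toReal_ofReal hs.le]
      exact integrable_circ_real (hg.norm.rpow_const fun _ => .inr hs.le)
    have h2 := integral_mul_le_Lp_mul_Lq_of_nonneg hpq (μ := circ)
      (f := fun θ => ‖f (polar (R, θ + z.arg))‖) (g := fun θ => ‖f (polar (r, θ))‖ ^ (p - 1))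
      (.of_forall fun θ => by positivity) (.of_forall fun θ => by positivity)
      (hbd _ hcR.norm (fun θ => norm_nonneg _) p hp0)
      (hbd _ hcr1 (fun θ => by positivity) q hpq.symm.pos)
    refine h2.trans (le_of_eq ?_)
    congr 2
    · exact integral_circ_polar_add (fun w => ‖f w‖ ^ p) R z.arg
    · rw [imean]
      congr 1
      ext θ
      rw [← Real.rpow_mul (norm_nonneg _), hpq.sub_one_mul_conj]
  have hmax : ‖G r‖ ≤ imean p f R ^ (1 / p) * imean p f r ^ (1 / q) := by
    -- For R = 0 the ball is empty and the maximum principle is void; then r = R and the bound is an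
    -- identity.
    rcases hR0.eq_or_lt with h0 | hR0'
    · have hrR' : r = R := le_antisymm hrR (h0 ▸ hr)
      rw [hGr, ← hrR', ← Real.rpow_add_of_nonneg (imean_nonneg _ _ _) hpq.one_div_nonneg
        hpq.symm.one_div_nonneg, one_div, one_div, hpq.inv_add_inv_eq_one, Real.rpow_one,
        Complex.norm_real, Real.norm_eq_abs, abs_of_nonneg (imean_nonneg _ _ _)]
    · apply Complex.norm_le_of_forall_mem_frontier_norm_le Metric.isBounded_ball _ hb
      · rw [closure_ball _ hR0'.ne', mem_closedBall_zero_iff, Complex.norm_real, Real.norm_eq_abs,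
          abs_of_nonneg hr]
        exact hrR
      · apply DifferentiableOn.diffContOnCl
        rw [closure_ball _ hR0'.ne']
        exact hGd.mono (Metric.closedBall_subset_ball hR)
  rw [hGr, Complex.norm_real, Real.norm_eq_abs, abs_of_nonneg (imean_nonneg _ _ _)] at hmax
  rcases (imean_nonneg p f r).eq_or_lt with h0 | h0
  · rw [← h0]; exact imean_nonneg _ _ _
  · have h3 : imean p f r ^ (1 / p) ≤ imean p f R ^ (1 / p) := by
      have h4 : imean p f r = imean p f r ^ (1 / p) * imean p f r ^ (1 / q) := by
        rw [← Real.rpow_add h0, one_div, one_div, hpq.inv_add_inv_eq_one, Real.rpow_one]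
      have h6 := h4.symm.trans_le hmax
      exact le_of_mul_le_mul_right h6 (by positivity)
    exact (Real.rpow_le_rpow_iff (imean_nonneg _ _ _) (imean_nonneg _ _ _)
      (by positivity)).1 h3

lemma lintegral_circ_eq_imean {f : ℂ → ℂ} (hf : ContinuousOn f disc) {p : ℝ} (hp : 0 < p) {r : ℝ}
    (hr : 0 ≤ r) (hr1 : r < 1) :
    ∫⁻ θ, ‖f (polar (r, θ))‖ₑ ^ p ∂circ = ENNReal.ofReal (imean p f r) := by
  rw [imean, ofReal_integral_eq_lintegral_ofReal
    (integrable_circ_real ((continuous_comp_polar hf hr hr1).norm.rpow_const fun _ => .inr hp.le))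
    (.of_forall fun θ => by positivity)]
  congr 1
  ext θ
  rw [← ofReal_norm, ENNReal.ofReal_rpow_of_nonneg (norm_nonneg _) hp.le]

/-- Comparison of the integrals of an increasing function by means of the tails. -/
lemma lintegral_le_of_tail_le {μ₁ μ₂ : Measure ℝ} [NullSingletonClass μ₁] {C : ℝ≥0∞}
    (h : ∀ x : ℝ, 0 ≤ x → x < 1 → μ₁ (Ioo x 1) ≤ C * μ₂ (Ioo x 1)) {M : ℝ → ℝ}
    (hM : MonotoneOn M (Ioo 0 1)) (h0 : ∀ r ∈ Ioo (0 : ℝ) 1, 0 ≤ M r) :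
    ∫⁻ r in Ioo 0 1, ENNReal.ofReal (M r) ∂μ₁ ≤ C * ∫⁻ r in Ioo 0 1, ENNReal.ofReal (M r) ∂μ₂ := by
  -- Layer cake formula: it reduces the claim to the superlevel sets of M.
  have key : ∀ μ : Measure ℝ, ∫⁻ r in Ioo 0 1, ENNReal.ofReal (M r) ∂μ =
      ∫⁻ t in Ioi 0, μ (Ioo 0 1 ∩ {a | t < M a}) := by
    intro μ
    rw [lintegral_eq_lintegral_meas_lt]
    · congr 1
      ext t
      rw [inter_comm, Measure.restrict_apply' measurableSet_Ioo]
    · filter_upwards [ae_restrict_mem measurableSet_Ioo] with r hr using h0 r hr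
    · exact aemeasurable_restrict_of_monotoneOn measurableSet_Ioo hM
  have hmeas : Measurable fun t => μ₂ (Ioo 0 1 ∩ {a | t < M a}) := by
    apply Antitone.measurable
    intro s t hst
    exact measure_mono (inter_subset_inter_right _ fun a ha => lt_of_le_of_lt hst ha)
  rw [key, key, ← lintegral_const_mul _ hmeas]
  apply lintegral_mono
  intro t
  set S := Ioo 0 1 ∩ {a | t < M a}
  rcases S.eq_empty_or_nonempty with hS | hS
  · simp [S] at hS ⊢
    simp [hS]
  have hbdd : BddBelow S := ⟨0, fun a ha => ha.1.1.le⟩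
  set x := sInf S
  have hx0 : 0 ≤ x := le_csInf hS fun a ha => ha.1.1.le
  have hx1 : x < 1 := by
    obtain ⟨a, ha⟩ := hS
    exact (csInf_le hbdd ha).trans_lt ha.1.2
  -- As M increases, the superlevel set is an interval reaching up to 1. Only its membership at the
  -- left end x is undecided, and `μ₁` does not charge points.
  have h1 : Ioo x 1 ⊆ S := by
    intro a ha
    obtain ⟨b, hb, hba⟩ := exists_lt_of_csInf_lt hS ha.1
    have haI : a ∈ Ioo (0 : ℝ) 1 := ⟨hb.1.1.trans hba, ha.2⟩
    exact ⟨haI, lt_of_lt_of_le hb.2 (hM hb.1 haI hba.le)⟩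
  have h2 : S ⊆ Ico x 1 := fun a ha => ⟨csInf_le hbdd ha, ha.1.2⟩
  calc μ₁ S ≤ μ₁ (Ico x 1) := measure_mono h2
    _ = μ₁ (Ioo x 1) := (measure_congr Ioo_ae_eq_Ico).symm
    _ ≤ C * μ₂ (Ioo x 1) := h x hx0 hx1
    _ ≤ C * μ₂ S := by gcongr

lemma lintegral_polarMeasure_enorm_rpow {f : ℂ → ℂ} (hf : ContinuousOn f disc) {p : ℝ} (hp : 0 < p)
    {ρ : Measure ℝ} [SFinite ρ] (hρ : ∀ᵐ r ∂ρ, r ∈ Ioo (0 : ℝ) 1) :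
    ∫⁻ z, ‖f z‖ₑ ^ p ∂(polarMeasure ρ) = ∫⁻ r in Ioo 0 1, ENNReal.ofReal (imean p f r) ∂ρ := by
  have h1 : AEMeasurable (fun z => ‖f z‖ₑ ^ p) (polarMeasure ρ) := by
    have h2 : AEMeasurable f ((polarMeasure ρ).restrict disc) :=
      hf.aemeasurable measurableSet_ball
    rw [Measure.restrict_eq_self_of_ae_mem (ae_polarMeasure_mem_disc hρ)] at h2
    exact h2.enorm.pow_const _
  rw [lintegral_polarMeasure ρ h1, Measure.restrict_eq_self_of_ae_mem hρ]
  apply lintegral_congr_ae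
  filter_upwards [hρ] with r hr
  exact lintegral_circ_eq_imean hf hp hr.1.le hr.2

/-- Since the integral means increase, domination of tails is enough and no pointwise comparison of
densities is needed. This is what allows an irregular weight to be exchanged for its regularized
form. -/
lemma lintegral_enorm_rpow_le_of_tail_le {f : ℂ → ℂ} (hf : DifferentiableOn ℂ f disc) {p : ℝ}
    (hp : 1 < p) {ρ₁ ρ₂ : Measure ℝ} [SFinite ρ₁] [SFinite ρ₂] [NullSingletonClass ρ₁]
    (h1 : ∀ᵐ r ∂ρ₁, r ∈ Ioo (0 : ℝ) 1) (h2 : ∀ᵐ r ∂ρ₂, r ∈ Ioo (0 : ℝ) 1) {C : ℝ≥0∞}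
    (h : ∀ x : ℝ, 0 ≤ x → x < 1 → ρ₁ (Ioo x 1) ≤ C * ρ₂ (Ioo x 1)) :
    ∫⁻ z, ‖f z‖ₑ ^ p ∂(polarMeasure ρ₁) ≤ C * ∫⁻ z, ‖f z‖ₑ ^ p ∂(polarMeasure ρ₂) := by
  rw [lintegral_polarMeasure_enorm_rpow hf.continuousOn (by linarith) h1,
    lintegral_polarMeasure_enorm_rpow hf.continuousOn (by linarith) h2]
  exact lintegral_le_of_tail_le h (fun r hr s hs hrs => imean_mono hf hp hr.1.le hrs hs.2)
    fun r _ => imean_nonneg _ _ _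

/-! ### Sequences with symbol estimates and summation by parts. -/

/-- Forward difference. -/
def dif (x : ℕ → ℝ) (k : ℕ) : ℝ := x (k + 1) - x k

/-- `x` is a symbol of smoothness `J` with majorant `m`. -/
def SymbolTo (J : ℕ) (x m : ℕ → ℝ) : Prop :=
  ∀ j ≤ J, ∃ C, 0 ≤ C ∧ ∀ k, |dif^[j] x k| ≤ C * (m k / (k + 1 : ℝ) ^ j)

lemma SymbolTo.dif {J : ℕ} {x m : ℕ → ℝ} (h : SymbolTo (J + 1) x m) :
    SymbolTo J (dif x) fun k => m k / (k + 1 : ℝ) := by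
  intro j hj
  obtain ⟨C, hC0, hC⟩ := h (j + 1) (by omega)
  refine ⟨C, hC0, fun k => ?_⟩
  have := hC k
  rw [Function.iterate_succ_apply] at this
  rwa [div_div, ← pow_succ']

lemma SymbolTo.of_dif {J : ℕ} {x m : ℕ → ℝ} (h : SymbolTo J (SmallHankel.dif x) fun k => m k / (k + 1 : ℝ))
    (h0 : ∃ C, 0 ≤ C ∧ ∀ k, |x k| ≤ C * m k) : SymbolTo (J + 1) x m := by
  intro j hj
  rcases j with _ | j
  · obtain ⟨C, hC0, hC⟩ := h0
    exact ⟨C, hC0, fun k => by simpa using hC k⟩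
  · obtain ⟨C, hC0, hC⟩ := h j (by omega)
    refine ⟨C, hC0, fun k => ?_⟩
    have := hC k
    rw [Function.iterate_succ_apply]
    rwa [div_div, ← pow_succ'] at this

lemma SymbolTo.le {J J' : ℕ} {x m : ℕ → ℝ} (h : SymbolTo J x m) (hJ : J' ≤ J) : SymbolTo J' x m :=
  fun j hj => h j (hj.trans hJ)

lemma iterate_dif_shift (x : ℕ → ℝ) (j k : ℕ) :
    dif^[j] (fun k => x (k + 1)) k = dif^[j] x (k + 1) := by
  induction j generalizing x with
  | zero => rfl
  | succ j ih =>
    rw [Function.iterate_succ_apply, Function.iterate_succ_apply]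
    exact ih (dif x)

lemma iterate_dif_add (x y : ℕ → ℝ) (j : ℕ) :
    dif^[j] (fun k => x k + y k) = fun k => dif^[j] x k + dif^[j] y k := by
  induction j generalizing x y with
  | zero => rfl
  | succ j ih =>
    simp only [Function.iterate_succ_apply]
    rw [← ih]
    congr 1
    ext k
    simp only [dif]
    ring

lemma iterate_dif_neg (x : ℕ → ℝ) (j : ℕ) :
    dif^[j] (fun k => -x k) = fun k => -dif^[j] x k := by
  induction j generalizing x with
  | zero => rfl
  | succ j ih =>
    simp only [Function.iterate_succ_apply]
    rw [← ih]
    congr 1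
    ext k
    simp only [dif]
    ring

lemma SymbolTo.shift {J : ℕ} {x m : ℕ → ℝ} (h : SymbolTo J x m) (hm0 : ∀ k, 0 ≤ m k) {D : ℝ}
    (hD0 : 0 ≤ D) (hD : ∀ k, m (k + 1) ≤ D * m k) : SymbolTo J (fun k => x (k + 1)) m := by
  intro j hj
  obtain ⟨C, hC0, hC⟩ := h j hj
  refine ⟨C * D, by positivity, fun k => ?_⟩
  rw [iterate_dif_shift]
  refine (hC (k + 1)).trans ?_
  have := hm0 k
  calc C * (m (k + 1) / ((k + 1 : ℕ) + 1 : ℝ) ^ j) ≤ C * ((D * m k) / (k + 1 : ℝ) ^ j) := by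
        gcongr
        · exact hD k
        · linarith
    _ = _ := by ring

lemma SymbolTo.neg {J : ℕ} {x m : ℕ → ℝ} (h : SymbolTo J x m) : SymbolTo J (fun k => -x k) m := by
  intro j hj
  obtain ⟨C, hC0, hC⟩ := h j hj
  refine ⟨C, hC0, fun k => ?_⟩
  rw [iterate_dif_neg, abs_neg]
  exact hC k

/-- Induction through the Leibniz rule Δ(xy)_k = Δx_k y_k + x_{k+1} Δy_k. The shift of x in the
second term is paid for by the growth bound on its majorant. -/
lemma SymbolTo.mul {J : ℕ} {x y m m' : ℕ → ℝ} (hx : SymbolTo J x m) (hy : SymbolTo J y m')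
    (hm0 : ∀ k, 0 ≤ m k) (hm0' : ∀ k, 0 ≤ m' k) {D : ℝ} (hD0 : 0 ≤ D) (hD : ∀ k, m (k + 1) ≤ D * m k) :
    SymbolTo J (fun k => x k * y k) fun k => m k * m' k := by
  induction J generalizing x y m m' with
  | zero =>
    intro j hj
    obtain rfl : j = 0 := by omega
    obtain ⟨C, hC0, hC⟩ := hx 0 le_rfl
    obtain ⟨C', hC0', hC'⟩ := hy 0 le_rfl
    refine ⟨C * C', by positivity, fun k => ?_⟩
    have h1 := hC k
    have h2 := hC' k
    simp only [Function.iterate_zero, id, pow_zero, div_one, abs_mul] at h1 h2 ⊢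
    calc |x k| * |y k| ≤ (C * m k) * (C' * m' k) := by gcongr; exact mul_nonneg hC0 (hm0 k)
      _ = _ := by ring
  | succ J ih =>
    apply SymbolTo.of_dif
    · have h1 := ih hx.dif (hy.le (Nat.le_succ J)) (fun k => div_nonneg (hm0 k) (by positivity)) hm0'
        (fun k => by
          rw [← mul_div_assoc]
          have := hD k
          have h3 := hm0 (k + 1)
          gcongr
          all_goals linarith)
      have h2 := ih ((hx.shift hm0 hD0 hD).le (Nat.le_succ J)) hy.dif hm0
        (fun k => div_nonneg (hm0' k) (by positivity)) hD
      intro j hj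
      obtain ⟨C, hC0, hC⟩ := h1 j hj
      obtain ⟨C', hC0', hC'⟩ := h2 j hj
      refine ⟨C + C', by positivity, fun k => ?_⟩
      have h3 : SmallHankel.dif (fun k => x k * y k) =
          fun k => SmallHankel.dif x k * y k + x (k + 1) * SmallHankel.dif y k := by
        ext k; simp only [SmallHankel.dif]; ring
      rw [h3, iterate_dif_add]
      refine (abs_add_le _ _).trans ?_
      have h4 := hC k
      have h5 := hC' k
      refine (add_le_add h4 h5).trans (le_of_eq ?_)
      ring
    · obtain ⟨C, hC0, hC⟩ := hx 0 (Nat.zero_le _)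
      obtain ⟨C', hC0', hC'⟩ := hy 0 (Nat.zero_le _)
      refine ⟨C * C', by positivity, fun k => ?_⟩
      have h1 := hC k
      have h2 := hC' k
      simp only [Function.iterate_zero, id, pow_zero, div_one, abs_mul] at h1 h2 ⊢
      calc |x k| * |y k| ≤ (C * m k) * (C' * m' k) := by gcongr; exact mul_nonneg hC0 (hm0 k)
        _ = _ := by ring

/-- The identity Δ(1/x)_k = -Δx_k · (1/x_k)(1/x_{k+1}) expresses the differences of 1/x up to order
J + 1 by those up to order J, so the product rule closes an induction on J. -/
lemma SymbolTo.inv {J : ℕ} {x t : ℕ → ℝ} (hx : SymbolTo J x t) (ht : ∀ k, 0 < t k)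
    (hx0 : ∀ k, 0 < x k) {c : ℝ} (hc : 0 < c) (hcx : ∀ k, c * t k ≤ x k) (hta : ∀ k, t (k + 1) ≤ t k) {D : ℝ}
    (hD0 : 0 < D) (hD : ∀ k, t k ≤ D * t (k + 1)) :
    SymbolTo J (fun k => (x k)⁻¹) fun k => (t k)⁻¹ := by
  have h0 : ∃ C, 0 ≤ C ∧ ∀ k, |(x k)⁻¹| ≤ C * (t k)⁻¹ := by
    refine ⟨c⁻¹, by positivity, fun k => ?_⟩
    rw [abs_of_pos (inv_pos.2 (hx0 k)), ← mul_inv]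
    exact inv_anti₀ (mul_pos hc (ht k)) (hcx k)
  have ht0 : ∀ k, 0 ≤ (t k)⁻¹ := fun k => (inv_pos.2 (ht k)).le
  have htD : ∀ k, (t (k + 1))⁻¹ ≤ D * (t k)⁻¹ := by
    intro k
    rw [← div_eq_mul_inv, le_div_iff₀ (ht k), ← div_eq_inv_mul, div_le_iff₀ (ht (k + 1))]
    exact hD k
  induction J with
  | zero =>
    intro j hj
    obtain rfl : j = 0 := by omega
    simpa using h0
  | succ J ih =>
    apply SymbolTo.of_dif _ h0
    have h1 := ih (hx.le (Nat.le_succ J))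
    have h2 := h1.shift ht0 hD0.le htD
    have h3 := (h1.mul h2 ht0 ht0 hD0.le htD)
    have h4 := hx.dif.neg.mul h3 (fun k => div_nonneg (ht k).le (by positivity))
      (fun k => mul_nonneg (ht0 k) (ht0 k)) zero_le_one (fun k => by
        rw [one_mul]
        have h5 := hta k
        have h6 := (ht k).le
        gcongr
        linarith)
    convert h4 using 2 with k k
    · have := (hx0 k).ne'
      have := (hx0 (k + 1)).ne'
      simp only [SmallHankel.dif]
      field_simp
      ring
    · have := (ht k).ne'
      field_simp

lemma iterate_dif_zero (j : ℕ) : dif^[j] (fun _ => 0) = fun _ => (0 : ℝ) := by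
  induction j with
  | zero => rfl
  | succ j ih =>
    rw [Function.iterate_succ_apply]
    have : dif (fun _ => 0) = fun _ => 0 := by ext k; simp [dif]
    rw [this, ih]

lemma iterate_dif_shift_add (x : ℕ → ℝ) (j N : ℕ) :
    dif^[j] (fun k => x (k + N)) = fun k => dif^[j] x (k + N) := by
  induction N with
  | zero => rfl
  | succ N ih =>
    ext k
    have h1 := iterate_dif_shift (fun k => x (k + N)) j k
    rw [ih] at h1
    have h2 : (fun k => x (k + (N + 1))) = fun k => x (k + 1 + N) := by
      ext k; congr 1; omega
    rw [h2, show k + (N + 1) = k + 1 + N by omega]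
    exact h1

lemma symbolTo_natCast_add (J n : ℕ) :
    SymbolTo J (fun k => (k + 1 + n : ℝ)) fun k => (k + 1 : ℝ) := by
  intro j _
  rcases j with _ | _ | j
  · refine ⟨n + 1, by positivity, fun k => ?_⟩
    simp only [Function.iterate_zero, id, pow_zero, div_one]
    rw [abs_of_pos (by positivity)]
    nlinarith [mul_nonneg (Nat.cast_nonneg (α := ℝ) n) (Nat.cast_nonneg (α := ℝ) k)]
  · refine ⟨1, zero_le_one, fun k => ?_⟩
    have : (k + 1 : ℝ) ≠ 0 := by positivity
    simp [dif, this]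
  · refine ⟨0, le_rfl, fun k => ?_⟩
    rw [Function.iterate_succ_apply, Function.iterate_succ_apply]
    have : dif (dif fun k => (k + 1 + n : ℝ)) = fun _ => 0 := by
      ext k; simp [dif]
    rw [this, iterate_dif_zero]
    simp

lemma symbolTo_ascFactorial (J n : ℕ) :
    SymbolTo J (fun k => ((k + 1).ascFactorial n : ℝ)) fun k => (k + 1 : ℝ) ^ n := by
  induction n with
  | zero =>
    intro j _
    refine ⟨1, zero_le_one, fun k => ?_⟩
    rcases j with _ | j
    · simp
    · rw [Function.iterate_succ_apply]
      have : (dif fun k => ((k + 1).ascFactorial 0 : ℝ)) = fun _ => 0 := by ext k; simp [dif]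
      rw [this, iterate_dif_zero]
      simp
      positivity
  | succ n ih =>
    have h := (symbolTo_natCast_add J n).mul ih (fun k => by positivity) (fun k => by positivity)
      (zero_le_two) (fun k => by push_cast; linarith [Nat.cast_nonneg (α := ℝ) k])
    convert h using 2 with k k
    · rw [Nat.ascFactorial_succ]; push_cast; ring
    · rw [pow_succ']

/-- Repeated summation by parts. -/
lemma norm_tsum_mul_pow_le (J : ℕ) (x : ℕ → ℝ) {w : ℂ} {δ : ℝ} (hδ : 0 < δ) (hw : δ ≤ ‖1 - w‖)
    (hw1 : ‖w‖ ≤ 1) (hx : Summable fun k => |x k| * ‖w‖ ^ k) (hJ : Summable fun k => |dif^[J] x k|) :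
    ‖∑' k, (x k : ℂ) * w ^ k‖ ≤ ∑ j ∈ Finset.range J, |dif^[j] x 0| / δ ^ (j + 1) +
      (∑' k, |dif^[J] x k|) / δ ^ J := by
  have hs : ∀ y : ℕ → ℝ, (Summable fun k => |y k| * ‖w‖ ^ k) → Summable fun k => (y k : ℂ) * w ^ k := by
    intro y hy
    apply Summable.of_norm
    refine hy.congr fun k => ?_
    rw [norm_mul, norm_pow, Complex.norm_real, Real.norm_eq_abs]
  induction J generalizing x with
  | zero =>
    simp only [Finset.range_zero, Finset.sum_empty, pow_zero, div_one, zero_add]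
    refine tsum_of_norm_bounded hJ.hasSum fun k => ?_
    rw [norm_mul, norm_pow, Complex.norm_real, Real.norm_eq_abs]
    exact mul_le_of_le_one_right (abs_nonneg _) (pow_le_one₀ (norm_nonneg _) hw1)
  | succ J ih =>
    -- The point 0 is separated because the summability of the shifted series is obtained by
    -- dividing by ‖w‖.
    by_cases hw0 : w = 0
    · subst hw0
      have hδ1 : δ ≤ 1 := by simpa using hw
      rw [tsum_eq_single 0 (by intro k hk; simp [hk])]
      rw [Finset.sum_range_succ']
      have h1 : 0 ≤ ∑ k ∈ Finset.range J, |dif^[k + 1] x 0| / δ ^ (k + 1 + 1) :=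
        Finset.sum_nonneg fun k _ => by positivity
      have h2 : 0 ≤ (∑' k, |dif^[J + 1] x k|) / δ ^ (J + 1) :=
        div_nonneg (tsum_nonneg fun k => abs_nonneg _) (by positivity)
      have h3 : |x 0| ≤ |x 0| / δ := by
        rw [le_div_iff₀ hδ]
        exact mul_le_of_le_one_right (abs_nonneg _) hδ1
      simp only [pow_zero, mul_one, Complex.norm_real, Real.norm_eq_abs, Function.iterate_zero, id,
        zero_add, pow_one]
      linarith
    have hwp : 0 < ‖w‖ := norm_pos_iff.2 hw0
    have hx1 : Summable fun k => |x (k + 1)| * ‖w‖ ^ k := by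
      have := ((summable_nat_add_iff 1).2 hx).mul_left (‖w‖⁻¹)
      refine this.congr fun k => ?_
      rw [pow_succ]
      field_simp
    have hdx : Summable fun k => |dif x k| * ‖w‖ ^ k := by
      refine Summable.of_nonneg_of_le (fun k => by positivity) (fun k => ?_) (hx1.add hx)
      rw [← add_mul]
      gcongr
      exact abs_sub _ _
    have h1 := ih (dif x) hdx (by simpa only [Function.iterate_succ_apply] using hJ)
    -- Abel's identity: each summation by parts trades a difference of the coefficients for one
    -- factor 1/(1-w).
    have h2 : (1 - w) * ∑' k, (x k : ℂ) * w ^ k = x 0 + w * ∑' k, (dif x k : ℂ) * w ^ k := by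
      have e1 : ∑' k, (dif x k : ℂ) * w ^ k = ∑' k, (x (k + 1) : ℂ) * w ^ k - ∑' k, (x k : ℂ) * w ^ k := by
        rw [← (hs (fun k => x (k + 1)) hx1).tsum_sub (hs _ hx)]
        congr 1
        ext k
        simp only [dif]
        push_cast
        ring
      have e2 : ∑' k, (x k : ℂ) * w ^ k = x 0 + w * ∑' k, (x (k + 1) : ℂ) * w ^ k := by
        rw [(hs _ hx).tsum_eq_zero_add, ← tsum_mul_left]
        simp only [pow_zero, mul_one]
        congr 1
        congr 1
        ext k
        ring
      rw [e1]
      linear_combination e2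
    have h3 : δ * ‖∑' k, (x k : ℂ) * w ^ k‖ ≤ |x 0| + ‖∑' k, (dif x k : ℂ) * w ^ k‖ := by
      calc δ * ‖∑' k, (x k : ℂ) * w ^ k‖ ≤ ‖1 - w‖ * ‖∑' k, (x k : ℂ) * w ^ k‖ := by gcongr
        _ = ‖x 0 + w * ∑' k, (dif x k : ℂ) * w ^ k‖ := by rw [← norm_mul, h2]
        _ ≤ ‖(x 0 : ℂ)‖ + ‖w * ∑' k, (dif x k : ℂ) * w ^ k‖ := norm_add_le _ _
        _ ≤ |x 0| + ‖∑' k, (dif x k : ℂ) * w ^ k‖ := by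
          rw [Complex.norm_real, Real.norm_eq_abs, norm_mul]
          gcongr
          exact mul_le_of_le_one_left (norm_nonneg _) hw1
    have h4 : ‖∑' k, (x k : ℂ) * w ^ k‖ ≤ (|x 0| + ‖∑' k, (dif x k : ℂ) * w ^ k‖) / δ := by
      rw [le_div_iff₀ hδ, mul_comm]; exact h3
    refine h4.trans ?_
    rw [Finset.sum_range_succ']
    simp only [Function.iterate_zero, id, zero_add, pow_one, Function.iterate_succ_apply] at h1 ⊢
    calc (|x 0| + ‖∑' k, (dif x k : ℂ) * w ^ k‖) / δ
        ≤ (|x 0| + (∑ j ∈ Finset.range J, |dif^[j] (dif x) 0| / δ ^ (j + 1) +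
          (∑' k, |dif^[J] (dif x) k|) / δ ^ J)) / δ := by gcongr
      _ = _ := by
        rw [add_div, add_div, Finset.sum_div]
        simp only [div_div, ← pow_succ]
        ring

lemma tsum_inv_sq_le {a : ℝ} (ha : 1 ≤ a) :
    (Summable fun k : ℕ => 1 / (a + k) ^ 2) ∧ ∑' k : ℕ, 1 / (a + k) ^ 2 ≤ 2 / a := by
  have h0 : ∀ n : ℕ, ∑ k ∈ Finset.range n, 1 / (a + k) ^ 2 ≤ 2 / a - 2 / (a + n) := by
    intro n
    induction n with
    | zero => simp
    | succ n ih =>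
      rw [Finset.sum_range_succ]
      have hx : 1 ≤ a + n := by linarith [Nat.cast_nonneg (α := ℝ) n]
      have h1 : 1 / (a + n) ^ 2 ≤ 2 / (a + n) - 2 / (a + n + 1) := by
        rw [div_sub_div _ _ (by positivity) (by positivity), div_le_div_iff₀ (by positivity) (by positivity)]
        nlinarith [sq_nonneg (a + n)]
      push_cast
      rw [← add_assoc]
      linarith
  have h1 : ∀ n : ℕ, ∑ k ∈ Finset.range n, 1 / (a + k) ^ 2 ≤ 2 / a := fun n =>
    (h0 n).trans (sub_le_self _ (by positivity))
  exact ⟨summable_of_sum_range_le (fun k => by positivity) h1,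
    Real.tsum_le_of_sum_range_le (fun k => by positivity) h1⟩

/-- Size of a power series whose coefficients form a symbol, near the boundary point `1`. -/
lemma exists_norm_tsum_symbol_le {x m : ℕ → ℝ} (hx : ∀ J, SymbolTo J x m) (hm0 : ∀ k, 0 < m k)
    (hmono : Monotone m) {D : ℝ} (hD0 : 0 ≤ D) {b : ℕ}
    (hD : ∀ k l, m (k + l) ≤ D * ((k + l + 1 : ℝ) / (k + 1)) ^ b * m k) :
    ∃ C, 0 ≤ C ∧ ∀ w : ℂ, ‖w‖ < 1 → ∀ L : ℕ, 1 / (L + 1 : ℝ) ≤ ‖1 - w‖ →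
      ‖∑' k, (x k : ℂ) * w ^ k‖ ≤ C * ((L + 1) * m L) := by
  -- The majorant grows at most like k^b, so after b + 2 differences the coefficients are dominated
  -- by the summable sequence k^(-2).
  set J := b + 2
  choose C hC0 hC using fun j : Fin (J + 1) => hx J j (Nat.lt_succ_iff.1 j.2)
  set E := ∑ j, C j with hE
  have hE0 : 0 ≤ E := Finset.sum_nonneg fun j _ => hC0 j
  have hCE : ∀ j ≤ J, ∀ k, |dif^[j] x k| ≤ E * (m k / (k + 1 : ℝ) ^ j) := by
    intro j hj k
    refine (hC ⟨j, Nat.lt_succ_iff.2 hj⟩ k).trans ?_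
    have := (hm0 k).le
    gcongr
    exact Finset.single_le_sum (f := C) (fun i _ => hC0 i) (Finset.mem_univ _)
  refine ⟨E + J * E + 2 * (E * D), by positivity, fun w hw L hL => ?_⟩
  have hL0 : (0 : ℝ) < L + 1 := by positivity
  have hmL := hm0 L
  have hsum0 : Summable fun k => |x k| * ‖w‖ ^ k := by
    have h1 := summable_pow_mul_geometric_of_norm_lt_one b (r := ‖w‖) (by simpa using hw)
    have h2 := ((summable_nat_add_iff 1).2 h1).mul_left (E * (D * m 0))
    by_cases hw0 : w = 0
    · refine summable_of_ne_finset_zero (s := {0}) fun k hk => ?_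
      simp at hk
      simp [hw0, hk]
    have hwp : 0 < ‖w‖ := norm_pos_iff.2 hw0
    refine Summable.of_nonneg_of_le (fun k => by positivity) (fun k => ?_) (h2.mul_left ‖w‖⁻¹)
    have h3 := hCE 0 (Nat.zero_le _) k
    simp only [Function.iterate_zero, id, pow_zero, div_one] at h3
    have h4 := hD 0 k
    simp only [zero_add, Nat.cast_zero, div_one] at h4
    calc |x k| * ‖w‖ ^ k ≤ (E * (D * (k + 1 : ℝ) ^ b * m 0)) * ‖w‖ ^ k := by
          gcongr; exact h3.trans (by gcongr)
      _ = _ := by push_cast; rw [pow_succ ‖w‖]; field_simp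
  have hsumC : Summable fun k => (x k : ℂ) * w ^ k := by
    apply Summable.of_norm
    refine hsum0.congr fun k => ?_
    rw [norm_mul, norm_pow, Complex.norm_real, Real.norm_eq_abs]
  -- Below L, the scale at which ‖1 - w‖ is felt, the terms are bounded trivially by the increasing
  -- majorant; above L summation by parts is used, with δ = 1/(L+1).
  rw [← hsumC.sum_add_tsum_nat_add L]
  have hfirst : ‖∑ k ∈ Finset.range L, (x k : ℂ) * w ^ k‖ ≤ E * ((L + 1) * m L) := by
    refine (norm_sum_le _ _).trans ?_
    have : ∀ k ∈ Finset.range L, ‖(x k : ℂ) * w ^ k‖ ≤ E * m L := by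
      intro k hk
      rw [norm_mul, norm_pow, Complex.norm_real, Real.norm_eq_abs]
      have h3 := hCE 0 (Nat.zero_le _) k
      simp only [Function.iterate_zero, id, pow_zero, div_one] at h3
      refine (mul_le_of_le_one_right (abs_nonneg _) (pow_le_one₀ (norm_nonneg _) hw.le)).trans
        (h3.trans ?_)
      gcongr
      exact hmono (Finset.mem_range.1 hk).le
    refine (Finset.sum_le_sum this).trans ?_
    rw [Finset.sum_const, Finset.card_range, nsmul_eq_mul]
    nlinarith [mul_nonneg hE0 hmL.le]
  have hit : ∀ j k, dif^[j] (fun k => x (k + L)) k = dif^[j] x (k + L) := fun j k =>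
    congrFun (iterate_dif_shift_add x j L) k
  have hJb : ∀ k : ℕ, |dif^[J] x (k + L)| ≤
      (E * D * m L / (L + 1 : ℝ) ^ b) * (1 / ((L + 1 : ℝ) + k) ^ 2) := by
    intro k
    have h1 := hCE J le_rfl (k + L)
    have h2 := hD L k
    rw [add_comm k L] at h1 ⊢
    refine h1.trans ?_
    have h3 : m (L + k) / ((L + k : ℕ) + 1 : ℝ) ^ J ≤
        (D * ((L + k + 1 : ℝ) / (L + 1)) ^ b * m L) / ((L + k : ℕ) + 1 : ℝ) ^ J := by gcongr
    refine (mul_le_mul_of_nonneg_left h3 hE0).trans (le_of_eq ?_)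
    have : (0 : ℝ) < L + k + 1 := by positivity
    push_cast
    rw [show (L + 1 + k : ℝ) = L + k + 1 by ring, div_pow, pow_add]
    field_simp
  obtain ⟨hs1, hs2⟩ := tsum_inv_sq_le (a := L + 1) (by linarith [Nat.cast_nonneg (α := ℝ) L])
  have hJs : Summable fun k => |dif^[J] x (k + L)| :=
    Summable.of_nonneg_of_le (fun k => abs_nonneg _) hJb (hs1.mul_left _)
  have hJt : ∑' k, |dif^[J] x (k + L)| ≤ (E * D * m L / (L + 1 : ℝ) ^ b) * (2 / (L + 1)) := by
    refine (hJs.tsum_le_tsum hJb (hs1.mul_left _)).trans ?_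
    rw [tsum_mul_left]
    gcongr
  have hsecond : ‖∑' k, (x (k + L) : ℂ) * w ^ (k + L)‖ ≤ (J * E + 2 * (E * D)) * ((L + 1) * m L) := by
    have e : ∀ k, (x (k + L) : ℂ) * w ^ (k + L) = w ^ L * ((x (k + L) : ℂ) * w ^ k) := by
      intro k; ring
    simp_rw [e]
    rw [tsum_mul_left, norm_mul, norm_pow]
    refine (mul_le_of_le_one_left (norm_nonneg _) (pow_le_one₀ (norm_nonneg _) hw.le)).trans ?_
    have hxs : Summable fun k => |x (k + L)| * ‖w‖ ^ k := by
      by_cases hw0 : w = 0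
      · refine summable_of_ne_finset_zero (s := {0}) fun k hk => ?_
        simp at hk
        simp [hw0, hk]
      have hwp : 0 < ‖w‖ := norm_pos_iff.2 hw0
      refine (((summable_nat_add_iff L).2 hsum0).mul_left (‖w‖ ^ L)⁻¹).congr fun k => ?_
      rw [pow_add]
      field_simp
    have h := norm_tsum_mul_pow_le J (fun k => x (k + L)) (by positivity) hL hw.le hxs
      (by simpa only [hit] using hJs)
    simp only [hit, zero_add] at h
    refine h.trans ?_
    have hA : ∑ j ∈ Finset.range J, |dif^[j] x L| / (1 / (L + 1 : ℝ)) ^ (j + 1) ≤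
        J * (E * ((L + 1) * m L)) := by
      have : ∀ j ∈ Finset.range J, |dif^[j] x L| / (1 / (L + 1 : ℝ)) ^ (j + 1) ≤
          E * ((L + 1) * m L) := by
        intro j hj
        have h1 := hCE j (Finset.mem_range.1 hj).le L
        calc |dif^[j] x L| / (1 / (L + 1 : ℝ)) ^ (j + 1) ≤
              (E * (m L / (L + 1 : ℝ) ^ j)) / (1 / (L + 1 : ℝ)) ^ (j + 1) := by gcongr
          _ = _ := by rw [one_div, inv_pow, pow_succ]; field_simp
      refine (Finset.sum_le_sum this).trans ?_
      rw [Finset.sum_const, Finset.card_range, nsmul_eq_mul]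
    have hB : (∑' k, |dif^[J] x (k + L)|) / (1 / (L + 1 : ℝ)) ^ J ≤ 2 * (E * D) * ((L + 1) * m L) := by
      calc (∑' k, |dif^[J] x (k + L)|) / (1 / (L + 1 : ℝ)) ^ J
          ≤ ((E * D * m L / (L + 1 : ℝ) ^ b) * (2 / (L + 1))) / (1 / (L + 1 : ℝ)) ^ J := by gcongr
        _ = _ := by rw [one_div, inv_pow, pow_add]; field_simp
    calc _ ≤ J * (E * ((L + 1) * m L)) + 2 * (E * D) * ((L + 1) * m L) := add_le_add hA hB
      _ = _ := by ring
  calc _ ≤ _ := norm_add_le _ _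
    _ ≤ E * ((L + 1) * m L) + (J * E + 2 * (E * D)) * ((L + 1) * m L) := add_le_add hfirst hsecond
    _ = _ := by ring

/-! ### Moments of the weight and the size of the kernel. -/

/-- The moments `∫ r ^ (2 k) 2 r ν(r) dr`. -/
def mom (ν : ℂ → ℝ) (k : ℕ) : ℝ := ∫ r, r ^ (2 * k) ∂(radialPart ν)

lemma integrable_radialPart_pow {ν : ℂ → ℝ} (hν : IsRadialWeight ν) (k : ℕ) :
    Integrable (fun r : ℝ => r ^ k) (radialPart ν) := by
  have := isFiniteMeasure_radialPart hν
  refine (integrable_const (1 : ℝ)).mono' (by fun_prop) ?_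
  filter_upwards [ae_radialPart ν] with r hr
  rw [Real.norm_eq_abs, abs_of_nonneg (pow_nonneg hr.1.le _)]
  exact pow_le_one₀ hr.1.le hr.2.le

lemma tl_shift_bounds {ν : ℂ → ℝ} {C : ℝ} {β : ℕ}
    (h : ∀ x r : ℝ, 0 ≤ x → x ≤ r → r < 1 → tl ν x ≤ C * ((1 - x) / (1 - r)) ^ β * tl ν r) (k l : ℕ) :
    tl ν (1 - 1 / (k + 1)) ≤ C * ((k + l + 1 : ℝ) / (k + 1)) ^ β * tl ν (1 - 1 / ((k + l : ℕ) + 1)) := by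
  have h1 : (0 : ℝ) < k + 1 := by positivity
  have h2 : (0 : ℝ) < (k + l : ℕ) + 1 := by positivity
  have h3 := h (1 - 1 / (k + 1)) (1 - 1 / ((k + l : ℕ) + 1))
    (by rw [sub_nonneg, div_le_one h1]; linarith [Nat.cast_nonneg (α := ℝ) k])
    (by apply sub_le_sub_left; apply one_div_le_one_div_of_le h1; push_cast; linarith [Nat.cast_nonneg (α := ℝ) l])
    (by linarith [one_div_pos.2 h2])
  convert h3 using 4
  push_cast
  field_simp
  ring

lemma one_sub_one_div_nonneg (k : ℕ) : (0 : ℝ) ≤ 1 - 1 / (k + 1) := by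
  rw [sub_nonneg, div_le_one (by positivity)]
  linarith [Nat.cast_nonneg (α := ℝ) k]

lemma one_sub_one_div_lt (k : ℕ) : (1 - 1 / (k + 1) : ℝ) < 1 := by
  have : (0 : ℝ) < 1 / (k + 1) := by positivity
  linarith

lemma tl_one_sub_pos {ν : ℂ → ℝ} (hν : IsDoublingWeight ν) (k : ℕ) : 0 < tl ν (1 - 1 / (k + 1)) :=
  tl_pos hν (one_sub_one_div_nonneg k) (one_sub_one_div_lt k)

/-- On the interval within 1/(k+2) of 1 the power r^(2k) stays above a fixed constant, so the moment
is at least a constant times the mass there; doubling replaces k + 2 by k + 1. -/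
lemma exists_mul_tl_le_mom {ν : ℂ → ℝ} (hν : IsDoublingWeight ν) :
    ∃ c, 0 < c ∧ ∀ k : ℕ, c * tl ν (1 - 1 / (k + 1)) ≤ mom ν k := by
  obtain ⟨C, β, hC, h⟩ := exists_tl_le_mul_pow hν
  refine ⟨2 * Real.exp (-2) / (C * 2 ^ β), by positivity, fun k => ?_⟩
  have hfin := isFiniteMeasure_radialPart hν.toIsRadialWeight
  -- This is 1 - 1/(k+2). The point 1 - 1/(k+1) would be 0 for k = 0, where the factor 2x in the
  -- bound for the mass vanishes.
  set x : ℝ := 1 - 1 / ((k + 1 : ℕ) + 1) with hx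
  have hx0 : 0 ≤ x := one_sub_one_div_nonneg (k + 1)
  have hk : (0 : ℝ) < k + 1 := by positivity
  have hxe : Real.exp (-2) ≤ x ^ (2 * k + 1) := by
    have h1 : x = ((k + 2 : ℝ) / (k + 1))⁻¹ := by
      rw [hx]; push_cast; field_simp; ring
    have h2 : (k + 2 : ℝ) / (k + 1) ≤ Real.exp (1 / (k + 1)) := by
      have := Real.add_one_le_exp (1 / (k + 1 : ℝ))
      refine le_trans (le_of_eq ?_) this
      field_simp; ring
    have h3 : Real.exp (-(1 / (k + 1))) ≤ x := by
      rw [h1, Real.exp_neg]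
      exact inv_anti₀ (by positivity) h2
    calc Real.exp (-2) ≤ Real.exp (((2 * k + 1 : ℕ) : ℝ) * -(1 / (k + 1))) := by
          apply Real.exp_le_exp.2
          push_cast
          rw [mul_neg, neg_le_neg_iff, mul_one_div, div_le_iff₀ hk]
          linarith
      _ = Real.exp (-(1 / (k + 1))) ^ (2 * k + 1) := by rw [Real.exp_nat_mul]
      _ ≤ _ := pow_le_pow_left₀ (Real.exp_pos _).le h3 _
  have h1 : x ^ (2 * k) * (2 * x * tl ν x) ≤ mom ν k := by
    have h2 : 2 * x * tl ν x ≤ (radialPart ν).real (Ioo x 1) := by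
      have := ENNReal.toReal_mono (measure_ne_top (radialPart ν) (Ioo x 1))
        (ofReal_mul_tail_le hν.toIsRadialWeight hx0)
      rwa [ENNReal.toReal_mul, ENNReal.toReal_ofReal (by positivity)] at this
    calc x ^ (2 * k) * (2 * x * tl ν x) ≤ x ^ (2 * k) * (radialPart ν).real (Ioo x 1) := by gcongr
      _ = ∫ r in Ioo x 1, x ^ (2 * k) ∂(radialPart ν) := by
        rw [setIntegral_const, smul_eq_mul, mul_comm]
      _ ≤ ∫ r in Ioo x 1, r ^ (2 * k) ∂(radialPart ν) := by
        apply setIntegral_mono_on (integrable_const _).integrableOn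
          (integrable_radialPart_pow hν.toIsRadialWeight _).integrableOn measurableSet_Ioo
        intro r hr
        exact pow_le_pow_left₀ hx0 hr.1.le _
      _ ≤ mom ν k := by
        apply setIntegral_le_integral (integrable_radialPart_pow hν.toIsRadialWeight _)
        filter_upwards [ae_radialPart ν] with r hr
        exact pow_nonneg hr.1.le _
  have h2 := tl_shift_bounds h k 1
  have h3 : tl ν (1 - 1 / (k + 1)) ≤ C * 2 ^ β * tl ν x := by
    refine h2.trans ?_
    have : 0 ≤ tl ν x := ENNReal.toReal_nonneg
    have h4 : ((k + (1 : ℕ) + 1 : ℝ) / (k + 1)) ≤ 2 := by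
      rw [div_le_iff₀ hk]; push_cast; linarith [Nat.cast_nonneg (α := ℝ) k]
    gcongr
  have h0 : 0 ≤ tl ν x := ENNReal.toReal_nonneg
  calc 2 * Real.exp (-2) / (C * 2 ^ β) * tl ν (1 - 1 / (k + 1))
      ≤ 2 * Real.exp (-2) / (C * 2 ^ β) * (C * 2 ^ β * tl ν x) := by gcongr
    _ = 2 * Real.exp (-2) * tl ν x := by field_simp
    _ ≤ 2 * x ^ (2 * k + 1) * tl ν x := by gcongr
    _ = x ^ (2 * k) * (2 * x * tl ν x) := by ring
    _ ≤ _ := h1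

/-- With m the integer part of (k+1)(1-r) one has r^k ≤ e^(1-m), while by doubling the mass beyond
distance (m+1)/(k+1) from 1 exceeds the tail at 1 - 1/(k+1) by at most a multiple of (m+1)^β. The
exponential wins in the sum over m. -/
lemma exists_integral_pow_le {ν : ℂ → ℝ} (hν : IsDoublingWeight ν) :
    ∃ C, 0 ≤ C ∧ ∀ k : ℕ, ∫ r, r ^ k ∂(radialPart ν) ≤ C * tl ν (1 - 1 / (k + 1)) := by
  obtain ⟨C, β, hC, h⟩ := exists_tl_le_mul_pow hν
  have hfin := isFiniteMeasure_radialPart hν.toIsRadialWeight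
  have hsum : Summable fun m : ℕ => Real.exp (1 - m) * (2 * (C * (m + 1 : ℝ) ^ β)) := by
    have h1 := Real.summable_pow_mul_exp_neg_nat_mul β (r := 1) one_pos
    have h2 := ((summable_nat_add_iff 1).2 h1).mul_left (2 * C * Real.exp 2)
    refine h2.congr fun m => ?_
    push_cast
    rw [show (1 - m : ℝ) = 2 + -1 * (m + 1) by ring, Real.exp_add]
    ring
  set S := ∑' m : ℕ, Real.exp (1 - m) * (2 * (C * (m + 1 : ℝ) ^ β))
  have hS0 : 0 ≤ S := tsum_nonneg fun m => by positivity
  refine ⟨S, hS0, fun k => ?_⟩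
  have ht := tl_one_sub_pos hν k
  have hk : (0 : ℝ) < k + 1 := by positivity
  rw [integral_eq_lintegral_of_nonneg_ae _ (by fun_prop)]
  swap
  · filter_upwards [ae_radialPart ν] with r hr
    exact pow_nonneg hr.1.le _
  apply ENNReal.toReal_le_of_le_ofReal (by positivity)
  set X : ℕ → ℝ := fun m => max 0 (1 - (m + 1) / (k + 1))
  have hX0 : ∀ m, 0 ≤ X m := fun m => le_max_left _ _
  have hpt : ∀ r ∈ Ioo (0 : ℝ) 1, ENNReal.ofReal (r ^ k) ≤
      ∑' m : ℕ, (Ioo (X m) 1).indicator (fun _ => ENNReal.ofReal (Real.exp (1 - m))) r := by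
    intro r hr
    set m := ⌊(k + 1) * (1 - r)⌋₊
    have hm0 : 0 ≤ (k + 1) * (1 - r) := mul_nonneg hk.le (by linarith [hr.2])
    have hm1 : (m : ℝ) ≤ (k + 1) * (1 - r) := Nat.floor_le hm0
    have hm2 : (k + 1) * (1 - r) < m + 1 := Nat.lt_floor_add_one _
    refine le_trans ?_ (ENNReal.le_tsum m)
    rw [indicator_of_mem]
    · apply ENNReal.ofReal_le_ofReal
      have h1 : r ≤ Real.exp (-(1 - r)) := by
        have := Real.add_one_le_exp (-(1 - r)); linarith
      calc r ^ k ≤ Real.exp (-(1 - r)) ^ k := pow_le_pow_left₀ hr.1.le h1 _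
        _ = Real.exp (k * -(1 - r)) := by rw [Real.exp_nat_mul]
        _ ≤ _ := Real.exp_le_exp.2 (by nlinarith [hr.1])
    · refine ⟨max_lt hr.1 ?_, hr.2⟩
      rw [sub_lt_comm, lt_div_iff₀ hk]
      linarith
  calc ∫⁻ r, ENNReal.ofReal (r ^ k) ∂(radialPart ν)
      ≤ ∫⁻ r, ∑' m : ℕ, (Ioo (X m) 1).indicator (fun _ => ENNReal.ofReal (Real.exp (1 - m))) r
          ∂(radialPart ν) := by
        apply lintegral_mono_ae
        filter_upwards [ae_radialPart ν] with r hr using hpt r hr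
    _ = ∑' m : ℕ, ENNReal.ofReal (Real.exp (1 - m)) * radialPart ν (Ioo (X m) 1) := by
        rw [lintegral_tsum fun m => (measurable_const.indicator measurableSet_Ioo).aemeasurable]
        congr 1
        ext m
        rw [lintegral_indicator_const measurableSet_Ioo]
    _ ≤ ∑' m : ℕ, ENNReal.ofReal ((Real.exp (1 - m) * (2 * (C * (m + 1 : ℝ) ^ β))) *
          tl ν (1 - 1 / (k + 1))) := by
        apply ENNReal.tsum_le_tsum
        intro m
        rw [mul_assoc, ENNReal.ofReal_mul (Real.exp_pos _).le]
        gcongr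
        refine (radialPart_Ioo_le hν.toIsRadialWeight (hX0 m)).trans ?_
        rw [← ofReal_tl hν (hX0 m), show (2 : ℝ≥0∞) = ENNReal.ofReal 2 by simp,
          ← ENNReal.ofReal_mul zero_le_two]
        apply ENNReal.ofReal_le_ofReal
        rw [mul_assoc]
        gcongr
        have hm : (1 : ℝ) ≤ m + 1 := by linarith [Nat.cast_nonneg (α := ℝ) m]
        have hle : X m ≤ 1 - 1 / (k + 1) :=
          max_le (one_sub_one_div_nonneg k) (by gcongr)
        refine (h _ _ (hX0 m) hle (one_sub_one_div_lt k)).trans ?_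
        have h5 : (1 - X m) / (1 - (1 - 1 / (k + 1 : ℝ))) ≤ m + 1 := by
          rw [sub_sub_cancel, div_le_iff₀ (by positivity), mul_one_div]
          have := le_max_right 0 (1 - (m + 1 : ℝ) / (k + 1))
          simp only [X]
          linarith
        have h6 : 0 ≤ (1 - X m) / (1 - (1 - 1 / (k + 1 : ℝ))) := by
          rw [sub_sub_cancel]
          exact div_nonneg (by linarith [one_sub_one_div_lt k]) (by positivity)
        gcongr
    _ = ENNReal.ofReal (S * tl ν (1 - 1 / (k + 1))) := by
        rw [← ENNReal.ofReal_tsum_of_nonneg (fun m => by positivity) (hsum.mul_right _), tsum_mul_right]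

/-- A single term of the binomial expansion of (s + (1-s))^(k+j) is at most 1, and the binomial
coefficient is at least (k+1)^j / j!. -/
lemma pow_mul_one_sub_pow_le {s : ℝ} (hs : 0 ≤ s) (hs1 : s ≤ 1) (k j : ℕ) :
    s ^ k * (1 - s) ^ j ≤ j.factorial / (k + 1 : ℝ) ^ j := by
  have h1 : ((k + j).choose k : ℝ) * (s ^ k * (1 - s) ^ j) ≤ 1 := by
    have h2 := add_pow s (1 - s) (k + j)
    rw [add_sub_cancel, one_pow] at h2
    have h3 := Finset.single_le_sum (f := fun m => s ^ m * (1 - s) ^ (k + j - m) * ((k + j).choose m : ℝ))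
      (s := Finset.range (k + j + 1)) (fun i _ => by
        have : 0 ≤ 1 - s := by linarith
        positivity) (Finset.mem_range.2 (by omega : k < k + j + 1))
    rw [← h2] at h3
    simp only [Nat.add_sub_cancel_left] at h3
    linarith
  have h4 : (k + 1 : ℝ) ^ j ≤ j.factorial * ((k + j).choose k : ℝ) := by
    have h5 := Nat.pow_succ_le_ascFactorial (k + 1) j
    rw [Nat.ascFactorial_eq_factorial_mul_choose, ← Nat.choose_symm_add] at h5
    exact_mod_cast h5
  rw [le_div_iff₀ (by positivity)]
  have h0 : 0 ≤ s ^ k * (1 - s) ^ j := mul_nonneg (pow_nonneg hs _) (pow_nonneg (by linarith) _)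
  calc s ^ k * (1 - s) ^ j * (k + 1 : ℝ) ^ j
      ≤ s ^ k * (1 - s) ^ j * (j.factorial * ((k + j).choose k : ℝ)) := by gcongr
    _ = j.factorial * (((k + j).choose k : ℝ) * (s ^ k * (1 - s) ^ j)) := by ring
    _ ≤ j.factorial * 1 := by gcongr
    _ = _ := mul_one _

lemma iterate_dif_mom {ν : ℂ → ℝ} (hν : IsRadialWeight ν) (j : ℕ) :
    dif^[j] (mom ν) = fun k => ∫ r, r ^ (2 * k) * (r ^ 2 - 1) ^ j ∂(radialPart ν) := by
  have hfin := isFiniteMeasure_radialPart hν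
  induction j with
  | zero => ext k; simp [mom]
  | succ j ih =>
    rw [Function.iterate_succ_apply', ih]
    ext k
    have hint : ∀ k, Integrable (fun r : ℝ => r ^ (2 * k) * (r ^ 2 - 1) ^ j) (radialPart ν) := by
      intro k
      refine (integrable_const (1 : ℝ)).mono' (by fun_prop) ?_
      filter_upwards [ae_radialPart ν] with r hr
      rw [norm_mul, norm_pow, norm_pow, Real.norm_eq_abs, Real.norm_eq_abs, abs_of_pos hr.1]
      apply mul_le_one₀ (pow_le_one₀ hr.1.le hr.2.le) (by positivity)
      apply pow_le_one₀ (abs_nonneg _)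
      rw [abs_le]
      constructor <;> nlinarith [hr.1, hr.2]
    rw [dif, ← integral_sub (hint _) (hint _)]
    congr 1
    ext r
    ring

/-- The j-th difference inserts (r^2-1)^j under the integral. One half of r^(2k) absorbs this factor
and yields (k+1)^(-j); the other half gives a moment. -/
lemma symbolTo_mom {ν : ℂ → ℝ} (hν : IsDoublingWeight ν) (J : ℕ) :
    SymbolTo J (mom ν) fun k => tl ν (1 - 1 / (k + 1)) := by
  obtain ⟨C, hC0, hC⟩ := exists_integral_pow_le hν
  intro j _
  refine ⟨j.factorial * 2 ^ j * C, by positivity, fun k => ?_⟩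
  rw [iterate_dif_mom hν.toIsRadialWeight]
  have h1 : ∀ᵐ r ∂(radialPart ν), ‖r ^ (2 * k) * (r ^ 2 - 1) ^ j‖ ≤
      (j.factorial / (k + 1 : ℝ) ^ j * 2 ^ j) * r ^ k := by
    filter_upwards [ae_radialPart ν] with r hr
    have h2 := pow_mul_one_sub_pow_le hr.1.le hr.2.le k j
    have h3 : |r ^ 2 - 1| = (1 - r) * (1 + r) := by
      rw [abs_of_nonpos (by nlinarith [hr.1, hr.2])]; ring
    have h4 : 0 ≤ 1 - r := by linarith [hr.2]
    rw [norm_mul, norm_pow, norm_pow, Real.norm_eq_abs, Real.norm_eq_abs, abs_of_pos hr.1, h3]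
    calc r ^ (2 * k) * ((1 - r) * (1 + r)) ^ j = (r ^ k * (1 - r) ^ j) * (1 + r) ^ j * r ^ k := by
          rw [mul_pow]; ring
      _ ≤ (j.factorial / (k + 1 : ℝ) ^ j) * 2 ^ j * r ^ k := by
          have := hr.1.le
          gcongr
          linarith [hr.2]
  rw [← Real.norm_eq_abs]
  refine (norm_integral_le_of_norm_le ((integrable_radialPart_pow hν.toIsRadialWeight k).const_mul _) h1).trans ?_
  rw [integral_const_mul]
  calc _ ≤ (j.factorial / (k + 1 : ℝ) ^ j * 2 ^ j) * (C * tl ν (1 - 1 / (k + 1))) := by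
        gcongr; exact hC k
    _ = _ := by ring

lemma mom_pos {ν : ℂ → ℝ} (hν : IsDoublingWeight ν) (k : ℕ) : 0 < mom ν k := by
  obtain ⟨c, hc, h⟩ := exists_mul_tl_le_mom hν
  exact (mul_pos hc (tl_one_sub_pos hν k)).trans_le (h k)

/-- The coefficients of the `n`-th derivative of the reproducing kernel. -/
def kercoef (ν : ℂ → ℝ) (n k : ℕ) : ℝ := (k + 1).ascFactorial n * (mom ν (k + n))⁻¹

lemma symbolTo_kercoef {ν : ℂ → ℝ} (hν : IsDoublingWeight ν) (n J : ℕ) :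
    SymbolTo J (kercoef ν n) fun k => (k + 1 : ℝ) ^ n * (tl ν (1 - 1 / (k + 1)))⁻¹ := by
  obtain ⟨C, β, hC, h⟩ := exists_tl_le_mul_pow hν
  obtain ⟨c, hc, hcm⟩ := exists_mul_tl_le_mom hν
  have ht := tl_one_sub_pos hν
  have hanti : ∀ k : ℕ, tl ν (1 - 1 / ((k + 1 : ℕ) + 1)) ≤ tl ν (1 - 1 / (k + 1)) := fun k =>
    tl_anti hν (one_sub_one_div_nonneg k) (by gcongr; simp)
  have hD : ∀ k : ℕ, tl ν (1 - 1 / (k + 1)) ≤ C * 2 ^ β * tl ν (1 - 1 / ((k + 1 : ℕ) + 1)) := by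
    intro k
    refine (tl_shift_bounds h k 1).trans ?_
    have := (ht (k + 1)).le
    gcongr
    rw [div_le_iff₀ (by positivity)]; push_cast; linarith [Nat.cast_nonneg (α := ℝ) k]
  have hinv := (symbolTo_mom hν J).inv ht (mom_pos hν) hc hcm hanti (by positivity) hD
  have hsh : SymbolTo J (fun k => (mom ν (k + n))⁻¹) fun k => (tl ν (1 - 1 / (k + 1)))⁻¹ := by
    clear hcm
    induction n with
    | zero => exact hinv
    | succ n ih =>
      have := ih.shift (fun k => (inv_pos.2 (ht k)).le) (D := C * 2 ^ β) (by positivity) (fun k => by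
        rw [← div_eq_mul_inv, le_div_iff₀ (ht k), ← div_eq_inv_mul, div_le_iff₀ (ht (k + 1))]
        exact hD k)
      convert this using 4
      omega
  have := (symbolTo_ascFactorial J n).mul hsh (fun k => by positivity)
    (fun k => (inv_pos.2 (ht k)).le) (D := 2 ^ n) (by positivity) (fun k => by
      rw [← mul_pow]
      push_cast
      gcongr
      linarith [Nat.cast_nonneg (α := ℝ) k])
  exact this

/-- Coefficients of size k^n / ν̂(1-1/k) with symbol estimates add up, at distance at least 1/L from
the point 1, to no more than L times the coefficient at L. -/
lemma exists_norm_kernel_le {ν : ℂ → ℝ} (hν : IsDoublingWeight ν) (n : ℕ) :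
    ∃ C, 0 ≤ C ∧ ∀ w : ℂ, ‖w‖ < 1 → ∀ j : ℕ, (1 / 2 : ℝ) ^ j ≤ ‖1 - w‖ →
      ‖∑' k, (kercoef ν n k : ℂ) * w ^ k‖ ≤ C * (2 ^ (j * (n + 1)) / tl ν (1 - (1 / 2) ^ j)) := by
  obtain ⟨C, β, hC, h⟩ := exists_tl_le_mul_pow hν
  have ht := tl_one_sub_pos hν
  obtain ⟨E, hE0, hE⟩ := exists_norm_tsum_symbol_le (symbolTo_kercoef hν n)
    (fun k => mul_pos (by positivity) (inv_pos.2 (ht k)))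
    (fun k l hkl => by
      have h1 := tl_anti hν (one_sub_one_div_nonneg k) (y := 1 - 1 / (l + 1)) (by gcongr)
      have := ht l
      have := (inv_pos.2 (ht k)).le
      have : (k : ℝ) ≤ l := by exact_mod_cast hkl
      gcongr) (D := C) (by linarith) (b := n + β) (fun k l => by
      have h1 := tl_shift_bounds h k l
      have h2 : (tl ν (1 - 1 / ((k + l : ℕ) + 1)))⁻¹ ≤
          C * ((k + l + 1 : ℝ) / (k + 1)) ^ β * (tl ν (1 - 1 / (k + 1)))⁻¹ := by
        rw [← div_eq_mul_inv, le_div_iff₀ (ht k), ← div_eq_inv_mul, div_le_iff₀ (ht (k + l))]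
        exact h1
      have h3 : (((k + l : ℕ) : ℝ) + 1) ^ n = ((k + l + 1 : ℝ) / (k + 1)) ^ n * (k + 1 : ℝ) ^ n := by
        rw [← mul_pow, div_mul_cancel₀ _ (by positivity)]; push_cast; ring
      rw [h3]
      calc _ ≤ ((k + l + 1 : ℝ) / (k + 1)) ^ n * (k + 1 : ℝ) ^ n *
            (C * ((k + l + 1 : ℝ) / (k + 1)) ^ β * (tl ν (1 - 1 / (k + 1)))⁻¹) := by gcongr
        _ = _ := by rw [pow_add]; ring)
  refine ⟨E, hE0, fun w hw j hj => ?_⟩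
  -- The cutoff L = 2^j - 1 turns L + 1 into the dyadic scale 2^j.
  have h1 : ((2 ^ j - 1 : ℕ) : ℝ) + 1 = 2 ^ j := by
    rw [Nat.cast_sub Nat.one_le_two_pow]; push_cast; ring
  have h2 := hE w hw (2 ^ j - 1) (by
    rw [h1]
    refine le_trans (le_of_eq ?_) hj
    rw [one_div_pow])
  refine h2.trans (le_of_eq ?_)
  rw [h1, one_div_pow, pow_mul, pow_succ]
  ring

/-! ### Dyadic model kernels and Schur's test. -/

/-- The index of the dyadic annulus containing a point of the disc. -/
def lev (z : ℂ) : ℕ := Nat.log 2 ⌊1 / (1 - ‖z‖)⌋₊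

lemma measurable_lev : Measurable lev := by
  unfold lev
  exact (measurable_from_top (f := fun n : ℕ => Nat.log 2 n)).comp
    (Nat.measurable_floor.comp (by fun_prop))

lemma measurable_comp_lev (f : ℕ → ℝ≥0∞) : Measurable fun z => f (lev z) :=
  (measurable_from_top (f := f)).comp measurable_lev

lemma lev_spec {z : ℂ} (hz : z ∈ disc) :
    (1 / 2 : ℝ) ^ (lev z + 1) < 1 - ‖z‖ ∧ 1 - ‖z‖ ≤ (1 / 2 : ℝ) ^ lev z := by
  rw [mem_ball_zero_iff] at hz
  have h0 : 0 < 1 - ‖z‖ := by linarith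
  have h1 : 1 ≤ 1 / (1 - ‖z‖) := by rw [le_div_iff₀ h0]; linarith [norm_nonneg z]
  have h2 : ⌊1 / (1 - ‖z‖)⌋₊ ≠ 0 := by
    have := Nat.le_floor (a := 1 / (1 - ‖z‖)) (n := 1) (by simpa using h1)
    omega
  have h3 := Nat.pow_log_le_self 2 h2
  have h4 := Nat.lt_pow_succ_log_self (b := 2) one_lt_two ⌊1 / (1 - ‖z‖)⌋₊
  have h5 : (2 : ℝ) ^ lev z ≤ 1 / (1 - ‖z‖) := by
    refine le_trans ?_ (Nat.floor_le (by linarith))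
    exact_mod_cast h3
  have h6 : 1 / (1 - ‖z‖) < (2 : ℝ) ^ (lev z + 1) := by
    refine (Nat.lt_floor_add_one _).trans_le ?_
    exact_mod_cast h4
  constructor
  · rw [one_div_pow, one_div_lt (by positivity) h0]; exact h6
  · rw [one_div_pow, le_one_div h0 (by positivity)]; exact h5

lemma lev_eq_iff {z : ℂ} (hz : z ∈ disc) {i : ℕ} (h1 : (1 / 2 : ℝ) ^ (i + 1) < 1 - ‖z‖)
    (h2 : 1 - ‖z‖ ≤ (1 / 2 : ℝ) ^ i) : lev z = i := by
  obtain ⟨h3, h4⟩ := lev_spec hz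
  have h5 := lt_of_lt_of_le h1 h4
  have h6 := lt_of_lt_of_le h3 h2
  rw [pow_lt_pow_iff_right_of_lt_one₀ (by norm_num) (by norm_num)] at h5 h6
  omega

/-- Sequences of geometric decay. -/
def GeoDecay (x : ℕ → ℝ) : Prop :=
  ∃ C ρ : ℝ, 0 ≤ C ∧ 0 < ρ ∧ ρ < 1 ∧ ∀ l i, x (l + i) ≤ C * ρ ^ i * x l

/-- Sequences of geometric growth. -/
def GeoGrowth (x : ℕ → ℝ) : Prop :=
  ∃ C ρ : ℝ, 0 ≤ C ∧ 0 < ρ ∧ ρ < 1 ∧ ∀ l i, x l ≤ C * ρ ^ i * x (l + i)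

lemma GeoDecay.tsum_le {x : ℕ → ℝ} (h : GeoDecay x) (hx : ∀ l, 0 ≤ x l) :
    ∃ C, 0 ≤ C ∧ ∀ l, ∑' i, ENNReal.ofReal (x (l + i)) ≤ ENNReal.ofReal (C * x l) := by
  obtain ⟨C, ρ, hC, hρ0, hρ, h⟩ := h
  have hρ1 : 0 < 1 - ρ := by linarith
  refine ⟨C * (1 - ρ)⁻¹, by positivity, fun l => ?_⟩
  have hs : Summable fun i : ℕ => C * ρ ^ i * x l :=
    ((summable_geometric_of_lt_one hρ0.le hρ).mul_left C).mul_right _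
  refine (ENNReal.tsum_le_tsum fun i => ENNReal.ofReal_le_ofReal (h l i)).trans ?_
  have := hx l
  rw [← ENNReal.ofReal_tsum_of_nonneg (fun i => by positivity) hs, tsum_mul_right, tsum_mul_left,
    tsum_geometric_of_lt_one hρ0.le hρ]

lemma GeoGrowth.sum_le {x : ℕ → ℝ} (h : GeoGrowth x) (hx : ∀ l, 0 ≤ x l) :
    ∃ C, 0 ≤ C ∧ ∀ l, ∑ i ∈ Finset.range (l + 1), x i ≤ C * x l := by
  obtain ⟨C, ρ, hC, hρ0, hρ, h⟩ := h
  have hρ1 : 0 < 1 - ρ := by linarith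
  refine ⟨C * (1 - ρ)⁻¹, by positivity, fun l => ?_⟩
  have h1 : ∀ i ∈ Finset.range (l + 1), x i ≤ C * ρ ^ (l - i) * x l := by
    intro i hi
    have := h i (l - i)
    rwa [Nat.add_sub_cancel' (by simpa [Nat.lt_succ_iff] using hi)] at this
  refine (Finset.sum_le_sum h1).trans ?_
  rw [← Finset.sum_mul, ← Finset.mul_sum]
  have := hx l
  gcongr
  rw [← tsum_geometric_of_lt_one hρ0.le hρ]
  have h2 := Finset.sum_range_reflect (fun i => ρ ^ i) (l + 1)
  simp only [Nat.add_sub_cancel] at h2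
  rw [h2]
  exact (summable_geometric_of_lt_one hρ0.le hρ).sum_le_tsum _ fun i _ => by positivity

/-- For |φ| ≤ π/2 the distance is at least |sin φ|, and Jordan's inequality applies. Beyond π/2 the
cosine is nonpositive and the distance is at least 1. -/
lemma abs_div_pi_le_norm {ρ φ : ℝ} (hρ : 0 ≤ ρ) (hφ : |φ| ≤ Real.pi) :
    |φ| / Real.pi ≤ ‖1 - polar (ρ, φ)‖ := by
  have hsq : ‖1 - polar (ρ, φ)‖ ^ 2 = (ρ - Real.cos φ) ^ 2 + Real.sin φ ^ 2 := by
    rw [← Complex.normSq_eq_norm_sq, Complex.normSq_apply, polar, Complex.exp_mul_I]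
    simp [Complex.cos_ofReal_re, Complex.sin_ofReal_re]
    linear_combination (ρ ^ 2 - 1) * Real.sin_sq_add_cos_sq φ
  have hpi := Real.pi_pos
  apply (pow_le_pow_iff_left₀ (by positivity) (norm_nonneg _) two_ne_zero).1
  rw [hsq]
  rcases le_or_gt |φ| (Real.pi / 2) with h | h
  · have h1 := Real.mul_le_sin (abs_nonneg φ) h
    have h2 : |φ| / Real.pi ≤ Real.sin |φ| := by
      refine le_trans ?_ h1
      rw [div_mul_eq_mul_div]
      gcongr
      linarith [abs_nonneg φ]
    have h3 : Real.sin |φ| ^ 2 = Real.sin φ ^ 2 := by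
      rcases abs_cases φ with ⟨h, _⟩ | ⟨h, _⟩ <;> rw [h]; simp
    have h4 : (|φ| / Real.pi) ^ 2 ≤ Real.sin |φ| ^ 2 := pow_le_pow_left₀ (by positivity) h2 2
    nlinarith [sq_nonneg (ρ - Real.cos φ)]
  · have h1 : Real.cos φ ≤ 0 := by
      rw [← Real.cos_abs]
      exact Real.cos_nonpos_of_pi_div_two_le_of_le h.le (by linarith)
    have h2 : (|φ| / Real.pi) ^ 2 ≤ 1 := pow_le_one₀ (by positivity) ((div_le_one hpi).2 hφ)
    nlinarith [Real.sin_sq_add_cos_sq φ, mul_nonneg hρ (neg_nonneg.2 h1)]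

/-- Closeness of z̄ζ to 1 confines the angle of ζ to within πt of arg z. The constant 3 counts the
translates of this arc by multiples of 2π. -/
lemma circ_tent_le {z : ℂ} {r t : ℝ} (hr : 0 ≤ r) (ht : 0 ≤ t) :
    circ {θ | ‖1 - conj z * polar (r, θ)‖ < t} ≤ ENNReal.ofReal (3 * t) := by
  set θ₀ := z.arg
  have hpi := Real.pi_pos
  have hz : ∀ θ, conj z * polar (r, θ) = polar (‖z‖ * r, θ - θ₀) := by
    intro θ
    conv_lhs => rw [← Complex.norm_mul_exp_arg_mul_I z]
    simp only [polar, map_mul, Complex.conj_ofReal, ← Complex.exp_conj, Complex.conj_I]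
    rw [show (‖z‖ : ℂ) * Complex.exp (z.arg * -Complex.I) * (r * Complex.exp (θ * Complex.I)) =
      ‖z‖ * r * (Complex.exp (z.arg * -Complex.I) * Complex.exp (θ * Complex.I)) by ring,
      ← Complex.exp_add]
    push_cast
    congr 2
    simp only [θ₀]
    ring
  -- The difference of the two angles can leave [-π, π] by one period on either side, hence three
  -- balls.
  have hsub : {θ | ‖1 - conj z * polar (r, θ)‖ < t} ∩ Ioo (-Real.pi) Real.pi ⊆
      (Metric.ball θ₀ (Real.pi * t) ∪ Metric.ball (θ₀ + 2 * Real.pi) (Real.pi * t)) ∪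
        Metric.ball (θ₀ - 2 * Real.pi) (Real.pi * t) := by
    rintro θ ⟨h1, h2⟩
    rw [mem_ofPred_eq, hz] at h1
    have key : ∀ φ : ℝ, |φ| ≤ Real.pi → polar (‖z‖ * r, φ) = polar (‖z‖ * r, θ - θ₀) →
        |φ| < Real.pi * t := by
      intro φ hφ he
      have := (abs_div_pi_le_norm (ρ := ‖z‖ * r) (by positivity) hφ).trans_lt (he ▸ h1)
      rwa [div_lt_iff₀ hpi, mul_comm] at this
    have hθ₀ := Complex.neg_pi_lt_arg z
    have hθ₀' := Complex.arg_le_pi z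
    simp only [mem_union, Metric.mem_ball, Real.dist_eq]
    rcases le_or_gt (θ - θ₀) (-Real.pi) with h3 | h3
    · right
      rw [show θ - (θ₀ - 2 * Real.pi) = θ - θ₀ + 2 * Real.pi by ring]
      apply key _ _ (polar_add_two_pi _ _)
      rw [abs_le]
      constructor <;> linarith [h2.1]
    rcases le_or_gt (θ - θ₀) Real.pi with h4 | h4
    · left; left
      exact key _ (abs_le.2 ⟨h3.le, h4⟩) rfl
    · left; right
      rw [show θ - (θ₀ + 2 * Real.pi) = θ - θ₀ - 2 * Real.pi by ring]
      apply key
      · rw [abs_le]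
        constructor <;> linarith [h2.2]
      · rw [← polar_add_two_pi]; congr 2; ring
  rw [circ, Measure.smul_apply, Measure.restrict_apply' measurableSet_Ioo, smul_eq_mul]
  have h3 : volume ({θ | ‖1 - conj z * polar (r, θ)‖ < t} ∩ Ioo (-Real.pi) Real.pi) ≤
      ENNReal.ofReal (2 * Real.pi) * ENNReal.ofReal (3 * t) := by
    refine (measure_mono hsub).trans ((measure_union_le _ _).trans ?_)
    refine (add_le_add_left (measure_union_le _ _) _).trans ?_
    rw [Real.volume_ball, Real.volume_ball, Real.volume_ball, ← ENNReal.ofReal_add (by positivity)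
      (by positivity), ← ENNReal.ofReal_add (by positivity) (by positivity),
      ← ENNReal.ofReal_mul (by positivity)]
    apply ENNReal.ofReal_le_ofReal
    linarith
  calc _ ≤ (ENNReal.ofReal (2 * Real.pi))⁻¹ * (ENNReal.ofReal (2 * Real.pi) * ENNReal.ofReal (3 * t)) := by
        gcongr
    _ = _ := by
        rw [← mul_assoc, ENNReal.inv_mul_cancel (by simp [hpi]) ENNReal.ofReal_ne_top, one_mul]

/-- The dyadic model kernel. -/
def kern (A : ℕ → ℝ) (c : ℕ) (z ζ : ℂ) : ℝ≥0∞ :=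
  ∑' j : ℕ, {p : ℂ × ℂ | ‖1 - conj p.1 * p.2‖ < 2 ^ c * (1 / 2) ^ j}.indicator
    (fun _ => ENNReal.ofReal (2 ^ j * A j)) (z, ζ)

lemma measurableSet_tent (t : ℝ) : MeasurableSet {p : ℂ × ℂ | ‖1 - conj p.1 * p.2‖ < t} := by
  apply measurableSet_lt _ measurable_const
  have : Continuous fun p : ℂ × ℂ => ‖1 - conj p.1 * p.2‖ :=
    (continuous_const.sub ((Complex.continuous_conj.comp continuous_fst).mul continuous_snd)).norm
  exact this.measurable

lemma measurable_kern (A : ℕ → ℝ) (c : ℕ) : Measurable fun p : ℂ × ℂ => kern A c p.1 p.2 := by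
  unfold kern
  exact Measurable.tsum fun j => measurable_const.indicator (measurableSet_tent _)

lemma kern_comm (A : ℕ → ℝ) (c : ℕ) (z ζ : ℂ) : kern A c z ζ = kern A c ζ z := by
  unfold kern
  congr 1
  ext j
  have : ‖1 - conj z * ζ‖ = ‖1 - conj ζ * z‖ := by
    rw [← RCLike.norm_conj]
    simp [mul_comm]
  simp only [indicator, mem_ofPred_eq, this]

lemma one_sub_norm_le {z ζ : ℂ} (hz : z ∈ disc) : 1 - ‖ζ‖ ≤ ‖1 - conj z * ζ‖ := by
  rw [mem_ball_zero_iff] at hz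
  have h1 : ‖conj z * ζ‖ ≤ ‖ζ‖ := by
    rw [norm_mul, RCLike.norm_conj]
    exact mul_le_of_le_one_left (norm_nonneg _) hz.le
  have h2 := norm_sub_norm_le (1 : ℂ) (conj z * ζ)
  rw [norm_one] at h2
  linarith

lemma one_sub_norm_le' {z ζ : ℂ} (hζ : ζ ∈ disc) : 1 - ‖z‖ ≤ ‖1 - conj z * ζ‖ := by
  have : ‖1 - conj z * ζ‖ = ‖1 - conj ζ * z‖ := by
    rw [← RCLike.norm_conj]
    simp [mul_comm]
  rw [this]
  exact one_sub_norm_le hζ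

/-- As ‖1 - z̄ζ‖ ≥ 1 - ‖z‖ on the disc, the terms of the model kernel with j > lev z + c vanish;
likewise for ζ. -/
lemma le_lev_add {z : ℂ} (hz : z ∈ disc) {c j : ℕ} (h : 1 - ‖z‖ < 2 ^ c * (1 / 2) ^ j) : j ≤ lev z + c := by
  have h1 := (lev_spec hz).1.trans h
  have h2 : (1 / 2 : ℝ) ^ (lev z + 1 + c) < (1 / 2) ^ j := by
    calc (1 / 2 : ℝ) ^ (lev z + 1 + c) = (1 / 2) ^ (lev z + 1) * (1 / 2) ^ c := pow_add _ _ _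
      _ < (2 ^ c * (1 / 2) ^ j) * (1 / 2) ^ c := by gcongr
      _ = (1 / 2) ^ j := by
        rw [mul_right_comm, ← mul_pow]; norm_num
  rw [pow_lt_pow_iff_right_of_lt_one₀ (by norm_num) (by norm_num)] at h2
  omega

/-- For i < l the terms are A i · x i, dominated by the last one because of geometric growth. For i
≥ l they are A l · x i, dominated by the first one because of geometric decay. -/
lemma tsum_le_of_geo {A x : ℕ → ℝ} (hA : ∀ l, 0 < A l) (hx : ∀ l, 0 < x l) (hxd : GeoDecay x)
    (hAx : GeoGrowth fun l => A l * x l) :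
    ∃ C, 0 ≤ C ∧ ∀ l, ∑' i, ENNReal.ofReal (x i * A (min i l)) ≤ ENNReal.ofReal (C * (A l * x l)) := by
  obtain ⟨C1, h10, h1⟩ := hxd.tsum_le fun l => (hx l).le
  obtain ⟨C2, h20, h2⟩ := hAx.sum_le fun l => (mul_pos (hA l) (hx l)).le
  refine ⟨C2 + C1, by positivity, fun l => ?_⟩
  rw [← ENNReal.summable.sum_add_tsum_nat_add' (f := fun i => ENNReal.ofReal (x i * A (min i l))) (k := l),
    add_mul, ENNReal.ofReal_add (by have := hA l; have := hx l; positivity)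
      (by have := hA l; have := hx l; positivity)]
  apply add_le_add
  · rw [← ENNReal.ofReal_sum_of_nonneg fun i _ => (mul_pos (hx _) (hA _)).le]
    apply ENNReal.ofReal_le_ofReal
    refine le_trans ?_ (h2 l)
    rw [Finset.sum_range_succ]
    refine le_trans (le_of_eq ?_) (le_add_of_nonneg_right (mul_pos (hA l) (hx l)).le)
    apply Finset.sum_congr rfl
    intro i hi
    rw [min_eq_left (Finset.mem_range.1 hi).le, mul_comm]
  · calc ∑' i, ENNReal.ofReal (x (i + l) * A (min (i + l) l))
        = ENNReal.ofReal (A l) * ∑' i, ENNReal.ofReal (x (l + i)) := by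
          rw [← ENNReal.tsum_mul_left]
          congr 1
          ext i
          rw [min_eq_right (Nat.le_add_left l i), add_comm i l, mul_comm, ENNReal.ofReal_mul (hA l).le]
      _ ≤ ENNReal.ofReal (A l) * ENNReal.ofReal (C1 * x l) := by gcongr; exact h1 l
      _ = _ := by rw [← ENNReal.ofReal_mul (hA l).le]; congr 1; ring

/-- A radial measure on `(0, 1)` whose mass on the dyadic annuli is controlled by `m`. -/
structure HasProfile (ρ : Measure ℝ) (m : ℕ → ℝ) : Prop where
  ae_mem : ∀ᵐ r ∂ρ, r ∈ Ioo (0 : ℝ) 1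
  le : ∀ i, ρ (Ico (1 - (1 / 2) ^ i) (1 - (1 / 2) ^ (i + 1))) ≤ ENNReal.ofReal (m i)

/-- The j-th term has height 2^j A j and lives on an arc of measure O(2^(-j)), so it contributes O(A
j). Only j up to min (lev r) (lev z) + c occur, and geometric growth lets the last term dominate. -/
lemma exists_lintegral_circ_kern_le {A : ℕ → ℝ} (c : ℕ) (hA : ∀ l, 0 < A l) (hAg : GeoGrowth A)
    {D : ℝ} (hD0 : 0 ≤ D) (hD : ∀ l, A (l + 1) ≤ D * A l) :
    ∃ E, 0 ≤ E ∧ ∀ z ∈ disc, ∀ r ∈ Ioo (0 : ℝ) 1, ∫⁻ θ, kern A c z (polar (r, θ)) ∂circ ≤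
      ENNReal.ofReal (E * A (min (lev r) (lev z))) := by
  obtain ⟨C2, h20, h2⟩ := hAg.sum_le fun l => (hA l).le
  have hDc : ∀ l, A (l + c) ≤ D ^ c * A l := by
    intro l
    induction c with
    | zero => simp
    | succ c ih =>
      calc A (l + (c + 1)) ≤ D * A (l + c) := hD (l + c)
        _ ≤ D * (D ^ c * A l) := by gcongr
        _ = _ := by ring
  refine ⟨3 * 2 ^ c * (C2 * D ^ c), by positivity, fun z hz => ?_⟩
  set l := lev z
  intro r hr
  have hrd : (r : ℂ) ∈ disc := ofReal_mem_disc hr.1.le hr.2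
  set i := min (lev r) l
  have hm : ∀ j, Measurable fun θ => {p : ℂ × ℂ | ‖1 - conj p.1 * p.2‖ < 2 ^ c * (1 / 2) ^ j}.indicator
      (fun _ => ENNReal.ofReal (2 ^ j * A j)) (z, polar (r, θ)) := fun j =>
    (measurable_const.indicator (measurableSet_tent _)).comp
      (measurable_const.prodMk (continuous_polar_right r).measurable)
  unfold kern
  rw [lintegral_tsum fun j => (hm j).aemeasurable]
  have hj : ∀ j, ∫⁻ θ, {p : ℂ × ℂ | ‖1 - conj p.1 * p.2‖ < 2 ^ c * (1 / 2) ^ j}.indicator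
      (fun _ => ENNReal.ofReal (2 ^ j * A j)) (z, polar (r, θ)) ∂circ ≤
      if j ∈ Finset.range (i + c + 1) then ENNReal.ofReal (3 * 2 ^ c * A j) else 0 := by
    intro j
    have e : ∫⁻ θ, {p : ℂ × ℂ | ‖1 - conj p.1 * p.2‖ < 2 ^ c * (1 / 2) ^ j}.indicator
        (fun _ => ENNReal.ofReal (2 ^ j * A j)) (z, polar (r, θ)) ∂circ =
        ENNReal.ofReal (2 ^ j * A j) * circ {θ | ‖1 - conj z * polar (r, θ)‖ < 2 ^ c * (1 / 2) ^ j} := by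
      rw [← lintegral_indicator_const]
      · rfl
      · exact (measurableSet_tent _).preimage
          (measurable_const.prodMk (continuous_polar_right r).measurable)
    rw [e]
    split_ifs with h
    · refine (mul_le_mul_right (circ_tent_le hr.1.le (by positivity)) _).trans ?_
      rw [← ENNReal.ofReal_mul (by have := hA j; positivity)]
      apply ENNReal.ofReal_le_ofReal
      apply le_of_eq
      rw [one_div_pow]
      field_simp
    · rw [nonpos_iff_eq_zero, mul_eq_zero]
      right
      convert measure_empty (μ := circ)
      rw [eq_empty_iff_forall_notMem]
      intro θ hθ
      apply h
      rw [mem_ofPred_eq] at hθ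
      have hp : polar (r, θ) ∈ disc := polar_mem_disc hr.1.le hr.2 θ
      have h3 := le_lev_add hz ((one_sub_norm_le' hp).trans_lt hθ)
      have h4 := (one_sub_norm_le hz).trans_lt hθ
      rw [norm_polar, abs_of_pos hr.1] at h4
      have h5 := le_lev_add hrd (c := c) (j := j) (by
        rwa [Complex.norm_real, Real.norm_eq_abs, abs_of_pos hr.1])
      rw [Finset.mem_range]
      omega
  refine (ENNReal.tsum_le_tsum hj).trans ?_
  rw [tsum_eq_sum (s := Finset.range (i + c + 1)) fun j hj => if_neg hj]
  rw [Finset.sum_congr rfl fun j hj => if_pos hj,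
    ← ENNReal.ofReal_sum_of_nonneg fun j _ => by have := hA j; positivity]
  apply ENNReal.ofReal_le_ofReal
  rw [← Finset.mul_sum]
  calc 3 * 2 ^ c * ∑ j ∈ Finset.range (i + c + 1), A j ≤ 3 * 2 ^ c * (C2 * (D ^ c * A i)) := by
        gcongr
        exact (h2 (i + c)).trans (by gcongr; exact hDc i)
    _ = _ := by ring

lemma lev_polar {r : ℝ} (θ : ℝ) : lev (polar (r, θ)) = lev r := by
  simp only [lev, norm_polar, Complex.norm_real, Real.norm_eq_abs]

lemma measurable_kern_right (A : ℕ → ℝ) (c : ℕ) (z : ℂ) : Measurable (kern A c z) :=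
  Measurable.of_uncurry_left (f := kern A c) (measurable_kern A c)

lemma measurable_kern_polar (A : ℕ → ℝ) (c : ℕ) (z : ℂ) (r : ℝ) :
    Measurable fun θ => kern A c z (polar (r, θ)) :=
  (measurable_kern_right A c z).comp (continuous_polar_right r).measurable

/-- Row estimate for Schur's test: the circle means are summed over the dyadic annuli, the mass of
each being given by the profile. -/
lemma exists_lintegral_kern_le {A x m φ : ℕ → ℝ} (c : ℕ) (hA : ∀ l, 0 < A l) (hAg : GeoGrowth A)
    {D : ℝ} (hD0 : 0 ≤ D) (hD : ∀ l, A (l + 1) ≤ D * A l)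
    (hx : ∀ l, 0 < x l) (hxd : GeoDecay x) (hAx : GeoGrowth fun l => A l * x l)
    (hφ : ∀ l, 0 ≤ φ l) (hφm : ∀ l, φ l * m l ≤ x l) {ρ : Measure ℝ} [SFinite ρ] (hρ : HasProfile ρ m) :
    ∃ C, 0 ≤ C ∧ ∀ z ∈ disc, ∫⁻ ζ, kern A c z ζ * ENNReal.ofReal (φ (lev ζ)) ∂(polarMeasure ρ) ≤
      ENNReal.ofReal (C * (A (lev z) * x (lev z))) := by
  obtain ⟨C1, h10, h1⟩ := tsum_le_of_geo hA hx hxd hAx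
  obtain ⟨E, hE0, hE⟩ := exists_lintegral_circ_kern_le c hA hAg hD0 hD
  refine ⟨E * C1, by positivity, fun z hz => ?_⟩
  have hcirc := hE z hz
  set l := lev z
  have hmeas : Measurable fun ζ => kern A c z ζ * ENNReal.ofReal (φ (lev ζ)) :=
    (measurable_kern_right A c z).mul
      (measurable_comp_lev fun n => ENNReal.ofReal (φ n))
  rw [lintegral_polarMeasure ρ hmeas.aemeasurable]
  calc ∫⁻ r, ∫⁻ θ, kern A c z (polar (r, θ)) * ENNReal.ofReal (φ (lev (polar (r, θ)))) ∂circ ∂ρ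
      ≤ ∫⁻ r, ENNReal.ofReal (E * (A (min (lev r) l) * φ (lev r))) ∂ρ := by
        apply lintegral_mono_ae
        filter_upwards [hρ.ae_mem] with r hr
        have e : ∀ θ, kern A c z (polar (r, θ)) * ENNReal.ofReal (φ (lev (polar (r, θ)))) =
            kern A c z (polar (r, θ)) * ENNReal.ofReal (φ (lev r)) := fun θ => by rw [lev_polar]
        rw [lintegral_congr e]
        have hm := measurable_kern_polar A c z r
        rw [lintegral_mul_const _ hm]
        refine (mul_le_mul' (hcirc r hr) le_rfl).trans ?_
        rw [← ENNReal.ofReal_mul (mul_nonneg hE0 (hA _).le), mul_assoc]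
    _ ≤ ∫⁻ r, ∑' i : ℕ, (Ico (1 - (1 / 2 : ℝ) ^ i) (1 - (1 / 2) ^ (i + 1))).indicator
          (fun _ => ENNReal.ofReal (E * (A (min i l) * φ i))) r ∂ρ := by
        apply lintegral_mono_ae
        filter_upwards [hρ.ae_mem] with r hr
        refine le_trans ?_ (ENNReal.le_tsum (lev r))
        rw [indicator_of_mem]
        have := lev_spec (ofReal_mem_disc hr.1.le hr.2)
        rw [Complex.norm_real, Real.norm_eq_abs, abs_of_pos hr.1] at this
        exact ⟨by linarith [this.2], by linarith [this.1]⟩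
    _ ≤ ∑' i : ℕ, ENNReal.ofReal E * ENNReal.ofReal (x i * A (min i l)) := by
        rw [lintegral_tsum fun i => (measurable_const.indicator measurableSet_Ico).aemeasurable]
        apply ENNReal.tsum_le_tsum
        intro i
        rw [lintegral_indicator_const measurableSet_Ico]
        refine (mul_le_mul_right (hρ.le i) _).trans ?_
        have hAm := (hA (min i l)).le
        have hφi := hφ i
        rw [← ENNReal.ofReal_mul (by positivity), ← ENNReal.ofReal_mul hE0]
        apply ENNReal.ofReal_le_ofReal
        calc E * (A (min i l) * φ i) * m i = E * ((φ i * m i) * A (min i l)) := by ring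
          _ ≤ _ := by gcongr; exact hφm i
    _ ≤ _ := by
        rw [ENNReal.tsum_mul_left, mul_assoc, ENNReal.ofReal_mul hE0]
        gcongr
        exact h1 l


/-- Supplies the ratio of the geometric Schur weights. Both strict inequalities hold at δ = 1, hence
slightly to its right. -/
lemma exists_ratio {ρ₁ ρ₂ s : ℝ} (h1 : ρ₁ < 1) (h2 : ρ₂ < 1) :
    ∃ δ, 1 < δ ∧ δ * ρ₁ < 1 ∧ δ ^ s * ρ₂ < 1 := by
  have t1 : Filter.Tendsto (fun δ : ℝ => δ * ρ₁) (nhdsWithin 1 (Ioi 1)) (nhds (1 * ρ₁)) :=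
    ((continuous_id.mul continuous_const).tendsto 1).mono_left nhdsWithin_le_nhds
  have t2 : Filter.Tendsto (fun δ : ℝ => δ ^ s * ρ₂) (nhdsWithin 1 (Ioi 1)) (nhds (1 ^ s * ρ₂)) := by
    have : ContinuousAt (fun δ : ℝ => δ ^ s * ρ₂) 1 :=
      (Real.continuousAt_rpow_const 1 s (.inl one_ne_zero)).mul continuousAt_const
    exact this.tendsto.mono_left nhdsWithin_le_nhds
  have e1 := t1.eventually_lt_const (by simpa using h1)
  have e2 := t2.eventually_lt_const (by simpa using h2)
  obtain ⟨δ, hδ⟩ := (e1.and (e2.and self_mem_nhdsWithin)).exists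
  exact ⟨δ, hδ.2.2, hδ.1, hδ.2.1⟩

/-- Hölder's inequality for the splitting K u = (K φ)^((p-1)/p) · (K u^p φ^(1-p))^(1/p). -/
lemma lintegral_mul_rpow_le {α : Type*} [MeasurableSpace α] {μ : Measure α} {K u φ : α → ℝ≥0∞}
    (hK : Measurable K) (hu : Measurable u) (hφ : Measurable φ) (hφ0 : ∀ x, φ x ≠ 0)
    (hφt : ∀ x, φ x ≠ ∞) {p : ℝ} (hp : 1 < p) :
    (∫⁻ x, K x * u x ∂μ) ^ p ≤
      (∫⁻ x, K x * φ x ∂μ) ^ (p - 1) * ∫⁻ x, K x * (u x ^ p * φ x ^ (1 - p)) ∂μ := by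
  have hp0 : 0 < p := by linarith
  have h1 := ENNReal.lintegral_mul_norm_pow_le (μ := μ) (f := fun x => K x * φ x)
    (g := fun x => K x * (u x ^ p * φ x ^ (1 - p))) (hK.mul hφ).aemeasurable
    (hK.mul ((hu.pow_const _).mul (hφ.pow_const _))).aemeasurable
    (p := (p - 1) / p) (q := 1 / p) (by have : 0 ≤ p - 1 := by linarith
                                        positivity) (by positivity) (by field_simp; ring)
  have h2 : ∀ x, (K x * φ x) ^ ((p - 1) / p) * (K x * (u x ^ p * φ x ^ (1 - p))) ^ (1 / p) =
      K x * u x := by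
    intro x
    have e1 : (0 : ℝ) ≤ (p - 1) / p := div_nonneg (by linarith) hp0.le
    have e2 : (0 : ℝ) ≤ 1 / p := by positivity
    rw [ENNReal.mul_rpow_of_nonneg _ _ e1, ENNReal.mul_rpow_of_nonneg _ _ e2,
      ENNReal.mul_rpow_of_nonneg _ _ e2, ← ENNReal.rpow_mul, ← ENNReal.rpow_mul, mul_one_div_cancel hp0.ne',
      ENNReal.rpow_one]
    calc _ = (K x ^ ((p - 1) / p) * K x ^ (1 / p)) * u x *
          (φ x ^ ((p - 1) / p) * φ x ^ ((1 - p) * (1 / p))) := by ring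
      _ = K x * u x * 1 := by
        rw [← ENNReal.rpow_add_of_nonneg _ _ e1 e2, ← ENNReal.rpow_add _ _ (hφ0 x) (hφt x)]
        rw [show (p - 1) / p + 1 / p = 1 by field_simp; ring,
          show (p - 1) / p + (1 - p) * (1 / p) = 0 by field_simp; ring, ENNReal.rpow_one,
          ENNReal.rpow_zero]
      _ = _ := mul_one _
  simp_rw [h2] at h1
  refine (ENNReal.rpow_le_rpow h1 hp0.le).trans (le_of_eq ?_)
  rw [ENNReal.mul_rpow_of_nonneg _ _ hp0.le, ← ENNReal.rpow_mul, ← ENNReal.rpow_mul,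
    div_mul_cancel₀ _ hp0.ne', div_mul_cancel₀ _ hp0.ne', ENNReal.rpow_one]

/-- Schur's test for the dyadic model kernels. -/
lemma exists_schur {A o m : ℕ → ℝ} (c : ℕ) {p : ℝ} (hp : 1 < p) (hA : ∀ l, 0 < A l) (hAg : GeoGrowth A)
    {D : ℝ} (hD0 : 0 ≤ D) (hD : ∀ l, A (l + 1) ≤ D * A l)
    (ho : ∀ l, 0 < o l) (hod : GeoDecay o) {B : ℝ} (hB0 : 0 ≤ B)
    (hAo : ∀ l i, A l * o l ≤ B * (A (l + i) * o (l + i))) (hm : ∀ l, 0 < m l)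
    {ρ ρ' : Measure ℝ} [SFinite ρ] [SFinite ρ'] (hρ : HasProfile ρ m) (hρ' : HasProfile ρ' o) :
    ∃ C, 0 ≤ C ∧ ∀ u : ℂ → ℝ≥0∞, Measurable u →
      ∫⁻ z, (∫⁻ ζ, kern A c z ζ * u ζ ∂(polarMeasure ρ)) ^ p ∂(polarMeasure ρ') ≤
        ENNReal.ofReal C * ∫⁻ ζ, u ζ ^ p *
          ENNReal.ofReal (A (lev ζ) ^ p * o (lev ζ) * m (lev ζ) ^ (p - 1)) ∂(polarMeasure ρ) := by
  obtain ⟨C1, ρ1, hC1, hρ10, hρ1, h1⟩ := hAg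
  obtain ⟨C2, ρ2, hC2, hρ20, hρ2, h2⟩ := id hod
  obtain ⟨δ, hδ1, hδA, hδo⟩ := exists_ratio hρ1 hρ2 (s := p - 1)
  have hδ0 : 0 < δ := by linarith
  -- The Schur weight is φ = δ^l / (A l · m l). Its row integrals are O(δ^l), and θ is the (p-1)-st
  -- power of δ^l. Taking δ > 1 makes the almost increasing A o into the geometrically growing A o
  -- θ, while δ close to 1 preserves the decay of δ^l / A and of o θ.
  set θ : ℕ → ℝ := fun l => (δ ^ (p - 1)) ^ l
  have hδp : 1 < δ ^ (p - 1) := Real.one_lt_rpow hδ1 (by linarith)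
  have hθ : ∀ l, 0 < θ l := fun l => by positivity
  set x : ℕ → ℝ := fun l => δ ^ l / A l
  have hx : ∀ l, 0 < x l := fun l => div_pos (by positivity) (hA l)
  set φ : ℕ → ℝ := fun l => x l / m l
  have hφ : ∀ l, 0 < φ l := fun l => div_pos (hx l) (hm l)
  have hrow1 := exists_lintegral_kern_le (x := x) (φ := φ) (m := m) c hA ⟨C1, ρ1, hC1, hρ10, hρ1, h1⟩ hD0 hD hx
    ⟨C1, δ * ρ1, hC1, by positivity, hδA, fun l i => by
      have := h1 l i
      simp only [x]
      rw [div_le_iff₀ (hA _), mul_pow, pow_add]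
      have hAl := hA l
      calc δ ^ l * δ ^ i = δ ^ l * δ ^ i * (A l / A l) := by rw [div_self hAl.ne', mul_one]
        _ ≤ δ ^ l * δ ^ i * (C1 * ρ1 ^ i * A (l + i) / A l) := by gcongr
        _ = _ := by ring⟩
    ⟨1, δ⁻¹, zero_le_one, by positivity, inv_lt_one_of_one_lt₀ hδ1, fun l i => by
      simp only [x]
      rw [mul_div_cancel₀ _ (hA _).ne', mul_div_cancel₀ _ (hA _).ne', pow_add, inv_pow]
      apply le_of_eq
      field_simp⟩
    (fun l => (hφ l).le) (fun l => by simp only [φ]; rw [div_mul_cancel₀ _ (hm l).ne']) hρ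
  obtain ⟨E1, hE10, hE1⟩ := hrow1
  have hrow2 := exists_lintegral_kern_le (x := fun l => o l * θ l) (φ := θ) (m := o) c hA ⟨C1, ρ1, hC1, hρ10, hρ1, h1⟩ hD0 hD
    (fun l => mul_pos (ho l) (hθ l))
    ⟨C2, δ ^ (p - 1) * ρ2, hC2, by positivity, hδo, fun l i => by
      have h3 := h2 l i
      have := hθ (l + i)
      calc o (l + i) * θ (l + i) ≤ (C2 * ρ2 ^ i * o l) * θ (l + i) := by gcongr
        _ = _ := by simp only [θ]; rw [mul_pow, pow_add]; ring⟩
    ⟨B, (δ ^ (p - 1))⁻¹, hB0, by positivity, inv_lt_one_of_one_lt₀ hδp, fun l i => by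
      have h3 := hAo l i
      have := hθ l
      calc A l * (o l * θ l) = (A l * o l) * θ l := by ring
        _ ≤ B * (A (l + i) * o (l + i)) * θ l := by gcongr
        _ = _ := by simp only [θ]; rw [pow_add, inv_pow]; field_simp⟩
    (fun l => (hθ l).le) (fun l => le_of_eq (mul_comm _ _)) hρ'
  obtain ⟨E2, hE20, hE2⟩ := hrow2
  refine ⟨E1 ^ (p - 1) * E2, by positivity, fun u hu => ?_⟩
  set Φ : ℂ → ℝ≥0∞ := fun ζ => ENNReal.ofReal (φ (lev ζ))
  have hΦm : Measurable Φ := measurable_comp_lev fun n => ENNReal.ofReal (φ n)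
  set Ψ : ℂ → ℝ≥0∞ := fun ζ => u ζ ^ p * Φ ζ ^ (1 - p)
  have hΨm : Measurable Ψ := (hu.pow_const _).mul (hΦm.pow_const _)
  have hkz : ∀ z, Measurable (kern A c z) := measurable_kern_right A c
  have hdisc := ae_polarMeasure_mem_disc hρ.ae_mem
  have hdisc' := ae_polarMeasure_mem_disc hρ'.ae_mem
  have hθm : Measurable fun z => ENNReal.ofReal (θ (lev z)) :=
    measurable_comp_lev fun n => ENNReal.ofReal (θ n)
  have hsf : ∀ ρ : Measure ℝ, SFinite ρ → SFinite (polarMeasure ρ) := fun ρ _ => by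
    unfold polarMeasure; infer_instance
  have := hsf ρ inferInstance
  have := hsf ρ' inferInstance
  calc ∫⁻ z, (∫⁻ ζ, kern A c z ζ * u ζ ∂(polarMeasure ρ)) ^ p ∂(polarMeasure ρ')
      ≤ ∫⁻ z, ENNReal.ofReal (E1 ^ (p - 1)) *
          ∫⁻ ζ, ENNReal.ofReal (θ (lev z)) * (kern A c z ζ * Ψ ζ) ∂(polarMeasure ρ) ∂(polarMeasure ρ') := by
        apply lintegral_mono_ae
        filter_upwards [hdisc'] with z hz
        refine (lintegral_mul_rpow_le (hkz z) hu hΦm (fun ζ => by simpa [Φ] using hφ _)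
          (fun ζ => ENNReal.ofReal_ne_top) hp).trans ?_
        have hkm : Measurable fun ζ => kern A c z ζ * Ψ ζ := (hkz z).mul hΨm
        rw [lintegral_const_mul _ hkm, ← mul_assoc]
        gcongr
        refine (ENNReal.rpow_le_rpow (hE1 z hz) (by linarith)).trans (le_of_eq ?_)
        rw [← ENNReal.ofReal_mul (by positivity), ENNReal.ofReal_rpow_of_nonneg
          (mul_nonneg hE10 (mul_pos (hA _) (hx _)).le) (by linarith)]
        congr 1
        simp only [x, θ]
        rw [mul_div_cancel₀ _ (hA _).ne', Real.mul_rpow hE10 (by positivity), ← Real.rpow_natCast,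
          ← Real.rpow_mul hδ0.le, ← Real.rpow_natCast, ← Real.rpow_mul hδ0.le, mul_comm (p - 1)]
    _ = ENNReal.ofReal (E1 ^ (p - 1)) * ∫⁻ ζ, ∫⁻ z, ENNReal.ofReal (θ (lev z)) * (kern A c z ζ * Ψ ζ)
          ∂(polarMeasure ρ') ∂(polarMeasure ρ) := by
        have hmm : Measurable fun q : ℂ × ℂ => ENNReal.ofReal (θ (lev q.1)) * (kern A c q.1 q.2 * Ψ q.2) :=
          (hθm.comp measurable_fst).mul ((measurable_kern A c).mul (hΨm.comp measurable_snd))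
        rw [lintegral_const_mul _ hmm.lintegral_prod_right', lintegral_lintegral_swap hmm.aemeasurable]
    _ ≤ ENNReal.ofReal (E1 ^ (p - 1)) * ∫⁻ ζ, ENNReal.ofReal E2 * (u ζ ^ p *
          ENNReal.ofReal (A (lev ζ) ^ p * o (lev ζ) * m (lev ζ) ^ (p - 1))) ∂(polarMeasure ρ) := by
        gcongr 1
        apply lintegral_mono_ae
        filter_upwards [hdisc] with ζ hζ
        have e : ∀ z, ENNReal.ofReal (θ (lev z)) * (kern A c z ζ * Ψ ζ) =
            (kern A c ζ z * ENNReal.ofReal (θ (lev z))) * Ψ ζ := by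
          intro z; rw [kern_comm A c z ζ]; ring
        have hkm : Measurable fun z => kern A c ζ z * ENNReal.ofReal (θ (lev z)) := (hkz ζ).mul hθm
        rw [lintegral_congr e, lintegral_mul_const _ hkm]
        -- The column integral contributes A o θ and Hölder's inequality φ^(1-p). The powers of δ
        -- cancel, and A^p o m^(p-1) remains.
        refine (mul_le_mul' (hE2 ζ hζ) le_rfl).trans (le_of_eq ?_)
        simp only [Ψ, Φ]
        rw [ENNReal.ofReal_rpow_of_pos (hφ _), ENNReal.ofReal_mul hE20, mul_assoc]
        congr 1
        rw [mul_left_comm, ← ENNReal.ofReal_mul (by have := hA (lev ζ); have := ho (lev ζ); have := hθ (lev ζ); positivity)]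
        congr 2
        set l := lev ζ
        have hAl := hA l
        have hml := hm l
        simp only [φ, x, θ]
        rw [Real.div_rpow (by positivity) hml.le, Real.div_rpow (by positivity) hAl.le,
          ← Real.rpow_natCast, ← Real.rpow_natCast, ← Real.rpow_mul hδ0.le, ← Real.rpow_mul hδ0.le,
          show (l : ℝ) * (1 - p) = -((p - 1) * l) by ring, Real.rpow_neg hδ0.le,
          show 1 - p = -(p - 1) by ring, Real.rpow_neg hAl.le, Real.rpow_neg hml.le,
          show A l ^ p = A l * A l ^ (p - 1) by
            nth_rw 2 [← Real.rpow_one (A l)]; rw [← Real.rpow_add hAl]; ring_nf]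
        have hAp : 0 < A l ^ (p - 1) := by positivity
        have hmp : 0 < m l ^ (p - 1) := by positivity
        have hdp : 0 < δ ^ ((p - 1) * l) := by positivity
        field_simp
    _ = _ := by
        rw [lintegral_const_mul' _ _ ENNReal.ofReal_ne_top, ← mul_assoc,
          ← ENNReal.ofReal_mul (by positivity)]

/-! ### The reproducing kernel and the coefficients of the small Hankel operator. -/

lemma kercoef_pos {ν : ℂ → ℝ} (hν : IsDoublingWeight ν) (n k : ℕ) : 0 < kercoef ν n k := by
  have := mom_pos hν (k + n)
  have h2 : 0 < (k + 1).ascFactorial n := Nat.ascFactorial_pos _ _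
  unfold kercoef
  positivity

lemma summable_kercoef {ν : ℂ → ℝ} (hν : IsDoublingWeight ν) (n : ℕ) {r : ℝ} (hr : 0 ≤ r) (hr1 : r < 1) :
    Summable fun k => kercoef ν n k * r ^ k := by
  obtain ⟨C, hC0, hC⟩ := symbolTo_kercoef hν n 0 0 le_rfl
  obtain ⟨D, β, hD1, hD⟩ := exists_tl_le_mul_pow hν
  have h0 : 0 < tl ν 0 := tl_pos hν le_rfl zero_lt_one
  have hb : Summable fun k : ℕ => C * D / tl ν 0 * (((k + 1 : ℕ) : ℝ) ^ (n + β) * r ^ k) := by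
    apply Summable.mul_left
    have h1 := summable_pow_mul_geometric_of_norm_lt_one (R := ℝ) (n + β) (r := r)
      (by rwa [Real.norm_eq_abs, abs_of_nonneg hr])
    rcases hr.eq_or_lt with rfl | hr0
    · apply summable_of_ne_finset_zero (s := {0})
      intro k hk
      rw [zero_pow (by simpa using hk), mul_zero]
    · rw [← summable_nat_add_iff 1] at h1
      refine (h1.mul_left r⁻¹).congr fun k => ?_
      rw [pow_succ r]
      field_simp
  refine Summable.of_nonneg_of_le (fun k => mul_nonneg (kercoef_pos hν n k).le (by positivity)) (fun k => ?_) hb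
  have h1 := hC k
  simp only [Function.iterate_zero, id_eq, pow_zero, div_one] at h1
  have h2 := tl_one_sub_pos hν k
  have h3 := hD 0 (1 - 1 / (k + 1)) le_rfl (one_sub_one_div_nonneg k) (one_sub_one_div_lt k)
  have h4 : (tl ν (1 - 1 / (k + 1)))⁻¹ ≤ D * (k + 1 : ℝ) ^ β / tl ν 0 := by
    rw [le_div_iff₀ h0, inv_mul_le_iff₀ h2]
    calc tl ν 0 ≤ _ := h3
      _ = _ := by rw [sub_zero, sub_sub_cancel, one_div_one_div]; ring
  calc kercoef ν n k * r ^ k ≤ (C * ((k + 1 : ℝ) ^ n * (D * (k + 1 : ℝ) ^ β / tl ν 0))) * r ^ k := by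
        gcongr
        exact (le_abs_self _).trans (h1.trans (by gcongr))
    _ = _ := by push_cast; ring

/-- The function `w ↦ ∑ (k+1)⋯(k+n) w^k / M_{k+n}`, where `M_k` are the moments of the weight. -/
def kerfun (ν : ℂ → ℝ) (n : ℕ) (w : ℂ) : ℂ := ∑' k, (kercoef ν n k : ℂ) * w ^ k

lemma hasSum_kerfun {ν : ℂ → ℝ} (hν : IsDoublingWeight ν) (n : ℕ) {w : ℂ} (hw : w ∈ disc) :
    HasSum (fun k => (kercoef ν n k : ℂ) * w ^ k) (kerfun ν n w) := by
  apply Summable.hasSum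
  apply Summable.of_norm
  refine (summable_kercoef hν n (norm_nonneg w) (by simpa using hw)).congr fun k => ?_
  rw [norm_mul, norm_pow, Complex.norm_real, Real.norm_eq_abs, abs_of_pos (kercoef_pos hν n k)]

lemma differentiableOn_kerfun {ν : ℂ → ℝ} (hν : IsDoublingWeight ν) (n : ℕ) :
    DifferentiableOn ℂ (kerfun ν n) disc :=
  differentiableOn_of_hasSum_disc fun _ hz => hasSum_kerfun hν n hz

lemma conj_mul_mem_disc {z ζ : ℂ} (hz : z ∈ disc) (hζ : ζ ∈ disc) : conj z * ζ ∈ disc := by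
  rw [mem_ball_zero_iff] at *
  rw [norm_mul, RCLike.norm_conj]
  exact mul_lt_one_of_nonneg_of_lt_one_left (norm_nonneg _) hz hζ.le

lemma differentiableOn_comp_conj_mul {G : ℂ → ℂ} (hG : DifferentiableOn ℂ G disc) {z : ℂ} (hz : z ∈ disc) :
    DifferentiableOn ℂ (fun ζ => G (conj z * ζ)) disc :=
  hG.comp (by fun_prop) fun _ hζ => conj_mul_mem_disc hz hζ

lemma conj_kerfun {ν : ℂ → ℝ} (hν : IsDoublingWeight ν) (n : ℕ) {w : ℂ} (hw : w ∈ disc) :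
    conj (kerfun ν n w) = kerfun ν n (conj w) := by
  have hw' : conj w ∈ disc := by
    rw [mem_ball_zero_iff, RCLike.norm_conj]; exact mem_ball_zero_iff.1 hw
  have h1 := (Complex.hasSum_conj'.2 (hasSum_kerfun hν n hw))
  have h2 := hasSum_kerfun hν n hw'
  refine h1.unique (h2.congr_fun fun k => ?_)
  simp

lemma aestronglyMeasurable_of_continuousOn {μ : Measure ℂ} (hμ : ∀ᵐ z ∂μ, z ∈ disc) {g : ℂ → ℂ}
    (hg : ContinuousOn g disc) : AEStronglyMeasurable g μ := by
  rw [← Measure.restrict_eq_self_of_ae_mem hμ]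
  exact hg.aestronglyMeasurable Metric.isOpen_ball.measurableSet

/-- Pairing an integrable function with a power series in `z̄ζ`. -/
lemma hasSum_integral_mul_conj_comp {μ : Measure ℂ} (hμ : ∀ᵐ z ∂μ, z ∈ disc) {u : ℂ → ℂ} (hu : Integrable u μ)
    {c : ℕ → ℂ} {G : ℂ → ℂ} (h : ∀ w ∈ disc, HasSum (fun k => c k * w ^ k) (G w)) {z : ℂ} (hz : z ∈ disc) :
    HasSum (fun k => conj (c k) * z ^ k * ∫ ζ, u ζ * conj ζ ^ k ∂μ) (∫ ζ, u ζ * conj (G (conj z * ζ)) ∂μ) := by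
  have hz' := mem_ball_zero_iff.1 hz
  have := hasSum_integral_mul hu (F := fun k ζ => conj (c k) * z ^ k * conj ζ ^ k)
    (G := fun ζ => conj (G (conj z * ζ))) (b := fun k => ‖c k‖ * ‖z‖ ^ k)
    (summable_of_hasSum_disc h (norm_nonneg z) hz') (fun k => by fun_prop) (fun k => by
      filter_upwards [hμ] with ζ hζ
      rw [norm_mul, norm_mul, norm_pow, norm_pow, RCLike.norm_conj, RCLike.norm_conj]
      exact mul_le_of_le_one_right (by positivity) (pow_le_one₀ (norm_nonneg _) (mem_ball_zero_iff.1 hζ).le)) (by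
      filter_upwards [hμ] with ζ hζ
      refine (Complex.hasSum_conj'.2 (h _ (conj_mul_mem_disc hz hζ))).congr_fun fun k => ?_
      simp [mul_pow, mul_assoc])
  refine this.congr_fun fun k => ?_
  rw [← integral_const_mul]
  congr 1
  ext ζ
  ring

lemma ae_weightMeasure_mem_disc {ν : ℂ → ℝ} (hν : IsRadialWeight ν) : ∀ᵐ z ∂(weightMeasure ν), z ∈ disc := by
  rw [weightMeasure_eq_polarMeasure hν]
  exact ae_polarMeasure_mem_disc (ae_radialPart ν)

lemma integral_mul_conj_pow {ν : ℂ → ℝ} (hν : IsRadialWeight ν) {f : ℂ → ℂ} (hf : DifferentiableOn ℂ f disc)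
    (hfi : Integrable f (weightMeasure ν)) (k : ℕ) :
    ∫ ζ, f ζ * conj ζ ^ k ∂(weightMeasure ν) = coef f k * mom ν k := by
  have hi : Integrable (fun ζ => f ζ * conj ζ ^ k) (weightMeasure ν) := by
    refine hfi.mul_bdd (c := 1) (by fun_prop) ?_
    filter_upwards [ae_weightMeasure_mem_disc hν] with ζ hζ
    rw [norm_pow, RCLike.norm_conj]
    exact pow_le_one₀ (norm_nonneg _) (mem_ball_zero_iff.1 hζ).le
  rw [weightMeasure_eq_polarMeasure hν] at hi ⊢
  rw [integral_polarMeasure _ hi, mom, ← integral_complex_ofReal, ← integral_const_mul]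
  apply integral_congr_ae
  filter_upwards [ae_radialPart ν] with r hr
  rw [integral_polar_mul_conj_pow (fun z hz => hasSum_coef hf hz) hr.1.le hr.2]
  push_cast
  rfl

/-- Coefficient by coefficient, the moment produced by the pairing cancels the reciprocal moment in
the series. -/
lemma integral_mul_conj_kerfun {ν : ℂ → ℝ} (hν : IsDoublingWeight ν) {f : ℂ → ℂ} (hf : DifferentiableOn ℂ f disc)
    (hfi : Integrable f (weightMeasure ν)) {z : ℂ} (hz : z ∈ disc) :
    ∫ ζ, f ζ * conj (kerfun ν 0 (conj z * ζ)) ∂(weightMeasure ν) = f z := by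
  refine (hasSum_integral_mul_conj_comp (ae_weightMeasure_mem_disc hν.toIsRadialWeight) hfi
    (fun w hw => hasSum_kerfun hν 0 hw) hz).unique ((hasSum_coef hf hz).congr_fun fun k => ?_)
  rw [integral_mul_conj_pow hν.toIsRadialWeight hf hfi, Complex.conj_ofReal, kercoef]
  have := mom_pos hν k
  have h2 : (mom ν k : ℂ) ≠ 0 := by exact_mod_cast this.ne'
  simp
  field_simp

lemma exists_norm_comp_conj_mul_le {c : ℕ → ℂ} {G : ℂ → ℂ}
    (h : ∀ w ∈ disc, HasSum (fun k => c k * w ^ k) (G w)) {z : ℂ} (hz : z ∈ disc) :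
    ∃ M, 0 ≤ M ∧ ∀ ζ ∈ disc, ‖G (conj z * ζ)‖ ≤ M := by
  have hs := summable_of_hasSum_disc h (norm_nonneg z) (mem_ball_zero_iff.1 hz)
  refine ⟨∑' k, ‖c k‖ * ‖z‖ ^ k, tsum_nonneg fun k => by positivity, fun ζ hζ => ?_⟩
  refine (h _ (conj_mul_mem_disc hz hζ)).norm_le_of_bounded hs.hasSum fun k => ?_
  rw [norm_mul, norm_pow, norm_mul, RCLike.norm_conj]
  gcongr
  exact mul_le_of_le_one_right (norm_nonneg _) (mem_ball_zero_iff.1 hζ).le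

lemma memLp_of_bounded {ν : ℂ → ℝ} (hν : IsRadialWeight ν) {g : ℂ → ℂ} (hg : ContinuousOn g disc) {M : ℝ}
    (hM : ∀ z ∈ disc, ‖g z‖ ≤ M) (p : ℝ≥0∞) : MemLp g p (weightMeasure ν) := by
  have := isFiniteMeasure_weightMeasure hν
  have hae := ae_weightMeasure_mem_disc hν
  refine MemLp.of_bound (aestronglyMeasurable_of_continuousOn hae hg) M ?_
  filter_upwards [hae] with z hz using hM z hz

lemma isReproducingKernelAt_kerfun {ν : ℂ → ℝ} (hν : IsDoublingWeight ν) {z : ℂ} (hz : z ∈ disc) :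
    IsReproducingKernelAt ν z fun ζ => kerfun ν 0 (conj z * ζ) := by
  have hd := differentiableOn_comp_conj_mul (differentiableOn_kerfun hν 0) hz
  obtain ⟨M, -, hM⟩ := exists_norm_comp_conj_mul_le (fun w hw => hasSum_kerfun hν 0 hw) hz
  have := isFiniteMeasure_weightMeasure hν.toIsRadialWeight
  refine ⟨⟨hd, memLp_of_bounded hν.toIsRadialWeight hd.continuousOn hM _⟩, fun f hf => ?_⟩
  exact (integral_mul_conj_kerfun hν hf.1 (hf.2.integrable (by simp)) hz).symm

/-- Uniqueness of reproducing kernels: the chosen kernel at z and the explicit one at ζ are each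
paired with the other, and the two values are conjugate. -/
lemma bergmanKernel_eq {ν : ℂ → ℝ} (hν : IsDoublingWeight ν) {z ζ : ℂ} (hz : z ∈ disc) (hζ : ζ ∈ disc) :
    bergmanKernel ν z ζ = kerfun ν 0 (conj z * ζ) := by
  have hex : ∃ K, IsReproducingKernelAt ν z K := ⟨_, isReproducingKernelAt_kerfun hν hz⟩
  have hK := hex.choose_spec
  rw [bergmanKernel, dif_pos hex]
  set K := hex.choose
  have h1 := hK.2 _ (isReproducingKernelAt_kerfun hν hζ).1
  have h2 := (isReproducingKernelAt_kerfun hν hζ).2 K hK.1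
  rw [h2, ← Complex.conj_conj (kerfun ν 0 (conj z * ζ)), conj_kerfun hν 0 (conj_mul_mem_disc hz hζ)]
  simp only [map_mul, Complex.conj_conj]
  rw [mul_comm z, h1, ← integral_conj]
  congr 1
  ext w
  simp [mul_comm]

lemma smallHankel_eq {ν : ℂ → ℝ} (hν : IsDoublingWeight ν) (f g : ℂ → ℂ) {z : ℂ} (hz : z ∈ disc) :
    smallHankel ν f g z = ∫ ζ, (f ζ * conj (g ζ)) * conj (kerfun ν 0 (conj z * ζ)) ∂(weightMeasure ν) := by
  apply integral_congr_ae
  filter_upwards [ae_weightMeasure_mem_disc hν.toIsRadialWeight] with ζ hζ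
  rw [bergmanKernel_eq hν hz hζ, map_mul, mul_assoc]

/-- The logarithmic factor is at least 1 on the disc. -/
lemma integrable_of_mem_logWeight {ν : ℂ → ℝ} (hν : IsRadialWeight ν) {f : ℂ → ℂ}
    (hf : f ∈ bergmanSpace 1 (logWeight ν)) : Integrable f (weightMeasure ν) := by
  have h1 := hf.2
  rw [ENNReal.ofReal_one, memLp_one_iff_integrable] at h1
  refine h1.mono_measure ?_
  unfold weightMeasure
  apply withDensity_mono
  have hae : ∀ᵐ z ∂areaMeasure, z ∈ disc := by
    unfold areaMeasure
    exact Measure.ae_smul_measure (ae_restrict_mem Metric.isOpen_ball.measurableSet) _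
  filter_upwards [hae] with z hz
  apply ENNReal.ofReal_le_ofReal
  rw [logWeight]
  have hz' := mem_ball_zero_iff.1 hz
  have h0 : 0 < 1 - ‖z‖ := by linarith
  apply le_mul_of_one_le_left (hν.nonneg z hz)
  rw [Real.le_log_iff_exp_le (by positivity), le_div_iff₀ h0]
  exact mul_le_of_le_one_right (Real.exp_pos 1).le (by linarith [norm_nonneg z])

lemma integrable_mul_conj {μ : Measure ℂ} (hμ : ∀ᵐ z ∂μ, z ∈ disc) {f g : ℂ → ℂ} (hf : Integrable f μ)
    (hg : ContinuousOn g disc) {M : ℝ} (hM : ∀ z ∈ disc, ‖g z‖ ≤ M) :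
    Integrable (fun ζ => f ζ * conj (g ζ)) μ := by
  refine hf.mul_bdd (c := M) (Complex.continuous_conj.comp_aestronglyMeasurable
    (aestronglyMeasurable_of_continuousOn hμ hg)) ?_
  filter_upwards [hμ] with ζ hζ
  rw [RCLike.norm_conj]
  exact hM ζ hζ

/-- A function which represents `h_f g` pairs with powers in the same way as `f conj g`. -/
lemma integral_mul_conj_pow_of_eqOn {ν : ℂ → ℝ} (hν : IsDoublingWeight ν) {f g F : ℂ → ℂ}
    (hf : Integrable f (weightMeasure ν))
    (hg : ContinuousOn g disc) {M : ℝ} (hM : ∀ z ∈ disc, ‖g z‖ ≤ M)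
    (hF : DifferentiableOn ℂ F disc) (hFi : Integrable F (weightMeasure ν))
    (h : EqOn F (smallHankel ν f g) disc) (k : ℕ) :
    ∫ ζ, F ζ * conj ζ ^ k ∂(weightMeasure ν) = ∫ ζ, f ζ * conj (g ζ) * conj ζ ^ k ∂(weightMeasure ν) := by
  have hae := ae_weightMeasure_mem_disc hν.toIsRadialWeight
  rw [integral_mul_conj_pow hν.toIsRadialWeight hF hFi]
  have h1 := coef_eq_of_hasSum (G := F)
    (c := fun k => (mom ν k : ℂ)⁻¹ * ∫ ζ, f ζ * conj (g ζ) * conj ζ ^ k ∂(weightMeasure ν)) (fun z hz => by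
      rw [h hz, smallHankel_eq hν f g hz]
      refine (hasSum_integral_mul_conj_comp hae (integrable_mul_conj hae hf hg hM)
        (fun w hw => hasSum_kerfun hν 0 hw) hz).congr_fun fun k => ?_
      rw [Complex.conj_ofReal, kercoef]
      simp
      ring) k
  have h2 : (mom ν k : ℂ) ≠ 0 := by exact_mod_cast (mom_pos hν k).ne'
  rw [h1]
  field_simp

/-- Termwise from the powers. This turns knowledge of an extension on bounded functions into a
formula for its pairing with the test functions of the lower bound. -/
lemma integral_mul_conj_pow_mul_comp_of_eqOn {ν : ℂ → ℝ} (hν : IsDoublingWeight ν) {f g F : ℂ → ℂ}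
    (hf : Integrable f (weightMeasure ν))
    (hg : ContinuousOn g disc) {M : ℝ} (hM : ∀ z ∈ disc, ‖g z‖ ≤ M)
    (hF : DifferentiableOn ℂ F disc) (hFi : Integrable F (weightMeasure ν))
    (h : EqOn F (smallHankel ν f g) disc) {G : ℂ → ℂ} (hG : DifferentiableOn ℂ G disc)
    {z : ℂ} (hz : z ∈ disc) (n : ℕ) :
    ∫ ζ, F ζ * conj (ζ ^ n * G (conj z * ζ)) ∂(weightMeasure ν) =
      ∫ ζ, f ζ * conj (g ζ) * conj (ζ ^ n * G (conj z * ζ)) ∂(weightMeasure ν) := by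
  have hae := ae_weightMeasure_mem_disc hν.toIsRadialWeight
  have hpow : ∀ u : ℂ → ℂ, Integrable u (weightMeasure ν) →
      Integrable (fun ζ => u ζ * conj (ζ ^ n)) (weightMeasure ν) := fun u hu =>
    integrable_mul_conj hae hu (by fun_prop) (M := 1) fun z hz => by
      rw [norm_pow]; exact pow_le_one₀ (norm_nonneg _) (mem_ball_zero_iff.1 hz).le
  have e : ∀ (u : ℂ → ℂ) (ζ : ℂ) (k : ℕ), u ζ * conj (ζ ^ n) * conj ζ ^ k = u ζ * conj ζ ^ (k + n) := by
    intro u ζ k; rw [map_pow]; ring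
  simp_rw [map_mul, ← mul_assoc]
  refine (hasSum_integral_mul_conj_comp hae (hpow _ hFi) (fun w hw => hasSum_coef hG hw) hz).unique
    ((hasSum_integral_mul_conj_comp hae (hpow _ (integrable_mul_conj hae hf hg hM))
      (fun w hw => hasSum_coef hG hw) hz).congr_fun fun k => ?_)
  have e1 := integral_mul_conj_pow_of_eqOn hν hf hg hM hF hFi h (k + n)
  simp_rw [e F, e1, ← e (fun ζ => f ζ * conj (g ζ))]

/-- The derivative `∂^n` of the reproducing kernel represents the `n`-th derivative. -/
lemma integral_mul_conj_pow_mul_kerfun {ν : ℂ → ℝ} (hν : IsDoublingWeight ν) {f : ℂ → ℂ}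
    (hf : DifferentiableOn ℂ f disc) (hfi : Integrable f (weightMeasure ν)) (n : ℕ) {z : ℂ} (hz : z ∈ disc) :
    ∫ ζ, f ζ * conj (ζ ^ n * kerfun ν n (conj z * ζ)) ∂(weightMeasure ν) = iteratedDeriv n f z := by
  have hae := ae_weightMeasure_mem_disc hν.toIsRadialWeight
  have hfn : Integrable (fun ζ => f ζ * conj (ζ ^ n)) (weightMeasure ν) :=
    integrable_mul_conj hae hfi (by fun_prop) (M := 1) fun z hz => by
      rw [norm_pow]; exact pow_le_one₀ (norm_nonneg _) (mem_ball_zero_iff.1 hz).le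
  simp_rw [map_mul, ← mul_assoc]
  refine (hasSum_integral_mul_conj_comp hae hfn
    (fun w hw => hasSum_kerfun hν n hw) hz).unique
      ((hasSum_coef (differentiableOn_iteratedDeriv hf n) hz).congr_fun fun k => ?_)
  have e : ∀ ζ : ℂ, f ζ * conj (ζ ^ n) * conj ζ ^ k = f ζ * conj ζ ^ (k + n) := by
    intro ζ; rw [map_pow]; ring
  simp_rw [e]
  rw [integral_mul_conj_pow hν.toIsRadialWeight hf hfi, Complex.conj_ofReal, kercoef, coef_iteratedDeriv,
    Nat.add_descFactorial_eq_ascFactorial]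
  have h2 : (mom ν (k + n) : ℂ) ≠ 0 := by exact_mod_cast (mom_pos hν (k + n)).ne'
  push_cast
  field_simp

/-! ### Moving a derivative onto the symbol. -/

/-- The kernel which inverts the differential operator `pderiv (m + 1)` on radii. -/
def invKer (m : ℕ) (r s : ℝ) : ℝ :=
  if 0 < s ∧ s < r then 2 * s * (r ^ 2 - s ^ 2) ^ m / (m.factorial * r ^ (2 * (m + 1))) else 0

lemma invKer_nonneg (m : ℕ) (r s : ℝ) : 0 ≤ invKer m r s := by
  unfold invKer
  split_ifs with h
  · have h1 : 0 ≤ r ^ 2 - s ^ 2 := by nlinarith [h.1, h.2]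
    have := h.1
    have : 0 ≤ r := by linarith [h.1, h.2]
    positivity
  · exact le_rfl

lemma measurable_invKer (m : ℕ) : Measurable fun p : ℝ × ℝ => invKer m p.1 p.2 := by
  unfold invKer
  apply Measurable.ite
  · exact (measurableSet_lt measurable_const measurable_snd).inter
      (measurableSet_lt measurable_snd measurable_fst)
  · fun_prop
  · fun_prop

/-- The factor r, available from the density 2 r ν(r), removes the singularity at small radii: what
remains is 2(s/r)((r^2-s^2)/r^2)^m / m!, and (r^2-s^2)/r^2 ≤ 2(1-s). -/
lemma mul_invKer_le (m : ℕ) {r s : ℝ} (hr : r < 1) (hs : s < 1) : r * invKer m r s ≤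
    2 * (2 * (1 - s)) ^ m := by
  unfold invKer
  split_ifs with h
  · obtain ⟨h0, h1⟩ := h
    have hr0 : 0 < r := by linarith
    have hm : (1 : ℝ) ≤ m.factorial := by exact_mod_cast m.factorial_pos
    have h2 : (r ^ 2 - s ^ 2) / r ^ 2 ≤ 2 * (1 - s) := by
      rw [div_le_iff₀ (by positivity)]
      have e1 : (r - s) ≤ r * (1 - s) := by nlinarith
      calc r ^ 2 - s ^ 2 = (r - s) * (r + s) := by ring
        _ ≤ (r * (1 - s)) * (2 * r) := by
          apply mul_le_mul e1 (by linarith) (by linarith)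
          exact mul_nonneg hr0.le (by linarith)
        _ = _ := by ring
    have h3 : 0 ≤ (r ^ 2 - s ^ 2) / r ^ 2 := div_nonneg (by nlinarith) (by positivity)
    calc r * (2 * s * (r ^ 2 - s ^ 2) ^ m / (m.factorial * r ^ (2 * (m + 1))))
        = (s / r) * 2 * ((r ^ 2 - s ^ 2) / r ^ 2) ^ m / m.factorial := by
          rw [div_pow, mul_add, pow_add, pow_mul]; field_simp; ring
      _ ≤ 1 * 2 * (2 * (1 - s)) ^ m / 1 := by
          have : 0 < 1 - s := by linarith
          gcongr
          rw [div_le_one hr0]; exact h1.le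
      _ = _ := by ring
  · rw [mul_zero]
    have : 0 < 1 - s := by linarith
    positivity

/-- A Beta integral, by induction on m: one factor r^2 - s^2 is expanded, and the second piece has k
raised by one. -/
lemma integral_sub_sq_pow_mul (m k : ℕ) (r : ℝ) :
    ∫ s in (0 : ℝ)..r, 2 * s * (r ^ 2 - s ^ 2) ^ m * s ^ (2 * k) =
      m.factorial / (k + 1).ascFactorial (m + 1) * r ^ (2 * (m + k + 1)) := by
  induction m generalizing k with
  | zero =>
    have : ∀ s : ℝ, 2 * s * (r ^ 2 - s ^ 2) ^ 0 * s ^ (2 * k) = 2 * s ^ (2 * k + 1) := by intro s; ring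
    simp_rw [this]
    rw [intervalIntegral.integral_const_mul, integral_pow]
    simp [Nat.ascFactorial]
    have : (k + 1 : ℝ) ≠ 0 := by positivity
    have h2 : (2 * k + 1 + 1 : ℝ) ≠ 0 := by positivity
    field_simp
    ring
  | succ m ih =>
    have : ∀ s : ℝ, 2 * s * (r ^ 2 - s ^ 2) ^ (m + 1) * s ^ (2 * k) =
        r ^ 2 * (2 * s * (r ^ 2 - s ^ 2) ^ m * s ^ (2 * k)) -
          2 * s * (r ^ 2 - s ^ 2) ^ m * s ^ (2 * (k + 1)) := by intro s; ring
    simp_rw [this]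
    rw [intervalIntegral.integral_sub (by apply Continuous.intervalIntegrable; fun_prop)
      (by apply Continuous.intervalIntegrable; fun_prop), intervalIntegral.integral_const_mul, ih, ih]
    have p1 : (0 : ℝ) < (k + 1).ascFactorial (m + 1) := by exact_mod_cast Nat.ascFactorial_pos _ _
    have e2 : ((k + 1).ascFactorial (m + 1 + 1) : ℝ) = (k + 1 + m + 1) * (k + 1).ascFactorial (m + 1) := by
      rw [Nat.ascFactorial_succ]; push_cast; ring
    have e3 : ((k + 1 + 1).ascFactorial (m + 1) : ℝ) = (k + 1 + m + 1) * (k + 1).ascFactorial (m + 1) / (k + 1) := by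
      rw [eq_div_iff (by positivity)]
      have := Nat.succ_ascFactorial (k + 1) (m + 1)
      have h : ((k + 1 : ℕ) : ℝ) * ((k + 1).succ.ascFactorial (m + 1) : ℕ) =
        ((k + 1 + (m + 1) : ℕ) : ℝ) * ((k + 1).ascFactorial (m + 1) : ℕ) := by exact_mod_cast this
      push_cast at h
      linarith
    rw [e2]
    rw [e3, Nat.factorial_succ]
    push_cast
    have : (k + 1 + m + 1 : ℝ) ≠ 0 := by positivity
    field_simp
    ring

lemma integral_invKer_mul_pow (m k : ℕ) {r : ℝ} (hr : 0 < r) :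
    ∫ s in Ioo 0 r, invKer m r s * s ^ (2 * k) = r ^ (2 * k) / (k + 1).ascFactorial (m + 1) := by
  have e : ∀ s ∈ Ioo 0 r, invKer m r s * s ^ (2 * k) =
      (m.factorial * r ^ (2 * (m + 1)))⁻¹ * (2 * s * (r ^ 2 - s ^ 2) ^ m * s ^ (2 * k)) := by
    intro s hs
    rw [invKer, if_pos (show 0 < s ∧ s < r from hs)]
    ring
  rw [setIntegral_congr_fun measurableSet_Ioo e, integral_const_mul, ← integral_Ioc_eq_integral_Ioo,
    ← intervalIntegral.integral_of_le hr.le, integral_sub_sq_pow_mul]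
  have : (0 : ℝ) < m.factorial := by exact_mod_cast m.factorial_pos
  rw [show 2 * (m + k + 1) = 2 * (m + 1) + 2 * k by ring, pow_add]
  field_simp

lemma integrableOn_invKer (m : ℕ) (r : ℝ) : IntegrableOn (invKer m r) (Ioo 0 r) := by
  have e : ∀ s ∈ Ioo 0 r, invKer m r s = 2 * s * (r ^ 2 - s ^ 2) ^ m / (m.factorial * r ^ (2 * (m + 1))) := by
    intro s hs
    rw [invKer, if_pos (show 0 < s ∧ s < r from hs)]
  refine IntegrableOn.congr_fun ?_ (fun s hs => (e s hs).symm) measurableSet_Ioo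
  exact ((by fun_prop : Continuous fun s : ℝ =>
    2 * s * (r ^ 2 - s ^ 2) ^ m / (m.factorial * r ^ (2 * (m + 1)))).integrableOn_Icc).mono_set Ioo_subset_Icc_self

lemma integral_invKer_mul {m : ℕ} {r : ℝ} (hr : 0 < r) (hr1 : r < 1) {d : ℕ → ℂ} {Φ : ℝ → ℂ} {S : ℂ}
    (hΦ : ∀ s : ℝ, 0 ≤ s → s < 1 → HasSum (fun k => ((k + 1).ascFactorial (m + 1) * d k) * (s : ℂ) ^ (2 * k)) (Φ s))
    (hS : HasSum (fun k => d k * (r : ℂ) ^ (2 * k)) S) :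
    ∫ s in Ioo (0 : ℝ) 1, (invKer m r s : ℂ) * Φ s = S := by
  rw [setIntegral_eq_of_subset_of_forall_sdiff_eq_zero measurableSet_Ioo
    (Ioo_subset_Ioo_right hr1.le) (fun s hs => by
      have : ¬ (0 < s ∧ s < r) := fun h => hs.2 h
      rw [invKer, if_neg this]; simp)]
  have hae : ∀ᵐ s ∂(volume.restrict (Ioo 0 r)), s ∈ Ioo 0 r := ae_restrict_mem measurableSet_Ioo
  have h1 := hasSum_integral_mul (μ := volume.restrict (Ioo 0 r)) (u := fun s => (invKer m r s : ℂ))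
    (integrableOn_invKer m r).ofReal
    (F := fun k s => ((k + 1).ascFactorial (m + 1) * d k) * (s : ℂ) ^ (2 * k)) (G := Φ)
    (hΦ r hr.le hr1).summable.norm (fun k => by fun_prop) (fun k => by
      filter_upwards [hae] with s hs
      rw [norm_mul _ ((s : ℂ) ^ (2 * k)), norm_mul _ ((r : ℂ) ^ (2 * k)), norm_pow, norm_pow, Complex.norm_real,
        Complex.norm_real, Real.norm_eq_abs, Real.norm_eq_abs, abs_of_pos hs.1, abs_of_pos hr]
      have := hs.2
      have := hs.1
      gcongr) (by
      filter_upwards [hae] with s hs using hΦ s hs.1.le (hs.2.trans hr1))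
  refine h1.unique (hS.congr_fun fun k => ?_)
  have e : ∀ s : ℝ, (invKer m r s : ℂ) * (((k + 1).ascFactorial (m + 1) * d k) * (s : ℂ) ^ (2 * k)) =
      ((k + 1).ascFactorial (m + 1) * d k) * ((invKer m r s * s ^ (2 * k) : ℝ) : ℂ) := by
    intro s; push_cast; ring
  simp_rw [e]
  rw [integral_const_mul, integral_complex_ofReal, integral_invKer_mul_pow m k hr]
  have : ((k + 1).ascFactorial (m + 1) : ℂ) ≠ 0 := by
    exact_mod_cast (Nat.ascFactorial_pos _ _).ne'
  push_cast
  field_simp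

/-- The radial measure which pairs with `pderiv (m + 1)` in the same way as `ρ` with the identity. -/
def invMeasure (m : ℕ) (ρ : Measure ℝ) : Measure ℝ :=
  ((ρ.prod (volume.restrict (Ioo 0 1))).withDensity fun p => ENNReal.ofReal (invKer m p.1 p.2)).map Prod.snd

instance (m : ℕ) (ρ : Measure ℝ) [SFinite ρ] : SFinite (invMeasure m ρ) := by
  unfold invMeasure; infer_instance

/-- On each circle Parseval's identity gives ∑ a_k conj b_k s^(2k), with the extra multiplier
(k+1)⋯(k+m+1) on the right. Integration against `invKer m r` maps s^(2k) to r^(2k) divided by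
exactly this multiplier. -/
lemma integral_mul_conj_eq_pderiv {ρ : Measure ℝ} [SFinite ρ] (hρ : ∀ᵐ r ∂ρ, r ∈ Ioo (0 : ℝ) 1) (m : ℕ)
    {f F : ℂ → ℂ} (hf : DifferentiableOn ℂ f disc) (hF : DifferentiableOn ℂ F disc)
    (h1 : Integrable (fun z => f z * conj (F z)) (polarMeasure ρ))
    (h2 : Integrable (fun z => pderiv (m + 1) f z * conj (F z)) (polarMeasure (invMeasure m ρ))) :
    ∫ z, f z * conj (F z) ∂(polarMeasure ρ) =
      ∫ z, pderiv (m + 1) f z * conj (F z) ∂(polarMeasure (invMeasure m ρ)) := by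
  rw [integral_polarMeasure _ h1, integral_polarMeasure _ h2]
  set Φ : ℝ → ℂ := fun s => ∫ θ, pderiv (m + 1) f (polar (s, θ)) * conj (F (polar (s, θ))) ∂circ
  have hΦi : Integrable Φ (invMeasure m ρ) := by
    unfold polarMeasure at h2
    rw [integrable_map_measure h2.1 measurable_polar.aemeasurable] at h2
    exact h2.integral_prod_left
  have hK : Measurable fun p : ℝ × ℝ => ENNReal.ofReal (invKer m p.1 p.2) :=
    (measurable_invKer m).ennreal_ofReal
  have hΦi' : Integrable (fun p : ℝ × ℝ => (invKer m p.1 p.2 : ℂ) * Φ p.2) (ρ.prod (volume.restrict (Ioo 0 1))) := by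
    have := hΦi
    unfold invMeasure at this
    rw [integrable_map_measure this.1 measurable_snd.aemeasurable,
      integrable_withDensity_iff_integrable_smul' hK (by simp)] at this
    refine this.congr (.of_forall fun p => ?_)
    simp [ENNReal.toReal_ofReal (invKer_nonneg m _ _)]
  have e : ∫ s, Φ s ∂(invMeasure m ρ) = ∫ r, ∫ s in Ioo (0 : ℝ) 1, (invKer m r s : ℂ) * Φ s ∂volume ∂ρ := by
    rw [← integral_prod _ hΦi']
    have h3 := hΦi.1
    unfold invMeasure at h3 ⊢
    rw [integral_map measurable_snd.aemeasurable h3,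
      integral_withDensity_eq_integral_toReal_smul hK (by simp)]
    congr 1
    ext p
    simp [ENNReal.toReal_ofReal (invKer_nonneg m _ _)]
  rw [e]
  apply integral_congr_ae
  filter_upwards [hρ] with r hr
  have hpd : DifferentiableOn ℂ (pderiv (m + 1) f) disc :=
    differentiableOn_of_hasSum_disc fun z hz => hasSum_pderiv hf (m + 1) hz
  refine (integral_invKer_mul hr.1 hr.2 (d := fun k => coef f k * conj (coef F k)) (fun s hs hs1 => ?_)
    (hasSum_integral_polar_mul_conj hf hF hr.1.le hr.2)).symm
  refine (hasSum_integral_polar_mul_conj hpd hF hs hs1).congr_fun fun k => ?_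
  rw [coef_eq_of_hasSum (fun z hz => hasSum_pderiv hf (m + 1) hz)]
  ring

/-- By Fubini the density at s is the integral of the inversion kernel over r > s. The pointwise
bound of r times the kernel leaves (1-s)^m times the tail. -/
lemma invMeasure_radialPart_le {ν : ℂ → ℝ} (hν : IsRadialWeight ν) (m : ℕ) :
    invMeasure m (radialPart ν) ≤ (volume.restrict (Ioo 0 1)).withDensity fun s =>
      ENNReal.ofReal (4 * (2 * (1 - s)) ^ m) * tail ν s := by
  rw [Measure.le_iff]
  intro E hE
  have hK : Measurable fun p : ℝ × ℝ => ENNReal.ofReal (invKer m p.1 p.2) :=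
    (measurable_invKer m).ennreal_ofReal
  unfold invMeasure
  rw [Measure.map_apply measurable_snd hE, withDensity_apply _ (measurable_snd hE), withDensity_apply _ hE,
    ← univ_prod, ← Measure.prod_restrict, lintegral_prod_symm _ hK.aemeasurable, Measure.restrict_univ,
    Measure.restrict_restrict hE]
  apply lintegral_mono_ae
  filter_upwards [ae_restrict_mem (hE.inter measurableSet_Ioo)] with s hs
  have hs1 := hs.2
  have hd : AEMeasurable (fun r : ℝ => ENNReal.ofReal (2 * r * ν r)) (volume.restrict (Ioo 0 1)) :=
    ((aemeasurable_id.const_mul 2).mul (aemeasurable_radial hν)).ennreal_ofReal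
  unfold radialPart tail
  have hKs : Measurable fun r : ℝ => ENNReal.ofReal (invKer m r s) :=
    hK.comp (measurable_id.prodMk measurable_const)
  rw [lintegral_withDensity_eq_lintegral_mul₀ hd hKs.aemeasurable, ← lintegral_const_mul' _ _ ENNReal.ofReal_ne_top,
    ← lintegral_indicator measurableSet_Ioo, ← lintegral_indicator measurableSet_Ioo]
  apply lintegral_mono
  intro r
  simp only [indicator]
  split_ifs with h3 h4 h4
  · have hνr := hν.nonneg r (ofReal_mem_disc h3.1.le h3.2)
    have hr0 := h3.1
    rw [Pi.mul_apply, ← ENNReal.ofReal_mul (by positivity), ← ENNReal.ofReal_mul (by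
      have : 0 < 1 - s := by linarith [hs1.2]
      positivity)]
    apply ENNReal.ofReal_le_ofReal
    calc 2 * r * ν r * invKer m r s = 2 * ν r * (r * invKer m r s) := by ring
      _ ≤ 2 * ν r * (2 * (2 * (1 - s)) ^ m) :=
        mul_le_mul_of_nonneg_left (mul_invKer_le m h3.2 hs1.2) (by positivity)
      _ = _ := by ring
  · have : ¬ (0 < s ∧ s < r) := fun h => h4 ⟨h.2, h3.2⟩
    simp [invKer, this]
  · exact bot_le
  · exact le_rfl

/-! ### Hardy inequalities on rays. -/

/-- The fundamental theorem of calculus along the ray, followed by Hölder's inequality on an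
interval of length less than 1. -/
lemma enorm_rpow_polar_le {h : ℂ → ℂ} (hh : DifferentiableOn ℂ h disc) {s : ℝ} (hs : 1 < s) {r : ℝ}
    (hr : 0 < r) (hr1 : r < 1) (θ : ℝ) :
    ‖h (polar (r, θ))‖ₑ ^ s ≤ 2 ^ (s - 1) * (‖h 0‖ₑ ^ s + ∫⁻ t in Ioo 0 r, ‖deriv h (polar (t, θ))‖ₑ ^ s) := by
  have hpol : ∀ t : ℝ, HasDerivAt (fun t : ℝ => polar (t, θ)) (Complex.exp (θ * Complex.I)) t := by
    intro t
    have := (Complex.ofRealCLM.hasDerivAt (x := t)).mul_const (Complex.exp (θ * Complex.I))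
    simpa [polar] using this
  have hmem : ∀ t ∈ Icc 0 r, polar (t, θ) ∈ disc := fun t ht => polar_mem_disc ht.1 (ht.2.trans_lt hr1) θ
  have hder : ∀ t ∈ uIcc 0 r, HasDerivAt (fun t : ℝ => h (polar (t, θ)))
      (deriv h (polar (t, θ)) * Complex.exp (θ * Complex.I)) t := by
    intro t ht
    rw [uIcc_of_le hr.le] at ht
    have h1 := (hh.differentiableAt (Metric.isOpen_ball.mem_nhds (hmem t ht))).hasDerivAt
    exact h1.comp t (hpol t)
  have hcont : ContinuousOn (fun t : ℝ => deriv h (polar (t, θ)) * Complex.exp (θ * Complex.I)) (uIcc 0 r) := by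
    rw [uIcc_of_le hr.le]
    refine ContinuousOn.mul ?_ continuousOn_const
    exact (hh.deriv Metric.isOpen_ball).continuousOn.comp
      (continuous_polar.comp (by fun_prop : Continuous fun t : ℝ => (t, θ))).continuousOn hmem
  have hftc := intervalIntegral.integral_eq_sub_of_hasDerivAt hder hcont.intervalIntegrable
  have h0 : polar (0, θ) = 0 := by simp [polar]
  rw [h0] at hftc
  have h1 : ‖h (polar (r, θ)) - h 0‖ₑ ≤ ∫⁻ t in Ioo 0 r, 1 * ‖deriv h (polar (t, θ))‖ₑ := by
    rw [← hftc, intervalIntegral.integral_of_le hr.le, integral_Ioc_eq_integral_Ioo]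
    refine (enorm_integral_le_lintegral_enorm _).trans (le_of_eq ?_)
    congr 1
    ext t
    rw [enorm_mul, ← ofReal_norm (Complex.exp _), Complex.norm_exp_ofReal_mul_I, ENNReal.ofReal_one, mul_one, one_mul]
  have h2 : (∫⁻ t in Ioo 0 r, 1 * ‖deriv h (polar (t, θ))‖ₑ) ^ s ≤
      ∫⁻ t in Ioo 0 r, ‖deriv h (polar (t, θ))‖ₑ ^ s := by
    have hm : Measurable fun t : ℝ => ‖deriv h (polar (t, θ))‖ₑ :=
      ((measurable_deriv h).comp (measurable_polar.comp (by fun_prop : Measurable fun t : ℝ => (t, θ)))).enorm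
    have := lintegral_mul_rpow_le (μ := volume.restrict (Ioo 0 r)) (K := fun _ => 1)
      (u := fun t => ‖deriv h (polar (t, θ))‖ₑ) (φ := fun _ => 1) measurable_const hm measurable_const
      (by simp) (by simp) hs
    refine this.trans ?_
    simp only [mul_one, one_mul, ENNReal.one_rpow]
    refine mul_le_of_le_one_left bot_le ?_
    apply ENNReal.rpow_le_one _ (by linarith)
    simp [hr1.le]
  calc ‖h (polar (r, θ))‖ₑ ^ s ≤ (‖h 0‖ₑ + ‖h (polar (r, θ)) - h 0‖ₑ) ^ s := by
        gcongr
        calc ‖h (polar (r, θ))‖ₑ = ‖h 0 + (h (polar (r, θ)) - h 0)‖ₑ := by congr 1; ring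
          _ ≤ _ := enorm_add_le _ _
    _ ≤ 2 ^ (s - 1) * (‖h 0‖ₑ ^ s + ‖h (polar (r, θ)) - h 0‖ₑ ^ s) :=
      ENNReal.rpow_add_le_mul_rpow_add_rpow _ _ hs.le
    _ ≤ _ := by
        gcongr
        exact (ENNReal.rpow_le_rpow h1 (by linarith)).trans h2

lemma lintegral_polarMeasure_withDensity {w : ℝ → ℝ≥0∞} (hw : Measurable w) {F : ℂ → ℝ≥0∞}
    (hF : AEMeasurable F (polarMeasure ((volume.restrict (Ioo 0 1)).withDensity w))) :
    ∫⁻ z, F z ∂(polarMeasure ((volume.restrict (Ioo 0 1)).withDensity w)) =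
      ∫⁻ r in Ioo 0 1, w r * ∫⁻ θ, F (polar (r, θ)) ∂circ := by
  rw [lintegral_polarMeasure _ hF]
  have : AEMeasurable (fun r => ∫⁻ θ, F (polar (r, θ)) ∂circ) ((volume.restrict (Ioo 0 1)).withDensity w) := by
    unfold polarMeasure at hF
    exact (hF.comp_measurable measurable_polar).lintegral_prod_right'
  rw [lintegral_withDensity_eq_lintegral_mul₀' hw.aemeasurable this]
  rfl

lemma ae_withDensity_mem (w : ℝ → ℝ≥0∞) :
    ∀ᵐ r ∂((volume.restrict (Ioo (0 : ℝ) 1)).withDensity w), r ∈ Ioo (0 : ℝ) 1 :=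
  (withDensity_absolutelyContinuous _ _).ae_le (ae_restrict_mem measurableSet_Ioo)

/-- A Hardy inequality on rays, for almost decreasing bounded weights. -/
lemma lintegral_enorm_rpow_le_deriv {w : ℝ → ℝ≥0∞} (hw : Measurable w) {C D : ℝ≥0∞}
    (hC : ∀ t r, 0 < t → t ≤ r → r < 1 → w r ≤ C * w t) (hD : ∀ r ∈ Ioo (0 : ℝ) 1, w r ≤ D)
    {h : ℂ → ℂ} (hh : DifferentiableOn ℂ h disc) {s : ℝ} (hs : 1 < s) :
    ∫⁻ z, ‖h z‖ₑ ^ s ∂(polarMeasure ((volume.restrict (Ioo 0 1)).withDensity w)) ≤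
      2 ^ (s - 1) * (D * ‖h 0‖ₑ ^ s +
        C * ∫⁻ z, ‖deriv h z‖ₑ ^ s ∂(polarMeasure ((volume.restrict (Ioo 0 1)).withDensity w))) := by
  have hdisc := ae_polarMeasure_mem_disc (ae_withDensity_mem w)
  have hdm : Measurable fun z => ‖deriv h z‖ₑ ^ s := (measurable_deriv h).enorm.pow_const s
  rw [lintegral_polarMeasure_withDensity hw
    ((aestronglyMeasurable_of_continuousOn hdisc hh.continuousOn).enorm.pow_const s),
    lintegral_polarMeasure_withDensity hw hdm.aemeasurable]
  set m : ℝ → ℝ≥0∞ := fun t => ∫⁻ θ, ‖deriv h (polar (t, θ))‖ₑ ^ s ∂circ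
  have hjm : Measurable fun p : ℝ × ℝ => ‖deriv h (polar (p.2, p.1))‖ₑ ^ s :=
    hdm.comp (measurable_polar.comp measurable_swap)
  have hm : Measurable m := (hdm.comp measurable_polar).lintegral_prod_right'
  have hcirc : ∀ r ∈ Ioo (0 : ℝ) 1, ∫⁻ θ, ‖h (polar (r, θ))‖ₑ ^ s ∂circ ≤
      2 ^ (s - 1) * (‖h 0‖ₑ ^ s + ∫⁻ t in Ioo 0 r, m t) := by
    intro r hr
    refine (lintegral_mono fun θ => enorm_rpow_polar_le hh hs hr.1 hr.2 θ).trans (le_of_eq ?_)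
    have hm1 : Measurable fun θ => ∫⁻ t in Ioo 0 r, ‖deriv h (polar (t, θ))‖ₑ ^ s :=
      hjm.lintegral_prod_right'
    rw [lintegral_const_mul' _ _ (by finiteness), lintegral_add_left measurable_const, lintegral_const,
      measure_univ, mul_one, lintegral_lintegral_swap hjm.aemeasurable]
  calc ∫⁻ r in Ioo 0 1, w r * ∫⁻ θ, ‖h (polar (r, θ))‖ₑ ^ s ∂circ
      ≤ ∫⁻ r in Ioo (0 : ℝ) 1, 2 ^ (s - 1) * (D * ‖h 0‖ₑ ^ s + C * ∫⁻ t in Ioo 0 1, w t * m t) := by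
        apply setLIntegral_mono' measurableSet_Ioo
        intro r hr
        refine (mul_le_mul' le_rfl (hcirc r hr)).trans ?_
        rw [mul_left_comm, mul_add]
        -- The weight at the larger radius r goes inside the integral as C w t, because t < r and w
        -- is almost decreasing.
        have h2 : w r * ∫⁻ t in Ioo 0 r, m t ≤ C * ∫⁻ t in Ioo 0 1, w t * m t := by
          have hwm : Measurable fun t => w t * m t := hw.mul hm
          rw [← lintegral_const_mul _ hm, ← lintegral_const_mul _ hwm]
          refine le_trans ?_ (lintegral_mono_set (Ioo_subset_Ioo_right hr.2.le))
          apply setLIntegral_mono' measurableSet_Ioo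
          intro t ht
          rw [← mul_assoc]
          gcongr
          exact hC t r ht.1 ht.2.le hr.2
        have h3 := hD r hr
        gcongr
    _ = _ := by simp [m]

lemma exists_enorm_pderiv_rpow_le (n : ℕ) {s : ℝ} (hs : 1 ≤ s) : ∃ C : ℝ≥0, ∀ (f : ℂ → ℂ), ∀ z ∈ disc,
    ‖pderiv n f z‖ₑ ^ s ≤ C * ∑ j ∈ Finset.range (n + 1), ‖iteratedDeriv j f z‖ₑ ^ s := by
  have key : ∀ j : ℕ, ∃ K : ℝ≥0, ∀ (f : ℂ → ℂ), ∀ z ∈ disc,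
      ‖((n.factorial * n.choose j : ℕ) / (j.factorial : ℂ)) * (z ^ j * iteratedDeriv j f z)‖ₑ ≤
        K * ‖iteratedDeriv j f z‖ₑ := by
    intro j
    refine ⟨‖((n.factorial * n.choose j : ℕ) / (j.factorial : ℂ))‖₊, fun f z hz => ?_⟩
    rw [enorm_mul, enorm_mul]
    refine mul_le_mul' le_rfl (mul_le_of_le_one_left bot_le ?_)
    rw [enorm_pow]
    apply pow_le_one₀ bot_le
    rw [← ofReal_norm]
    exact ENNReal.ofReal_le_one.2 (mem_ball_zero_iff.1 hz).le
  choose K hK using key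
  refine ⟨(n + 1) ^ (s - 1) * (∑ j ∈ Finset.range (n + 1), K j) ^ s, fun f z hz => ?_⟩
  have h1 : ‖pderiv n f z‖ₑ ≤ ∑ j ∈ Finset.range (n + 1),
      ((∑ j ∈ Finset.range (n + 1), K j : ℝ≥0) : ℝ≥0∞) * ‖iteratedDeriv j f z‖ₑ := by
    unfold pderiv
    refine (enorm_sum_le _ _).trans (Finset.sum_le_sum fun j hj => (hK j f z hz).trans ?_)
    gcongr
    exact Finset.single_le_sum (f := K) (fun _ _ => zero_le) hj
  refine (ENNReal.rpow_le_rpow h1 (by linarith)).trans ?_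
  refine (ENNReal.rpow_sum_le_const_mul_sum_rpow _ _ hs).trans (le_of_eq ?_)
  simp_rw [ENNReal.mul_rpow_of_nonneg _ _ (by linarith : 0 ≤ s)]
  rw [← Finset.mul_sum, ← mul_assoc, Finset.card_range]
  congr 2
  push_cast
  rw [ENNReal.coe_rpow_of_nonneg _ (by linarith), ENNReal.coe_rpow_of_nonneg _ (by linarith)]
  push_cast
  rfl

/-- Control of all lower order derivatives, and hence of `pderiv n f`, by the `n`-th one. -/
lemma exists_lintegral_pderiv_le {w : ℝ → ℝ≥0∞} (hw : Measurable w) {C D : ℝ≥0}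
    (hC : ∀ t r, 0 < t → t ≤ r → r < 1 → w r ≤ C * w t) (hD : ∀ r ∈ Ioo (0 : ℝ) 1, w r ≤ D)
    (n : ℕ) {s : ℝ} (hs : 1 < s) : ∃ E : ℝ≥0, ∀ f : ℂ → ℂ, DifferentiableOn ℂ f disc →
    ∫⁻ z, ‖pderiv n f z‖ₑ ^ s ∂(polarMeasure ((volume.restrict (Ioo 0 1)).withDensity w)) ≤
      E * (∑ j ∈ Finset.range n, ‖iteratedDeriv j f 0‖ₑ ^ s +
        ∫⁻ z, ‖iteratedDeriv n f z‖ₑ ^ s ∂(polarMeasure ((volume.restrict (Ioo 0 1)).withDensity w))) := by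
  set P := polarMeasure ((volume.restrict (Ioo 0 1)).withDensity w)
  -- Descent from order n to order n - k; each application of Hardy's inequality lowers the order by
  -- one at the cost of one value at the origin.
  have step : ∀ k ≤ n, ∃ E : ℝ≥0, ∀ f : ℂ → ℂ, DifferentiableOn ℂ f disc →
      ∫⁻ z, ‖iteratedDeriv (n - k) f z‖ₑ ^ s ∂P ≤
        E * (∑ j ∈ Finset.range n, ‖iteratedDeriv j f 0‖ₑ ^ s + ∫⁻ z, ‖iteratedDeriv n f z‖ₑ ^ s ∂P) := by
    intro k hk
    induction k with
    | zero => exact ⟨1, fun f hf => by rw [ENNReal.coe_one, one_mul]; exact le_add_self⟩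
    | succ k ih =>
      obtain ⟨E, hE⟩ := ih (by omega)
      refine ⟨2 ^ (s - 1) * (D + C * E), fun f hf => ?_⟩
      have h1 := lintegral_enorm_rpow_le_deriv hw hC hD (differentiableOn_iteratedDeriv hf (n - (k + 1))) hs
      rw [← iteratedDeriv_succ, show n - (k + 1) + 1 = n - k by omega] at h1
      refine h1.trans ?_
      have h2 : ‖iteratedDeriv (n - (k + 1)) f 0‖ₑ ^ s ≤ ∑ j ∈ Finset.range n, ‖iteratedDeriv j f 0‖ₑ ^ s +
          ∫⁻ z, ‖iteratedDeriv n f z‖ₑ ^ s ∂P := by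
        refine le_trans ?_ le_self_add
        exact Finset.single_le_sum (f := fun j => ‖iteratedDeriv j f 0‖ₑ ^ s) (fun _ _ => bot_le)
          (Finset.mem_range.2 (by omega))
      have h3 := hE f hf
      push_cast
      rw [ENNReal.coe_rpow_of_nonneg _ (by linarith), mul_assoc, add_mul, mul_assoc (C : ℝ≥0∞)]
      push_cast
      gcongr
  choose! E hE using step
  obtain ⟨K, hK⟩ := exists_enorm_pderiv_rpow_le n hs.le
  have hdisc : ∀ᵐ z ∂P, z ∈ disc := ae_polarMeasure_mem_disc (ae_withDensity_mem w)
  refine ⟨K * ∑ j ∈ Finset.range (n + 1), E (n - j), fun f hf => ?_⟩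
  calc ∫⁻ z, ‖pderiv n f z‖ₑ ^ s ∂P
      ≤ ∫⁻ z, K * ∑ j ∈ Finset.range (n + 1), ‖iteratedDeriv j f z‖ₑ ^ s ∂P := by
        apply lintegral_mono_ae
        filter_upwards [hdisc] with z hz using hK f z hz
    _ = K * ∑ j ∈ Finset.range (n + 1), ∫⁻ z, ‖iteratedDeriv j f z‖ₑ ^ s ∂P := by
        rw [lintegral_const_mul' _ _ ENNReal.coe_ne_top, lintegral_finsetSum']
        intro j _
        exact (aestronglyMeasurable_of_continuousOn hdisc
          (differentiableOn_iteratedDeriv hf j).continuousOn).enorm.pow_const s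
    _ ≤ _ := by
        push_cast
        rw [mul_assoc, Finset.sum_mul]
        gcongr with j hj
        have := hE (n - j) (by omega) f hf
        rwa [show n - (n - j) = j by have := Finset.mem_range.1 hj; omega] at this

/-! ### Dyadic tails and the regularized weight ω̂/(1-r). -/

lemma one_sub_half_pow_nonneg (l : ℕ) : (0 : ℝ) ≤ 1 - (1 / 2) ^ l :=
  sub_nonneg.2 (pow_le_one₀ (by norm_num) (by norm_num))

lemma one_sub_half_pow_lt (l : ℕ) : (1 - (1 / 2) ^ l : ℝ) < 1 :=
  sub_lt_self _ (by positivity)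

lemma one_sub_half_pow_mono {l k : ℕ} (h : l ≤ k) : (1 - (1 / 2) ^ l : ℝ) ≤ 1 - (1 / 2) ^ k :=
  sub_le_sub_left (pow_le_pow_of_le_one (by norm_num) (by norm_num) h) _

/-- The tail of a weight at dyadic radii. -/
def dyTail (ω : ℂ → ℝ) (l : ℕ) : ℝ := tl ω (1 - (1 / 2) ^ l)

lemma dyTail_pos {ω : ℂ → ℝ} (hω : IsDoublingWeight ω) (l : ℕ) : 0 < dyTail ω l :=
  tl_pos hω (one_sub_half_pow_nonneg l) (one_sub_half_pow_lt l)

lemma geoDecay_dyTail {ω : ℂ → ℝ} (hω : IsDoublingWeight ω) : GeoDecay (dyTail ω) := by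
  obtain ⟨C, α, hC, hα, h⟩ := exists_tl_le_mul_rpow hω
  refine ⟨C, (1 / 2) ^ α, by linarith, by positivity, Real.rpow_lt_one (by norm_num) (by norm_num) hα,
    fun l i => ?_⟩
  refine (h _ _ (one_sub_half_pow_nonneg l) (one_sub_half_pow_mono (Nat.le_add_right l i))
    (one_sub_half_pow_lt _)).trans (le_of_eq ?_)
  have e : ((1 / 2 : ℝ) ^ i) ^ α = ((1 / 2) ^ α) ^ i := by
    rw [← Real.rpow_natCast, ← Real.rpow_natCast, ← Real.rpow_mul (by norm_num), ← Real.rpow_mul (by norm_num),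
      mul_comm]
  rw [sub_sub_cancel, sub_sub_cancel, pow_add, mul_div_cancel_left₀ _ (by positivity), e]
  rfl

lemma exists_dyTail_le {ω : ℂ → ℝ} (hω : IsDoublingWeight ω) : ∃ (C : ℝ) (β : ℕ), 1 ≤ C ∧ ∀ l i,
    dyTail ω l ≤ C * 2 ^ (i * β) * dyTail ω (l + i) := by
  obtain ⟨C, β, hC, h⟩ := exists_tl_le_mul_pow hω
  refine ⟨C, β, hC, fun l i => ?_⟩
  refine (h _ _ (one_sub_half_pow_nonneg l) (one_sub_half_pow_mono (Nat.le_add_right l i))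
    (one_sub_half_pow_lt _)).trans (le_of_eq ?_)
  have e : (1 / 2 : ℝ) ^ l / (1 / 2) ^ (l + i) = 2 ^ i := by
    rw [pow_add, div_mul_cancel_left₀ (by positivity), one_div, inv_pow, inv_inv]
  rw [sub_sub_cancel, sub_sub_cancel, e, pow_mul]
  rfl

lemma GeoDecay.inv {x : ℕ → ℝ} (hx : ∀ l, 0 < x l) (h : GeoDecay x) : GeoGrowth fun l => (x l)⁻¹ := by
  obtain ⟨C, ρ, hC, hρ, hρ1, h⟩ := h
  refine ⟨C, ρ, hC, hρ, hρ1, fun l i => ?_⟩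
  have h1 := hx l
  have h2 := hx (l + i)
  rw [← div_eq_mul_inv, le_div_iff₀ h2, inv_mul_le_iff₀ h1, mul_comm]
  exact h l i

lemma hasProfile_radialPart {ω : ℂ → ℝ} (hω : IsDoublingWeight ω) :
    HasProfile (radialPart ω) fun l => 2 * dyTail ω l := by
  refine ⟨ae_radialPart ω, fun i => ?_⟩
  have h1 : radialPart ω {1 - (1 / 2 : ℝ) ^ i} = 0 := by
    apply withDensity_absolutelyContinuous
    simp
  calc radialPart ω (Ico (1 - (1 / 2) ^ i) (1 - (1 / 2) ^ (i + 1)))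
      ≤ radialPart ω ({1 - (1 / 2 : ℝ) ^ i} ∪ Ioo (1 - (1 / 2) ^ i) 1) := by
        apply measure_mono
        intro r hr
        rcases hr.1.eq_or_lt with h | h
        · exact .inl h.symm
        · exact .inr ⟨h, hr.2.trans (one_sub_half_pow_lt _)⟩
    _ ≤ 0 + radialPart ω (Ioo (1 - (1 / 2) ^ i) 1) := by rw [← h1]; exact measure_union_le _ _
    _ ≤ 2 * tail ω (1 - (1 / 2) ^ i) := by
        rw [zero_add]; exact radialPart_Ioo_le hω.toIsRadialWeight (one_sub_half_pow_nonneg i)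
    _ = _ := by
        rw [ENNReal.ofReal_mul zero_le_two, dyTail, ofReal_tl hω (one_sub_half_pow_nonneg i)]
        simp

lemma hasProfile_volume : HasProfile (volume.restrict (Ioo (0 : ℝ) 1)) fun l => (1 / 2) ^ l := by
  refine ⟨ae_restrict_mem measurableSet_Ioo, fun i => ?_⟩
  refine (Measure.restrict_apply_le _ _).trans ?_
  rw [Real.volume_Ico]
  apply ENNReal.ofReal_le_ofReal
  have : (0 : ℝ) < (1 / 2) ^ (i + 1) := by positivity
  linarith

lemma measurable_tail (ω : ℂ → ℝ) : Measurable (tail ω) := (tail_antitone ω).measurable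

/-- The radial measure with density `ω̂(r)/(1-r)`. -/
def tailMeasure (ω : ℂ → ℝ) : Measure ℝ :=
  (volume.restrict (Ioo 0 1)).withDensity fun r => tail ω r / ENNReal.ofReal (1 - r)

instance (ω : ℂ → ℝ) : SFinite (tailMeasure ω) := by unfold tailMeasure; infer_instance

lemma ae_tailMeasure (ω : ℂ → ℝ) : ∀ᵐ r ∂(tailMeasure ω), r ∈ Ioo (0 : ℝ) 1 := ae_withDensity_mem _

lemma hasProfile_tailMeasure {ω : ℂ → ℝ} (hω : IsDoublingWeight ω) : HasProfile (tailMeasure ω) (dyTail ω) := by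
  refine ⟨ae_tailMeasure ω, fun i => ?_⟩
  rw [tailMeasure, withDensity_apply _ measurableSet_Ico, Measure.restrict_restrict measurableSet_Ico]
  refine (lintegral_mono_set inter_subset_left).trans ?_
  calc ∫⁻ r in Ico (1 - (1 / 2 : ℝ) ^ i) (1 - (1 / 2) ^ (i + 1)), tail ω r / ENNReal.ofReal (1 - r)
      ≤ ∫⁻ r in Ico (1 - (1 / 2 : ℝ) ^ i) (1 - (1 / 2) ^ (i + 1)),
          ENNReal.ofReal (dyTail ω i) / ENNReal.ofReal ((1 / 2) ^ (i + 1)) := by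
        apply setLIntegral_mono' measurableSet_Ico
        intro r hr
        rw [dyTail, ofReal_tl hω (one_sub_half_pow_nonneg i)]
        gcongr
        · exact tail_antitone ω hr.1
        · linarith [hr.2]
    _ = _ := by
        rw [setLIntegral_const, Real.volume_Ico, show (1 - (1 / 2) ^ (i + 1) - (1 - (1 / 2 : ℝ) ^ i)) =
          (1 / 2) ^ (i + 1) by ring]
        exact ENNReal.div_mul_cancel (by simp) ENNReal.ofReal_ne_top

/-- Here lower doubling enters: it bounds ω̂(r)/(1-r) by a multiple of ω̂(x)(1-x)^(-α)(1-r)^(α-1),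
which is integrable up to 1 since α > 0. -/
lemma exists_tailMeasure_Ioo_le {ω : ℂ → ℝ} (hω : IsDoublingWeight ω) : ∃ C : ℝ≥0, ∀ x : ℝ, 0 ≤ x → x < 1 →
    tailMeasure ω (Ioo x 1) ≤ C * tail ω x := by
  obtain ⟨C, α, hC, hα, h⟩ := exists_tl_le_mul_rpow hω
  refine ⟨(C / α).toNNReal, fun x hx hx1 => ?_⟩
  have hx0 : 0 < 1 - x := by linarith
  rw [tailMeasure, withDensity_apply _ measurableSet_Ioo, Measure.restrict_restrict measurableSet_Ioo,
    inter_eq_left.2 (Ioo_subset_Ioo_left hx)]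
  have hint : IntervalIntegrable (fun t : ℝ => t ^ (α - 1)) volume 0 (1 - x) :=
    intervalIntegral.intervalIntegrable_rpow' (by linarith)
  have hi2 : IntegrableOn (fun r : ℝ => (1 - r) ^ (α - 1)) (Ioo x 1) := by
    have := hint.comp_sub_left 1
    simp only [sub_zero, sub_sub_cancel] at this
    exact (intervalIntegrable_iff_integrableOn_Ioo_of_le hx1.le (by simp) (by simp)).1 this.symm
  have hval : ∫ r in Ioo x 1, (1 - r) ^ (α - 1) = (1 - x) ^ α / α := by
    rw [← integral_Ioc_eq_integral_Ioo, ← intervalIntegral.integral_of_le hx1.le,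
      intervalIntegral.integral_comp_sub_left (fun t => t ^ (α - 1)), sub_self, integral_rpow (.inl (by linarith))]
    simp [Real.zero_rpow hα.ne']
  calc ∫⁻ r in Ioo x 1, tail ω r / ENNReal.ofReal (1 - r)
      ≤ ∫⁻ r in Ioo x 1, ENNReal.ofReal (C * tl ω x * ((1 - x) ^ α)⁻¹ * (1 - r) ^ (α - 1)) := by
        apply setLIntegral_mono' measurableSet_Ioo
        intro r hr
        have hr1 : 0 < 1 - r := by linarith [hr.2]
        rw [← ofReal_tl hω (hx.trans hr.1.le), ← ENNReal.ofReal_div_of_pos hr1]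
        apply ENNReal.ofReal_le_ofReal
        rw [div_le_iff₀ hr1]
        refine (h x r hx hr.1.le hr.2).trans (le_of_eq ?_)
        rw [Real.div_rpow hr1.le hx0.le, Real.rpow_sub_one hr1.ne']
        field_simp
    _ = ENNReal.ofReal (C * tl ω x * ((1 - x) ^ α)⁻¹ * ((1 - x) ^ α / α)) := by
        rw [← hval, ← integral_const_mul, ofReal_integral_eq_lintegral_ofReal (hi2.const_mul _)]
        filter_upwards [ae_restrict_mem measurableSet_Ioo] with r hr
        have hr1 : 0 < 1 - r := by linarith [hr.2]
        have := tl_pos hω hx hx1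
        simp only [Pi.zero_apply]
        positivity
    _ = _ := by
        rw [← ofReal_tl hω hx]
        change _ = ENNReal.ofReal _ * _
        rw [← ENNReal.ofReal_mul (by positivity)]
        congr 1
        field_simp

/-- If a measure has finite mass and is dominated by tails near `1`, it is dominated everywhere. -/
lemma exists_Ioo_le_of_half {ρ₁ ρ₂ : Measure ℝ} {C : ℝ≥0} (h : ∀ x : ℝ, 1 / 2 ≤ x → x < 1 →
    ρ₁ (Ioo x 1) ≤ C * ρ₂ (Ioo x 1)) (h1 : ρ₁ (Ioo 0 1) ≠ ∞) (h2 : ρ₂ (Ioo (1 / 2) 1) ≠ 0) :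
    ∃ D : ℝ≥0, ∀ x : ℝ, 0 ≤ x → x < 1 → ρ₁ (Ioo x 1) ≤ D * ρ₂ (Ioo x 1) := by
  by_cases h3 : ρ₂ (Ioo (1 / 2) 1) = ∞
  · refine ⟨max C 1, fun x hx hx1 => ?_⟩
    rcases le_or_gt (1 / 2) x with hx2 | hx2
    · refine (h x hx2 hx1).trans ?_
      gcongr
      exact le_max_left _ _
    · have : ρ₂ (Ioo x 1) = ∞ := by
        rw [eq_top_iff, ← h3]; exact measure_mono (Ioo_subset_Ioo_left hx2.le)
      rw [this, ENNReal.mul_top]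
      · exact le_top
      · simp
  · refine ⟨max C (ρ₁ (Ioo 0 1) / ρ₂ (Ioo (1 / 2) 1)).toNNReal, fun x hx hx1 => ?_⟩
    rcases le_or_gt (1 / 2) x with hx2 | hx2
    · refine (h x hx2 hx1).trans ?_
      gcongr
      exact le_max_left _ _
    · calc ρ₁ (Ioo x 1) ≤ ρ₁ (Ioo 0 1) := measure_mono (Ioo_subset_Ioo_left hx)
        _ = ρ₁ (Ioo 0 1) / ρ₂ (Ioo (1 / 2) 1) * ρ₂ (Ioo (1 / 2) 1) := (ENNReal.div_mul_cancel h2 h3).symm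
        _ ≤ _ := by
          gcongr
          rw [← ENNReal.coe_toNNReal (a := ρ₁ (Ioo 0 1) / ρ₂ (Ioo (1 / 2) 1)) (ENNReal.div_ne_top h1 h2)]
          exact_mod_cast le_max_right _ _

lemma tail_half_pos {ω : ℂ → ℝ} (hω : IsDoublingWeight ω) : 0 < tail ω (1 / 2) :=
  hω.tail_pos _ (by norm_num) (by norm_num)

instance (ω : ℂ → ℝ) : NullSingletonClass (tailMeasure ω) := by
  refine ⟨fun x => ?_⟩
  apply withDensity_absolutelyContinuous
  simp

/-- The norm of `A^p_ω` controls the norm with respect to the weight `ω̂/(1-|z|)`. -/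
lemma exists_lintegral_tailMeasure_le {ω : ℂ → ℝ} (hω : IsDoublingWeight ω) {p : ℝ} (hp : 1 < p) :
    ∃ C : ℝ≥0, ∀ g : ℂ → ℂ, DifferentiableOn ℂ g disc →
      ∫⁻ z, ‖g z‖ₑ ^ p ∂(polarMeasure (tailMeasure ω)) ≤ C * ∫⁻ z, ‖g z‖ₑ ^ p ∂(weightMeasure ω) := by
  obtain ⟨C, hC⟩ := exists_tailMeasure_Ioo_le hω
  have h1 : tailMeasure ω (Ioo 0 1) ≠ ∞ :=
    ((hC 0 le_rfl zero_lt_one).trans_lt (ENNReal.mul_lt_top ENNReal.coe_lt_top (tail_lt_top hω le_rfl))).ne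
  have hle : ∀ x : ℝ, 1 / 2 ≤ x → tail ω x ≤ radialPart ω (Ioo x 1) := by
    intro x hx
    refine le_trans ?_ (ofReal_mul_tail_le hω.toIsRadialWeight (by linarith))
    refine le_mul_of_one_le_left bot_le ?_
    rw [ENNReal.one_le_ofReal]
    linarith
  obtain ⟨D, hD⟩ := exists_Ioo_le_of_half (ρ₁ := tailMeasure ω) (ρ₂ := radialPart ω) (C := C)
    (fun x hx hx1 => (hC x (by linarith) hx1).trans (by gcongr; exact hle x hx)) h1
    ((tail_half_pos hω).trans_le (hle _ le_rfl)).ne'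
  refine ⟨D, fun g hg => ?_⟩
  rw [weightMeasure_eq_polarMeasure hω.toIsRadialWeight]
  exact lintegral_enorm_rpow_le_of_tail_le hg hp (ae_tailMeasure ω) (ae_radialPart ω) hD

/-! ### The weight of the symbol integral. -/

/-- The real form of the weight in `symbolIntegral`. -/
def symWeight (p q : ℝ) (ω ν : ℂ → ℝ) (n : ℕ) (r : ℝ) : ℝ :=
  (1 - r) ^ (n * (p * q / (p - q)) - 1) * tl ν r ^ (p / (p - q)) * tl ω r ^ (-(q / (p - q)))

lemma measurable_tl (ω : ℂ → ℝ) : Measurable (tl ω) := (measurable_tail ω).ennreal_toReal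

lemma measurable_symWeight (p q : ℝ) (ω ν : ℂ → ℝ) (n : ℕ) : Measurable (symWeight p q ω ν n) := by
  have := measurable_tl ω
  have := measurable_tl ν
  unfold symWeight
  fun_prop

lemma symWeight_pos {p q : ℝ} {ω ν : ℂ → ℝ} (hω : IsDoublingWeight ω) (hν : IsDoublingWeight ν) (n : ℕ)
    {r : ℝ} (hr : 0 ≤ r) (hr1 : r < 1) : 0 < symWeight p q ω ν n r := by
  have h1 := tl_pos hω hr hr1
  have h2 := tl_pos hν hr hr1
  have : 0 < 1 - r := by linarith
  unfold symWeight
  positivity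

lemma symbol_weight_eq {p q : ℝ} (hqp : q < p) {ω ν : ℂ → ℝ} (hω : IsDoublingWeight ω)
    (hν : IsDoublingWeight ν) (n : ℕ) {r : ℝ} (hr : 0 ≤ r) (hr1 : r < 1) :
    ENNReal.ofReal (1 - r) ^ (n * (p * q / (p - q))) * (tail ν r / tail ω r) ^ (p / (p - q)) *
      (tail ω r / ENNReal.ofReal (1 - r)) = ENNReal.ofReal (symWeight p q ω ν n r) := by
  have h1 := tl_pos hω hr hr1
  have h2 := tl_pos hν hr hr1
  have h3 : 0 < 1 - r := by linarith
  have hpq : 0 < p - q := by linarith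
  rw [← ofReal_tl hω hr, ← ofReal_tl hν hr, ENNReal.ofReal_rpow_of_pos h3, ← ENNReal.ofReal_div_of_pos h1,
    ← ENNReal.ofReal_div_of_pos h3, ENNReal.ofReal_rpow_of_pos (by positivity), ← ENNReal.ofReal_mul (by positivity),
    ← ENNReal.ofReal_mul (by positivity)]
  congr 1
  rw [symWeight, Real.rpow_sub_one h3.ne', Real.div_rpow h2.le h1.le,
    show -(q / (p - q)) = 1 - p / (p - q) by field_simp; ring, Real.rpow_sub h1, Real.rpow_one]
  field_simp

lemma symbolIntegral_eq {p q : ℝ} (hqp : q < p) {ω ν : ℂ → ℝ} (hω : IsDoublingWeight ω)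
    (hν : IsDoublingWeight ν) {f : ℂ → ℂ} (hf : DifferentiableOn ℂ f disc) (n : ℕ) :
    symbolIntegral p q ω ν f n = ∫⁻ z, ‖iteratedDeriv n f z‖ₑ ^ (p * q / (p - q)) ∂(polarMeasure
      ((volume.restrict (Ioo 0 1)).withDensity fun r =>
        ENNReal.ofReal (2 * r) * ENNReal.ofReal (symWeight p q ω ν n r))) := by
  have hae : ∀ᵐ z ∂areaMeasure, z ∈ disc := by
    unfold areaMeasure
    exact Measure.ae_smul_measure (ae_restrict_mem Metric.isOpen_ball.measurableSet) _
  have hwm : Measurable fun z : ℂ => ENNReal.ofReal (symWeight p q ω ν n ‖z‖) :=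
    ((measurable_symWeight p q ω ν n).comp measurable_norm).ennreal_ofReal
  have hm : polarMeasure ((volume.restrict (Ioo 0 1)).withDensity fun r =>
        ENNReal.ofReal (2 * r) * ENNReal.ofReal (symWeight p q ω ν n r)) =
      areaMeasure.withDensity fun z => ENNReal.ofReal (symWeight p q ω ν n ‖z‖) := by
    ext E hE
    rw [withDensity_apply _ hE, setLIntegral_area_eq_polar
      (fun r => ENNReal.ofReal (symWeight p q ω ν n r)) (measurable_symWeight p q ω ν n).ennreal_ofReal.aemeasurable hE _
      fun z _ => rfl]
  have hfm := ((aestronglyMeasurable_of_continuousOn hae (differentiableOn_iteratedDeriv hf n).continuousOn).enorm.pow_const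
    (p * q / (p - q)))
  rw [hm, lintegral_withDensity_eq_lintegral_mul₀ hwm.aemeasurable hfm]
  unfold symbolIntegral
  apply lintegral_congr_ae
  filter_upwards [hae] with z hz
  rw [Pi.mul_apply, ← symbol_weight_eq hqp hω hν n (norm_nonneg z) (mem_ball_zero_iff.1 hz)]
  ring

/-- The factor in ν̂ decreases, while the negative power of ω̂ increases at most like a fixed
negative power of 1-r. A high enough order n makes the power of 1-r compensate for it. -/
lemma exists_symWeight_le {p q : ℝ} (hq : 1 < q) (hqp : q < p) {ω ν : ℂ → ℝ} (hω : IsDoublingWeight ω)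
    (hν : IsDoublingWeight ν) : ∃ N : ℕ, 1 ≤ N ∧ ∀ n : ℕ, N ≤ n → ∃ C : ℝ, 0 ≤ C ∧
      ∀ t r, 0 ≤ t → t ≤ r → r < 1 → symWeight p q ω ν n r ≤ C * symWeight p q ω ν n t := by
  obtain ⟨C, β, hC, h⟩ := exists_tl_le_mul_pow hω
  have hpq : 0 < p - q := by linarith
  have hp : 0 < p := by linarith
  have hs : 0 < p * q / (p - q) := by positivity
  set e := q / (p - q)
  have he : 0 < e := by positivity
  -- With e = q/(p-q) and s = pq/(p-q) the requirement is n s - 1 ≥ β e, where β is the exponent of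
  -- upper doubling of ω.
  obtain ⟨N, hN⟩ := exists_nat_ge ((β * e + 1) / (p * q / (p - q)))
  refine ⟨N + 1, by omega, fun n hn => ⟨C ^ e, by positivity, fun t r ht htr hr => ?_⟩⟩
  have hn' : β * e + 1 ≤ n * (p * q / (p - q)) := by
    rw [div_le_iff₀ hs] at hN
    refine hN.trans ?_
    gcongr
    omega
  have ht1 : 0 < 1 - t := by linarith
  have hr1 : 0 < 1 - r := by linarith
  have h1 := tl_pos hω ht (htr.trans_lt hr)
  have h2 := tl_pos hω (ht.trans htr) hr
  have h3 := tl_pos hν ht (htr.trans_lt hr)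
  have h4 := tl_pos hν (ht.trans htr) hr
  set x := (1 - r) / (1 - t) with hx
  have hx0 : 0 < x := by positivity
  have hx1 : x ≤ 1 := by rw [hx, div_le_one ht1]; linarith
  have b1 : tl ω r ^ (-e) ≤ C ^ e * x ^ (-(β * e)) * tl ω t ^ (-e) := by
    have h5 := h t r ht htr hr
    have h6 : (1 - t) / (1 - r) = x⁻¹ := by rw [hx, inv_div]
    rw [h6] at h5
    have h7 : tl ω t ^ e ≤ C ^ e * x ^ (-(β * e)) * tl ω r ^ e := by
      refine (Real.rpow_le_rpow h1.le h5 he.le).trans (le_of_eq ?_)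
      rw [Real.mul_rpow (by positivity) h2.le, Real.mul_rpow (by positivity) (by positivity),
        Real.rpow_neg hx0.le, Real.rpow_mul hx0.le, Real.rpow_natCast, inv_pow, Real.inv_rpow (by positivity)]
    rw [Real.rpow_neg h2.le, Real.rpow_neg h1.le, ← div_eq_mul_inv, le_div_iff₀ (by positivity),
      inv_mul_le_iff₀ (by positivity), mul_comm]
    exact h7
  have b2 : (1 - r) ^ (n * (p * q / (p - q)) - 1) ≤ x ^ (β * e) * (1 - t) ^ (n * (p * q / (p - q)) - 1) := by
    have : 1 - r = x * (1 - t) := by rw [hx]; field_simp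
    rw [this, Real.mul_rpow hx0.le ht1.le]
    have := Real.rpow_le_rpow_of_exponent_ge hx0 hx1 (show β * e ≤ n * (p * q / (p - q)) - 1 by linarith)
    gcongr
  have b3 : tl ν r ^ (p / (p - q)) ≤ tl ν t ^ (p / (p - q)) :=
    Real.rpow_le_rpow h4.le (tl_anti hν ht htr) (by have : 0 < p := by linarith
                                                    positivity)
  calc symWeight p q ω ν n r ≤ (x ^ (β * e) * (1 - t) ^ (n * (p * q / (p - q)) - 1)) *
        tl ν t ^ (p / (p - q)) * (C ^ e * x ^ (-(β * e)) * tl ω t ^ (-e)) := by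
        unfold symWeight; gcongr
    _ = (x ^ (β * e) * x ^ (-(β * e))) * (C ^ e * symWeight p q ω ν n t) := by unfold symWeight; ring
    _ = _ := by rw [← Real.rpow_add hx0]; simp

/-- Hardy's inequality is applied without the Jacobian factor 2r, which would spoil the almost
decreasing weight near 0. The factor is restored for f^(n) afterwards by comparing tails, harmlessly
because integral means increase. -/
lemma exists_lintegral_pderiv_symWeight_le {p q : ℝ} (hq : 1 < q) (hqp : q < p) {ω ν : ℂ → ℝ}
    (hω : IsDoublingWeight ω) (hν : IsDoublingWeight ν) {n : ℕ} {C : ℝ} (hC0 : 0 ≤ C)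
    (hC : ∀ t r, 0 ≤ t → t ≤ r → r < 1 → symWeight p q ω ν n r ≤ C * symWeight p q ω ν n t) :
    ∃ E : ℝ≥0, ∀ f : ℂ → ℂ, DifferentiableOn ℂ f disc →
      ∫⁻ z, ‖pderiv n f z‖ₑ ^ (p * q / (p - q)) ∂(polarMeasure
        ((volume.restrict (Ioo 0 1)).withDensity fun r => ENNReal.ofReal (symWeight p q ω ν n r))) ≤
      E * (symbolIntegral p q ω ν f n +
        ∑ j ∈ Finset.range n, ‖iteratedDeriv j f 0‖ₑ ^ (p * q / (p - q))) := by
  have hs : 1 < p * q / (p - q) := by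
    rw [one_lt_div (by linarith)]
    nlinarith
  set w : ℝ → ℝ≥0∞ := fun r => ENNReal.ofReal (symWeight p q ω ν n r) with hwdef
  have hw : Measurable w := (measurable_symWeight p q ω ν n).ennreal_ofReal
  have hw2 : Measurable fun r => ENNReal.ofReal (2 * r) * w r := by fun_prop
  have hwD : ∀ r ∈ Ioo (0 : ℝ) 1, w r ≤ (C * symWeight p q ω ν n 0).toNNReal := fun r hr =>
    ENNReal.ofReal_le_ofReal (hC 0 r le_rfl hr.1.le hr.2)
  obtain ⟨E, hE⟩ := exists_lintegral_pderiv_le hw (C := C.toNNReal) (D := (C * symWeight p q ω ν n 0).toNNReal)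
    (fun t r ht htr hr => by
      change _ ≤ ENNReal.ofReal C * _
      rw [hwdef, ← ENNReal.ofReal_mul hC0]
      exact ENNReal.ofReal_le_ofReal (hC t r ht.le htr hr)) hwD n hs
  have happ : ∀ {w : ℝ → ℝ≥0∞} {x : ℝ}, 0 ≤ x → (volume.restrict (Ioo 0 1)).withDensity w (Ioo x 1) =
      ∫⁻ r in Ioo x 1, w r := by
    intro w x hx
    rw [withDensity_apply _ measurableSet_Ioo, Measure.restrict_restrict measurableSet_Ioo,
      inter_eq_left.2 (Ioo_subset_Ioo_left hx)]
  have hle : ∀ x : ℝ, 1 / 2 ≤ x → x < 1 → (volume.restrict (Ioo 0 1)).withDensity w (Ioo x 1) ≤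
      (1 : ℝ≥0) * (volume.restrict (Ioo 0 1)).withDensity (fun r => ENNReal.ofReal (2 * r) * w r) (Ioo x 1) := by
    intro x hx hx1
    rw [happ (by linarith), happ (by linarith), ENNReal.coe_one, one_mul]
    apply setLIntegral_mono' measurableSet_Ioo
    intro r hr
    refine le_mul_of_one_le_left bot_le ?_
    rw [ENNReal.one_le_ofReal]
    linarith [hr.1]
  obtain ⟨D, hD⟩ := exists_Ioo_le_of_half hle (by
      rw [happ le_rfl]
      refine ((setLIntegral_mono' measurableSet_Ioo hwD).trans_lt ?_).ne
      simp) (by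
      have h5 := hle (1 / 2) le_rfl (by norm_num)
      rw [ENNReal.coe_one, one_mul] at h5
      refine (lt_of_lt_of_le ?_ h5).ne'
      rw [happ (by norm_num), setLIntegral_pos_iff hw]
      have : Ioo (1 / 2 : ℝ) 1 ⊆ Function.support w ∩ Ioo (1 / 2) 1 := by
        intro r hr
        refine ⟨?_, hr⟩
        have h0 : (0 : ℝ) ≤ r := by linarith [hr.1]
        simpa [w] using symWeight_pos hω hν n h0 hr.2
      refine lt_of_lt_of_le ?_ (measure_mono this)
      rw [Real.volume_Ioo]
      norm_num)
  have hnull : NullSingletonClass ((volume.restrict (Ioo (0 : ℝ) 1)).withDensity w) := by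
    refine ⟨fun x => ?_⟩
    apply withDensity_absolutelyContinuous
    simp
  refine ⟨E * (1 + D), fun f hf => (hE f hf).trans ?_⟩
  push_cast
  rw [mul_assoc]
  gcongr
  rw [symbolIntegral_eq hqp hω hν hf, add_comm, mul_add]
  have h3 := lintegral_enorm_rpow_le_of_tail_le (differentiableOn_iteratedDeriv hf n) hs
    (ae_withDensity_mem w) (ae_withDensity_mem _) hD
  refine add_le_add (h3.trans ?_) ?_
  · gcongr
    exact le_add_self
  · exact le_mul_of_one_le_left bot_le le_self_add

lemma lintegral_polarMeasure_withDensity' {w : ℝ → ℝ≥0∞} (hw : Measurable w) {F : ℂ → ℝ≥0∞}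
    (hF : Measurable F) :
    ∫⁻ z, F z ∂(polarMeasure ((volume.restrict (Ioo 0 1)).withDensity w)) =
      ∫⁻ z, w ‖z‖ * F z ∂(polarMeasure (volume.restrict (Ioo 0 1))) := by
  have hwF : Measurable fun z => w ‖z‖ * F z := (hw.comp measurable_norm).mul hF
  rw [lintegral_polarMeasure_withDensity hw hF.aemeasurable, lintegral_polarMeasure _ hwF.aemeasurable]
  apply setLIntegral_congr_fun measurableSet_Ioo
  intro r hr
  have : ∀ θ, w ‖polar (r, θ)‖ * F (polar (r, θ)) = w r * F (polar (r, θ)) := by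
    intro θ; rw [norm_polar, abs_of_pos hr.1]
  have hm : Measurable fun θ => F (polar (r, θ)) := hF.comp (continuous_polar_right r).measurable
  simp only
  rw [lintegral_congr this, lintegral_const_mul _ hm]

lemma isFiniteMeasure_tailMeasure {ω : ℂ → ℝ} (hω : IsDoublingWeight ω) : IsFiniteMeasure (tailMeasure ω) := by
  obtain ⟨C, hC⟩ := exists_tailMeasure_Ioo_le hω
  refine ⟨?_⟩
  have h1 : tailMeasure ω (Ioo 0 1)ᶜ = 0 := by
    have := ae_tailMeasure ω
    rwa [ae_iff] at this
  calc tailMeasure ω univ ≤ tailMeasure ω (Ioo 0 1) + tailMeasure ω (Ioo 0 1)ᶜ := by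
        rw [← union_compl_self (Ioo (0 : ℝ) 1)]; exact measure_union_le _ _
    _ ≤ C * tail ω 0 := by rw [h1, add_zero]; exact hC 0 le_rfl zero_lt_one
    _ < ∞ := ENNReal.mul_lt_top ENNReal.coe_lt_top (tail_lt_top hω le_rfl)

/-- Hölder's inequality in the form needed for the small Hankel operator. -/
lemma lintegral_tailMeasure_mul_le {p q : ℝ} (hq : 1 < q) (hqp : q < p) {ω ν : ℂ → ℝ}
    (hω : IsDoublingWeight ω) (hν : IsDoublingWeight ν) (n : ℕ) {a b : ℂ → ℝ≥0∞} (ha : Measurable a)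
    (hb : Measurable b) :
    ∫⁻ z, (a z * b z * ENNReal.ofReal (1 - ‖z‖) ^ n) ^ q ∂(polarMeasure (tailMeasure ν)) ≤
      (∫⁻ z, b z ^ p ∂(polarMeasure (tailMeasure ω))) ^ (q / p) *
      (∫⁻ z, a z ^ (p * q / (p - q)) ∂(polarMeasure
        ((volume.restrict (Ioo 0 1)).withDensity fun r => ENNReal.ofReal (symWeight p q ω ν n r)))) ^
          ((p - q) / p) := by
  have hp0 : 0 < p := by linarith
  have hq0 : 0 < q := by linarith
  have hpq : 0 < p - q := by linarith
  have hw := (measurable_symWeight p q ω ν n).ennreal_ofReal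
  have htm : ∀ ω, Measurable fun r : ℝ => tail ω r / ENNReal.ofReal (1 - r) := fun ω =>
    (measurable_tail ω).div (by fun_prop)
  unfold tailMeasure
  rw [lintegral_polarMeasure_withDensity' (htm ν) (by fun_prop),
    lintegral_polarMeasure_withDensity' (htm ω) (by fun_prop), lintegral_polarMeasure_withDensity' hw (by fun_prop)]
  -- Hölder's inequality with exponents p/q and p/(p-q). The identity `key` between the three radial
  -- weights is what determines the weight of the symbol integral.
  refine le_trans (lintegral_mono_ae ?_) (ENNReal.lintegral_mul_norm_pow_le
    (((htm ω).comp measurable_norm).mul (hb.pow_const p)).aemeasurable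
    ((hw.comp measurable_norm).mul (ha.pow_const _)).aemeasurable (by positivity) (by positivity)
    (by field_simp; ring))
  filter_upwards [ae_polarMeasure_mem_disc (ae_restrict_mem measurableSet_Ioo)] with z hz
  simp only [Function.comp, Pi.mul_apply]
  set r := ‖z‖
  have hr : 0 ≤ r := norm_nonneg z
  have hr1 : r < 1 := mem_ball_zero_iff.1 hz
  have h1 := tl_pos hω hr hr1
  have h2 := tl_pos hν hr hr1
  have h3 : 0 < 1 - r := by linarith
  have hsw := symWeight_pos (p := p) (q := q) hω hν n hr hr1
  rw [← ofReal_tl hω hr, ← ofReal_tl hν hr, ← ENNReal.ofReal_div_of_pos h3, ← ENNReal.ofReal_div_of_pos h3,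
    ENNReal.mul_rpow_of_nonneg _ _ (by positivity : 0 ≤ q / p),
    ENNReal.mul_rpow_of_nonneg _ _ (by positivity : 0 ≤ (p - q) / p), ← ENNReal.rpow_mul, ← ENNReal.rpow_mul,
    ENNReal.mul_rpow_of_nonneg _ _ hq0.le, ENNReal.mul_rpow_of_nonneg _ _ hq0.le,
    show p * (q / p) = q by field_simp, show p * q / (p - q) * ((p - q) / p) = q by field_simp]
  have key : tl ν r / (1 - r) * ((1 - r) ^ n) ^ q =
      (tl ω r / (1 - r)) ^ (q / p) * symWeight p q ω ν n r ^ ((p - q) / p) := by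
    rw [symWeight, Real.div_rpow h1.le h3.le, Real.mul_rpow (by positivity) (by positivity),
      Real.mul_rpow (by positivity) (by positivity), ← Real.rpow_mul h3.le, ← Real.rpow_mul h2.le,
      ← Real.rpow_mul h1.le, ← Real.rpow_natCast, ← Real.rpow_mul h3.le,
      show p / (p - q) * ((p - q) / p) = 1 by field_simp, Real.rpow_one,
      show -(q / (p - q)) * ((p - q) / p) = -(q / p) by field_simp, Real.rpow_neg h1.le,
      show (n * (p * q / (p - q)) - 1) * ((p - q) / p) = n * q + q / p - 1 by field_simp; ring,
      Real.rpow_sub_one h3.ne', Real.rpow_add h3]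
    field_simp
  have key2 : ENNReal.ofReal (tl ν r / (1 - r)) * (ENNReal.ofReal (1 - r) ^ n) ^ q =
      ENNReal.ofReal (tl ω r / (1 - r)) ^ (q / p) * ENNReal.ofReal (symWeight p q ω ν n r) ^ ((p - q) / p) := by
    rw [← ENNReal.ofReal_pow h3.le, ENNReal.ofReal_rpow_of_pos (by positivity),
      ENNReal.ofReal_rpow_of_pos (by positivity), ENNReal.ofReal_rpow_of_pos hsw, ← ENNReal.ofReal_mul (by positivity),
      ← ENNReal.ofReal_mul (by positivity), key]
  calc _ = (ENNReal.ofReal (tl ν r / (1 - r)) * (ENNReal.ofReal (1 - r) ^ n) ^ q) * (a z ^ q * b z ^ q) := by ring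
    _ ≤ _ := by rw [key2]; apply le_of_eq; ring

/-! ### The upper bound for the operator norm. -/

/-- A kernel with dyadic bounds away from the point `1` is dominated by the model kernel. -/
lemma enorm_comp_le_kern {A : ℕ → ℝ} {G : ℂ → ℂ} {C : ℝ} (hC : 0 ≤ C)
    (h : ∀ w : ℂ, ‖w‖ < 1 → ∀ j : ℕ, (1 / 2 : ℝ) ^ j ≤ ‖1 - w‖ → ‖1 - w‖ ≤ 2 * (1 / 2) ^ j →
      ‖G w‖ ≤ C * (2 ^ j * A j)) {z ζ : ℂ}
    (hz : z ∈ disc) (hζ : ζ ∈ disc) : ‖G (conj z * ζ)‖ₑ ≤ ENNReal.ofReal C * kern A 2 z ζ := by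
  have hw := mem_ball_zero_iff.1 (conj_mul_mem_disc hz hζ)
  have h0 : 0 < ‖1 - conj z * ζ‖ := by
    rw [norm_pos_iff, sub_ne_zero]
    intro h
    rw [← h] at hw
    simp at hw
  have h2 : ‖1 - conj z * ζ‖ ≤ 2 := by
    refine (norm_sub_le _ _).trans ?_
    rw [norm_one]
    linarith
  -- Halving brings the distance, at most 2, into (0, 1]. The resulting j satisfies 2^(-j) < ‖1 - w‖
  -- ≤ 2·2^(-j), so the j-th term of the model kernel with aperture c = 2 is present.
  obtain ⟨j, hj1, hj2⟩ := exists_nat_pow_near_of_lt_one (x := ‖1 - conj z * ζ‖ / 2) (y := 1 / 2) (by positivity)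
    (by linarith) (by norm_num) (by norm_num)
  rw [pow_succ] at hj1
  have h3 := h _ hw j (by linarith) (by linarith)
  calc ‖G (conj z * ζ)‖ₑ ≤ ENNReal.ofReal C * ENNReal.ofReal (2 ^ j * A j) := by
        rw [← ofReal_norm, ← ENNReal.ofReal_mul hC]
        exact ENNReal.ofReal_le_ofReal h3
    _ ≤ _ := by
        gcongr
        unfold kern
        refine le_trans (le_of_eq ?_) (ENNReal.le_tsum j)
        rw [indicator_of_mem (show (z, ζ) ∈ {p : ℂ × ℂ | ‖1 - conj p.1 * p.2‖ < 2 ^ 2 * (1 / 2) ^ j} from ?_)]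
        rw [mem_ofPred_eq]
        have : (0 : ℝ) < (1 / 2) ^ j := by positivity
        simp only
        linarith

/-- The kernel has A = 1/ν̂, the target profile is 2ν̂ and the source profile ν̂. Then A o is
constant, and the weight A^q o m^(q-1) given by Schur's test is the constant 2. -/
lemma exists_schur_bergman {ν : ℂ → ℝ} (hν : IsDoublingWeight ν) {q : ℝ} (hq : 1 < q) :
    ∃ C : ℝ≥0, ∀ u : ℂ → ℝ≥0∞, Measurable u →
      ∫⁻ z, (∫⁻ ζ, ‖kerfun ν 0 (conj z * ζ)‖ₑ * u ζ ∂(polarMeasure (tailMeasure ν))) ^ q ∂(weightMeasure ν) ≤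
        C * ∫⁻ ζ, u ζ ^ q ∂(polarMeasure (tailMeasure ν)) := by
  obtain ⟨D, β, hD1, hD⟩ := exists_dyTail_le hν
  have hpos := dyTail_pos hν
  obtain ⟨C, hC0, hC⟩ := exists_schur (A := fun l => (dyTail ν l)⁻¹) (o := fun l => 2 * dyTail ν l) (m := dyTail ν)
    2 hq (fun l => inv_pos.2 (hpos l)) ((geoDecay_dyTail hν).inv hpos) (D := D * 2 ^ β) (by positivity)
    (fun l => by
      rw [← div_eq_mul_inv, le_div_iff₀ (hpos l), inv_mul_le_iff₀ (hpos _), mul_comm]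
      simpa using hD l 1)
    (fun l => by have := hpos l; positivity)
    (by
      obtain ⟨C, ρ, h1, h2, h3, h4⟩ := geoDecay_dyTail hν
      exact ⟨C, ρ, h1, h2, h3, fun l i => by have := h4 l i; linarith⟩) zero_le_one
    (fun l i => by
      have h1 := (hpos l).ne'
      have h2 := (hpos (l + i)).ne'
      apply le_of_eq
      field_simp) hpos (hasProfile_tailMeasure hν) (hasProfile_radialPart hν)
  obtain ⟨K, hK0, hK⟩ := exists_norm_kernel_le hν 0
  have hker := @enorm_comp_le_kern (fun l => (dyTail ν l)⁻¹) (kerfun ν 0) K hK0 (fun w hw j hj _ => by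
    have := hK w hw j hj
    simpa [kerfun, dyTail, div_eq_mul_inv] using this)
  refine ⟨(K ^ q * (C * 2)).toNNReal, fun u hu => ?_⟩
  have h3 := hC u hu
  rw [weightMeasure_eq_polarMeasure hν.toIsRadialWeight]
  calc ∫⁻ z, (∫⁻ ζ, ‖kerfun ν 0 (conj z * ζ)‖ₑ * u ζ ∂(polarMeasure (tailMeasure ν))) ^ q ∂(polarMeasure (radialPart ν))
      ≤ ∫⁻ z, ENNReal.ofReal (K ^ q) *
          (∫⁻ ζ, kern (fun l => (dyTail ν l)⁻¹) 2 z ζ * u ζ ∂(polarMeasure (tailMeasure ν))) ^ q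
            ∂(polarMeasure (radialPart ν)) := by
        apply lintegral_mono_ae
        filter_upwards [ae_polarMeasure_mem_disc (ae_radialPart ν)] with z hz
        rw [← ENNReal.ofReal_rpow_of_nonneg hK0 (by linarith), ← ENNReal.mul_rpow_of_nonneg _ _ (by linarith),
          ← lintegral_const_mul' _ _ ENNReal.ofReal_ne_top]
        apply ENNReal.rpow_le_rpow _ (by linarith)
        apply lintegral_mono_ae
        filter_upwards [ae_polarMeasure_mem_disc (ae_tailMeasure ν)] with ζ hζ
        rw [← mul_assoc]
        exact mul_le_mul' (hker hz hζ) le_rfl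
    _ ≤ ENNReal.ofReal (K ^ q) * (ENNReal.ofReal C * ∫⁻ ζ, u ζ ^ q * 2 ∂(polarMeasure (tailMeasure ν))) := by
        rw [lintegral_const_mul' _ _ ENNReal.ofReal_ne_top]
        gcongr
        refine h3.trans (le_of_eq ?_)
        congr 1
        apply lintegral_congr
        intro ζ
        congr 1
        have h5 := hpos (lev ζ)
        rw [Real.inv_rpow h5.le, Real.rpow_sub_one h5.ne']
        have : 0 < dyTail ν (lev ζ) ^ q := by positivity
        rw [← ENNReal.ofReal_ofNat]
        congr 1
        field_simp
    _ = _ := by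
        rw [lintegral_mul_const' _ _ (by simp)]
        change _ = ENNReal.ofReal _ * _
        rw [ENNReal.ofReal_mul (by positivity), ENNReal.ofReal_mul hC0]
        simp
        ring

lemma lintegral_invMeasure_le {ν : ℂ → ℝ} (hν : IsDoublingWeight ν) (m : ℕ) {F : ℂ → ℝ≥0∞} (hF : Measurable F) :
    ∫⁻ ζ, F ζ ∂(polarMeasure (invMeasure m (radialPart ν))) ≤ ENNReal.ofReal (4 * 2 ^ m) *
      ∫⁻ ζ, F ζ * ENNReal.ofReal (1 - ‖ζ‖) ^ (m + 1) ∂(polarMeasure (tailMeasure ν)) := by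
  have hw : Measurable fun s : ℝ => ENNReal.ofReal (4 * (2 * (1 - s)) ^ m) * tail ν s :=
    (by fun_prop : Measurable fun s : ℝ => ENNReal.ofReal (4 * (2 * (1 - s)) ^ m)).mul (measurable_tail ν)
  have htm : Measurable fun r : ℝ => tail ν r / ENNReal.ofReal (1 - r) :=
    (measurable_tail ν).div (by fun_prop)
  have hF2 : Measurable fun ζ => F ζ * ENNReal.ofReal (1 - ‖ζ‖) ^ (m + 1) := by fun_prop
  calc ∫⁻ ζ, F ζ ∂(polarMeasure (invMeasure m (radialPart ν)))
      ≤ ∫⁻ ζ, F ζ ∂(polarMeasure ((volume.restrict (Ioo 0 1)).withDensity fun s =>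
          ENNReal.ofReal (4 * (2 * (1 - s)) ^ m) * tail ν s)) := by
        rw [lintegral_polarMeasure _ hF.aemeasurable, lintegral_polarMeasure _ hF.aemeasurable]
        exact lintegral_mono' (invMeasure_radialPart_le hν.toIsRadialWeight m) le_rfl
    _ = ENNReal.ofReal (4 * 2 ^ m) *
      ∫⁻ ζ, F ζ * ENNReal.ofReal (1 - ‖ζ‖) ^ (m + 1) ∂(polarMeasure (tailMeasure ν)) := by
        unfold tailMeasure
        rw [lintegral_polarMeasure_withDensity' hw hF, lintegral_polarMeasure_withDensity' htm hF2,
          ← lintegral_const_mul' _ _ ENNReal.ofReal_ne_top]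
        apply lintegral_congr_ae
        filter_upwards [ae_polarMeasure_mem_disc (ae_restrict_mem measurableSet_Ioo)] with z hz
        have h3 : 0 < 1 - ‖z‖ := by linarith [mem_ball_zero_iff.1 hz]
        have h4 : ENNReal.ofReal (1 - ‖z‖) / ENNReal.ofReal (1 - ‖z‖) = 1 :=
          ENNReal.div_self (by simpa using h3) ENNReal.ofReal_ne_top
        rw [mul_pow, ← mul_assoc, ENNReal.ofReal_mul (by positivity), ENNReal.ofReal_pow h3.le, pow_succ]
        calc _ = ENNReal.ofReal (4 * 2 ^ m) * (tail ν ‖z‖ * (F z * ENNReal.ofReal (1 - ‖z‖) ^ m)) *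
              (ENNReal.ofReal (1 - ‖z‖) / ENNReal.ofReal (1 - ‖z‖)) := by rw [h4]; ring
          _ = _ := by rw [div_eq_mul_inv, div_eq_mul_inv]; ring

lemma weightedNorm_eq {p : ℝ} (hp : 0 < p) (ω : ℂ → ℝ) (f : ℂ → ℂ) :
    weightedNorm p ω f = (∫⁻ z, ‖f z‖ₑ ^ p ∂(weightMeasure ω)) ^ (1 / p) := by
  rw [weightedNorm, eLpNorm_eq_lintegral_rpow_enorm_toReal (by simpa using hp) ENNReal.ofReal_ne_top,
    ENNReal.toReal_ofReal hp.le]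

lemma lintegral_enorm_rpow_eq {p : ℝ} (hp : 0 < p) (ω : ℂ → ℝ) (f : ℂ → ℂ) :
    ∫⁻ z, ‖f z‖ₑ ^ p ∂(weightMeasure ω) = weightedNorm p ω f ^ p := by
  rw [weightedNorm_eq hp, ← ENNReal.rpow_mul, one_div_mul_cancel hp.ne', ENNReal.rpow_one]

lemma measurable_indicator_of_continuousOn {F : ℂ → ℂ} (hF : ContinuousOn F disc) :
    Measurable (disc.indicator F) := by
  classical
  rw [← Set.piecewise_eq_indicator]
  exact hF.measurable_piecewise continuousOn_const Metric.isOpen_ball.measurableSet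

/-- The integral over the disc that represents the small Hankel operator by means of a derivative
of the symbol. -/
def hankelExt (m : ℕ) (ν : ℂ → ℝ) (f g : ℂ → ℂ) : ℂ → ℂ :=
  disc.indicator fun z => ∫ ζ, pderiv (m + 1) f ζ * conj (g ζ) * conj (kerfun ν 0 (conj z * ζ))
    ∂(polarMeasure (invMeasure m (radialPart ν)))

lemma differentiableOn_pderiv {f : ℂ → ℂ} (hf : DifferentiableOn ℂ f disc) (n : ℕ) :
    DifferentiableOn ℂ (pderiv n f) disc :=
  differentiableOn_of_hasSum_disc fun _ hz => hasSum_pderiv hf n hz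

lemma ae_invMeasure {ν : ℂ → ℝ} (hν : IsRadialWeight ν) (m : ℕ) :
    ∀ᵐ r ∂(invMeasure m (radialPart ν)), r ∈ Ioo (0 : ℝ) 1 :=
  (Measure.absolutelyContinuous_of_le (invMeasure_radialPart_le hν m)).ae_le (ae_withDensity_mem _)

/-- The main estimate for the upper bound of the operator norm. -/
lemma exists_hankelExt_le {p q : ℝ} (hq : 1 < q) (hqp : q < p) {ω ν : ℂ → ℝ} (hω : IsDoublingWeight ω)
    (hν : IsDoublingWeight ν) (m : ℕ) : ∃ C : ℝ≥0, ∀ f g : ℂ → ℂ, DifferentiableOn ℂ f disc →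
      DifferentiableOn ℂ g disc →
      ∫⁻ z, ‖hankelExt m ν f g z‖ₑ ^ q ∂(weightMeasure ν) ≤ C * (weightedNorm p ω g ^ q *
        (∫⁻ z, ‖pderiv (m + 1) f z‖ₑ ^ (p * q / (p - q)) ∂(polarMeasure ((volume.restrict (Ioo 0 1)).withDensity
          fun r => ENNReal.ofReal (symWeight p q ω ν (m + 1) r)))) ^ ((p - q) / p)) ∧
      (∫⁻ z, ‖pderiv (m + 1) f z * conj (g z)‖ₑ ∂(polarMeasure (invMeasure m (radialPart ν)))) ^ q ≤
        C * (weightedNorm p ω g ^ q *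
        (∫⁻ z, ‖pderiv (m + 1) f z‖ₑ ^ (p * q / (p - q)) ∂(polarMeasure ((volume.restrict (Ioo 0 1)).withDensity
          fun r => ENNReal.ofReal (symWeight p q ω ν (m + 1) r)))) ^ ((p - q) / p)) := by
  have hp : 1 < p := by linarith
  have hp0 : 0 < p := by linarith
  have hq0 : 0 < q := by linarith
  have hpq : 0 < p - q := by linarith
  obtain ⟨C₁, hC₁⟩ := exists_schur_bergman hν hq
  obtain ⟨C₂, hC₂⟩ := exists_lintegral_tailMeasure_le hω hp
  set K : ℝ≥0 := (4 * 2 ^ m : ℝ).toNNReal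
  have := isFiniteMeasure_tailMeasure hν
  have hfin := isFiniteMeasure_polarMeasure (tailMeasure ν)
  set V : ℝ≥0 := (polarMeasure (tailMeasure ν) univ).toNNReal
  have hV : (V : ℝ≥0∞) = polarMeasure (tailMeasure ν) univ := ENNReal.coe_toNNReal (measure_ne_top _ _)
  refine ⟨K ^ q * (C₁ + V ^ (q - 1)) * C₂ ^ (q / p), fun f g hf hg => ?_⟩
  have hDd := differentiableOn_pderiv hf (m + 1)
  set Df := disc.indicator (pderiv (m + 1) f)
  set Ig := disc.indicator g
  have hDm : Measurable Df := measurable_indicator_of_continuousOn hDd.continuousOn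
  have hIm : Measurable Ig := measurable_indicator_of_continuousOn hg.continuousOn
  have hDeq : ∀ z ∈ disc, Df z = pderiv (m + 1) f z := fun z hz => indicator_of_mem hz _
  have hIeq : ∀ z ∈ disc, Ig z = g z := fun z hz => indicator_of_mem hz _
  have hτ : ∀ᵐ z ∂(polarMeasure (invMeasure m (radialPart ν))), z ∈ disc :=
    ae_polarMeasure_mem_disc (ae_invMeasure hν.toIsRadialWeight m)
  set J := ∫⁻ z, ‖pderiv (m + 1) f z‖ₑ ^ (p * q / (p - q)) ∂(polarMeasure ((volume.restrict (Ioo 0 1)).withDensity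
          fun r => ENNReal.ofReal (symWeight p q ω ν (m + 1) r)))
  set u : ℂ → ℝ≥0∞ := fun ζ => ‖Df ζ‖ₑ * ‖Ig ζ‖ₑ * ENNReal.ofReal (1 - ‖ζ‖) ^ (m + 1) with hu
  have hum : Measurable u := by fun_prop
  have hholder : ∫⁻ ζ, u ζ ^ q ∂(polarMeasure (tailMeasure ν)) ≤
      (C₂ : ℝ≥0∞) ^ (q / p) * (weightedNorm p ω g ^ q * J ^ ((p - q) / p)) := by
    refine (lintegral_tailMeasure_mul_le hq hqp hω hν (m + 1) hDm.enorm hIm.enorm).trans ?_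
    rw [← mul_assoc]
    refine mul_le_mul' ?_ (le_of_eq ?_)
    · have e : ∫⁻ z, ‖Ig z‖ₑ ^ p ∂(polarMeasure (tailMeasure ω)) = ∫⁻ z, ‖g z‖ₑ ^ p ∂(polarMeasure (tailMeasure ω)) := by
        apply lintegral_congr_ae
        filter_upwards [ae_polarMeasure_mem_disc (ae_tailMeasure ω)] with z hz
        rw [hIeq z hz]
      rw [e]
      refine (ENNReal.rpow_le_rpow (hC₂ g hg) (by positivity)).trans (le_of_eq ?_)
      rw [lintegral_enorm_rpow_eq hp0, ENNReal.mul_rpow_of_nonneg _ _ (by positivity), ← ENNReal.rpow_mul]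
      congr 2
      field_simp
    · congr 1
      apply lintegral_congr_ae
      filter_upwards [ae_polarMeasure_mem_disc (ae_withDensity_mem _)] with z hz
      rw [hDeq z hz]
  -- The inverted measure is at most a constant times (1-|ζ|)^(m+1) ν̂/(1-|ζ|), and u already
  -- contains this power of 1-|ζ|.
  have hinv : ∀ k : ℂ → ℝ≥0∞, Measurable k →
      ∫⁻ ζ, ‖pderiv (m + 1) f ζ * conj (g ζ)‖ₑ * k ζ ∂(polarMeasure (invMeasure m (radialPart ν))) ≤
        K * ∫⁻ ζ, k ζ * u ζ ∂(polarMeasure (tailMeasure ν)) := by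
    intro k hk
    have e : ∫⁻ ζ, ‖pderiv (m + 1) f ζ * conj (g ζ)‖ₑ * k ζ ∂(polarMeasure (invMeasure m (radialPart ν))) =
        ∫⁻ ζ, ‖Df ζ‖ₑ * ‖Ig ζ‖ₑ * k ζ ∂(polarMeasure (invMeasure m (radialPart ν))) := by
      apply lintegral_congr_ae
      filter_upwards [hτ] with ζ hζ
      rw [hDeq ζ hζ, hIeq ζ hζ, enorm_mul, RCLike.enorm_conj]
    rw [e]
    refine (lintegral_invMeasure_le hν m (by fun_prop)).trans (mul_le_mul' le_rfl (le_of_eq ?_))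
    apply lintegral_congr
    intro ζ
    rw [hu]
    ring
  have hcoe : ((K ^ q * (C₁ + V ^ (q - 1)) * C₂ ^ (q / p) : ℝ≥0) : ℝ≥0∞) =
      (K : ℝ≥0∞) ^ q * (C₁ + (V : ℝ≥0∞) ^ (q - 1)) * (C₂ : ℝ≥0∞) ^ (q / p) := by
    push_cast
    rw [ENNReal.coe_rpow_of_nonneg _ hq0.le, ENNReal.coe_rpow_of_nonneg _ (by linarith),
      ENNReal.coe_rpow_of_nonneg _ (by positivity)]
  have hfinal : ∀ X : ℝ≥0∞, X ≤ (K : ℝ≥0∞) ^ q * ((C₁ + (V : ℝ≥0∞) ^ (q - 1)) *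
      ∫⁻ ζ, u ζ ^ q ∂(polarMeasure (tailMeasure ν))) →
      X ≤ ((K ^ q * (C₁ + V ^ (q - 1)) * C₂ ^ (q / p) : ℝ≥0) : ℝ≥0∞) * (weightedNorm p ω g ^ q * J ^ ((p - q) / p)) := by
    intro X hX
    rw [hcoe]
    refine hX.trans ?_
    rw [mul_assoc, mul_assoc]
    gcongr
  constructor
  · apply hfinal
    calc ∫⁻ z, ‖hankelExt m ν f g z‖ₑ ^ q ∂(weightMeasure ν)
        ≤ ∫⁻ z, (K : ℝ≥0∞) ^ q * (∫⁻ ζ, ‖kerfun ν 0 (conj z * ζ)‖ₑ * u ζ ∂(polarMeasure (tailMeasure ν))) ^ q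
            ∂(weightMeasure ν) := by
          apply lintegral_mono_ae
          filter_upwards [ae_weightMeasure_mem_disc hν.toIsRadialWeight] with z hz
          rw [← ENNReal.mul_rpow_of_nonneg _ _ hq0.le]
          apply ENNReal.rpow_le_rpow _ hq0.le
          rw [hankelExt, indicator_of_mem hz]
          set k := disc.indicator fun ζ => kerfun ν 0 (conj z * ζ)
          have hkm : Measurable k := measurable_indicator_of_continuousOn
            (differentiableOn_comp_conj_mul (differentiableOn_kerfun hν 0) hz).continuousOn
          have hk : ∀ ζ ∈ disc, k ζ = kerfun ν 0 (conj z * ζ) := fun ζ hζ => indicator_of_mem hζ _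
          refine (enorm_integral_le_lintegral_enorm _).trans ?_
          refine le_trans (le_of_eq ?_) ((hinv (fun ζ => ‖k ζ‖ₑ) hkm.enorm).trans (le_of_eq ?_))
          · apply lintegral_congr_ae
            filter_upwards [hτ] with ζ hζ
            rw [hk ζ hζ, enorm_mul _ (conj (kerfun ν 0 (conj z * ζ))), RCLike.enorm_conj]
          · congr 1
            apply lintegral_congr_ae
            filter_upwards [ae_polarMeasure_mem_disc (ae_tailMeasure ν)] with ζ hζ
            rw [hk ζ hζ]
      _ ≤ (K : ℝ≥0∞) ^ q * (C₁ * ∫⁻ ζ, u ζ ^ q ∂(polarMeasure (tailMeasure ν))) := by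
          rw [lintegral_const_mul' _ _ (by finiteness)]
          gcongr
          exact hC₁ u hum
      _ ≤ _ := by
          gcongr
          exact le_self_add
  · apply hfinal
    -- The case of kernel 1, with Hölder's inequality on a finite measure. It provides the absolute
    -- convergence needed to define the extension for unbounded g.
    have h1 := hinv (fun _ => 1) measurable_const
    simp only [mul_one] at h1
    refine (ENNReal.rpow_le_rpow h1 hq0.le).trans ?_
    rw [ENNReal.mul_rpow_of_nonneg _ _ hq0.le]
    have h2 := lintegral_mul_rpow_le (μ := polarMeasure (tailMeasure ν)) (K := fun _ => 1) (u := u) (φ := fun _ => 1)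
      measurable_const hum measurable_const (by simp) (by simp) hq
    simp only [mul_one, ENNReal.one_rpow, lintegral_const, one_mul] at h2
    rw [← hV] at h2
    simp only [one_mul]
    gcongr
    refine h2.trans ?_
    gcongr
    exact le_add_self

/-- The extension is `hankelExt`, which converges absolutely for every g in the domain space. The
number X stands for an s-th root of the symbol side, so that the bound is homogeneous in f. -/
lemma exists_isSmallHankelBound {p q : ℝ} (hq : 1 < q) (hqp : q < p) {ω ν : ℂ → ℝ} (hω : IsDoublingWeight ω)
    (hν : IsDoublingWeight ν) : ∃ N : ℕ, ∀ n : ℕ, N ≤ n → ∃ C : ℝ≥0, ∀ f : ℂ → ℂ, DifferentiableOn ℂ f disc →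
      Integrable f (weightMeasure ν) → ∀ X : ℝ≥0,
        symbolIntegral p q ω ν f n + ∑ j ∈ Finset.range n, ‖iteratedDeriv j f 0‖ₑ ^ (p * q / (p - q)) ≤
          (X : ℝ≥0∞) ^ (p * q / (p - q)) → IsSmallHankelBound p q ω ν f (C * X) := by
  have hp : 1 < p := by linarith
  have hp0 : 0 < p := by linarith
  have hq0 : 0 < q := by linarith
  have hpq : 0 < p - q := by linarith
  obtain ⟨N, hN1, hN⟩ := exists_symWeight_le hq hqp hω hν
  refine ⟨N, fun n hn => ?_⟩
  obtain ⟨m, rfl⟩ : ∃ m, n = m + 1 := ⟨n - 1, by omega⟩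
  obtain ⟨D, hD0, hD⟩ := hN _ hn
  obtain ⟨E, hE⟩ := exists_lintegral_pderiv_symWeight_le hq hqp hω hν hD0 hD
  obtain ⟨C, hC⟩ := exists_hankelExt_le hq hqp hω hν m
  refine ⟨(C * E ^ ((p - q) / p)) ^ (1 / q), fun f hf hfi X hX => ?_⟩
  have hDd := differentiableOn_pderiv hf (m + 1)
  have hτ : ∀ᵐ z ∂(polarMeasure (invMeasure m (radialPart ν))), z ∈ disc :=
    ae_polarMeasure_mem_disc (ae_invMeasure hν.toIsRadialWeight m)
  have hJ : (∫⁻ z, ‖pderiv (m + 1) f z‖ₑ ^ (p * q / (p - q)) ∂(polarMeasure ((volume.restrict (Ioo 0 1)).withDensity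
          fun r => ENNReal.ofReal (symWeight p q ω ν (m + 1) r)))) ^ ((p - q) / p) ≤
      (E : ℝ≥0∞) ^ ((p - q) / p) * (X : ℝ≥0∞) ^ q := by
    refine (ENNReal.rpow_le_rpow ((hE f hf).trans (mul_le_mul' le_rfl hX)) (by positivity)).trans (le_of_eq ?_)
    rw [ENNReal.mul_rpow_of_nonneg _ _ (by positivity), ← ENNReal.rpow_mul]
    congr 2
    field_simp
  have hbound : ∀ Y : ℝ≥0∞, ∀ g : ℂ → ℂ, Y ≤ C * (weightedNorm p ω g ^ q *
        (∫⁻ z, ‖pderiv (m + 1) f z‖ₑ ^ (p * q / (p - q)) ∂(polarMeasure ((volume.restrict (Ioo 0 1)).withDensity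
          fun r => ENNReal.ofReal (symWeight p q ω ν (m + 1) r)))) ^ ((p - q) / p)) →
        Y ^ (1 / q) ≤ (((C * E ^ ((p - q) / p)) ^ (1 / q) * X : ℝ≥0) : ℝ≥0∞) * weightedNorm p ω g := by
    intro Y g hY
    refine (ENNReal.rpow_le_rpow (hY.trans (mul_le_mul' le_rfl (mul_le_mul' le_rfl hJ))) (by positivity)).trans
      (le_of_eq ?_)
    have h1q : (0 : ℝ) ≤ 1 / q := by positivity
    push_cast
    rw [ENNReal.coe_rpow_of_nonneg _ h1q]
    push_cast
    rw [ENNReal.coe_rpow_of_nonneg _ (by positivity), show (C : ℝ≥0∞) * (weightedNorm p ω g ^ q *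
      ((E : ℝ≥0∞) ^ ((p - q) / p) * (X : ℝ≥0∞) ^ q)) = (C * (E : ℝ≥0∞) ^ ((p - q) / p)) * (X ^ q * weightedNorm p ω g ^ q) by ring,
      ENNReal.mul_rpow_of_nonneg _ _ h1q, ← ENNReal.mul_rpow_of_nonneg _ _ hq0.le, ← ENNReal.rpow_mul _ q,
      mul_one_div_cancel hq0.ne', ENNReal.rpow_one, mul_assoc]
  have hint : ∀ g ∈ bergmanSpace p ω, Integrable (fun z => pderiv (m + 1) f z * conj (g z))
      (polarMeasure (invMeasure m (radialPart ν))) := by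
    intro g hg
    refine ⟨aestronglyMeasurable_of_continuousOn hτ (hDd.continuousOn.mul
      (Complex.continuous_conj.comp_continuousOn hg.1.continuousOn)), ?_⟩
    have h1 := hbound _ g (hC f g hf hg.1).2
    rw [← ENNReal.rpow_mul, mul_one_div_cancel hq0.ne', ENNReal.rpow_one] at h1
    exact h1.trans_lt (ENNReal.mul_lt_top ENNReal.coe_lt_top hg.2.2)
  have hkint : ∀ g ∈ bergmanSpace p ω, ∀ z ∈ disc, Integrable (fun ζ => pderiv (m + 1) f ζ * conj (g ζ) *
      conj (kerfun ν 0 (conj z * ζ))) (polarMeasure (invMeasure m (radialPart ν))) := by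
    intro g hg z hz
    obtain ⟨M, -, hM⟩ := exists_norm_comp_conj_mul_le (fun w hw => hasSum_kerfun hν 0 hw) hz
    exact integrable_mul_conj hτ (hint g hg)
      (differentiableOn_comp_conj_mul (differentiableOn_kerfun hν 0) hz).continuousOn hM
  have hnorm : ∀ g ∈ bergmanSpace p ω, weightedNorm q ν (hankelExt m ν f g) ≤
      (((C * E ^ ((p - q) / p)) ^ (1 / q) * X : ℝ≥0) : ℝ≥0∞) * weightedNorm p ω g := by
    intro g hg
    rw [weightedNorm_eq hq0]
    exact hbound _ g (hC f g hf hg.1).1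
  have hmem : ∀ g ∈ bergmanSpace p ω, hankelExt m ν f g ∈ bergmanSpace q ν := by
    intro g hg
    have hd : DifferentiableOn ℂ (hankelExt m ν f g) disc := by
      refine differentiableOn_of_hasSum_disc (c := fun k => conj (kercoef ν 0 k : ℂ) *
        ∫ ζ, pderiv (m + 1) f ζ * conj (g ζ) * conj ζ ^ k ∂(polarMeasure (invMeasure m (radialPart ν))))
        fun z hz => ?_
      rw [hankelExt, indicator_of_mem hz]
      exact (hasSum_integral_mul_conj_comp hτ (hint g hg) (fun w hw => hasSum_kerfun hν 0 hw) hz).congr_fun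
        fun k => by ring
    refine ⟨hd, aestronglyMeasurable_of_continuousOn (ae_weightMeasure_mem_disc hν.toIsRadialWeight)
      hd.continuousOn, ?_⟩
    exact (hnorm g hg).trans_lt (ENNReal.mul_lt_top ENNReal.coe_lt_top hg.2.2)
  refine ⟨{ toFun := fun g => ⟨hankelExt m ν f g, hmem g g.2⟩, map_add' := ?_, map_smul' := ?_ }, ?_, fun g => hnorm g g.2⟩
  · intro g h
    ext z
    change hankelExt m ν f (g + h) z = hankelExt m ν f g z + hankelExt m ν f h z
    by_cases hz : z ∈ disc
    · simp only [hankelExt, indicator_of_mem hz]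
      rw [← integral_add (hkint g g.2 z hz) (hkint h h.2 z hz)]
      congr 1
      ext ζ
      simp only [Pi.add_apply, map_add]
      ring
    · simp [hankelExt, indicator_of_notMem hz]
  · intro c g
    ext z
    change hankelExt m ν f (c • (g : ℂ → ℂ)) z = conj c * hankelExt m ν f g z
    by_cases hz : z ∈ disc
    · simp only [hankelExt, indicator_of_mem hz]
      rw [← integral_const_mul]
      congr 1
      ext ζ
      simp only [Pi.smul_apply, smul_eq_mul, map_mul]
      ring
    · simp [hankelExt, indicator_of_notMem hz]
  -- For bounded g the product of g and the kernel is bounded and analytic, so both pairings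
  -- converge and the transfer of the derivative identifies the extension with the original
  -- integral.
  · rintro g ⟨M, hM⟩ z hz
    change hankelExt m ν f g z = _
    have hgd := g.2.1
    have hkd := differentiableOn_comp_conj_mul (differentiableOn_kerfun hν 0) hz
    obtain ⟨L, hL0, hL⟩ := exists_norm_comp_conj_mul_le (fun w hw => hasSum_kerfun hν 0 hw) hz
    rw [smallHankel_eq hν _ _ hz, hankelExt, indicator_of_mem hz]
    have e1 : ∀ (F : ℂ → ℂ) (ζ : ℂ), F ζ * conj ((g : ℂ → ℂ) ζ) * conj (kerfun ν 0 (conj z * ζ)) =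
        F ζ * conj ((g : ℂ → ℂ) ζ * kerfun ν 0 (conj z * ζ)) := by
      intro F ζ; rw [map_mul, mul_assoc]
    have h1 := hkint g g.2 z hz
    simp_rw [e1] at h1 ⊢
    have h2 : Integrable (fun ζ => f ζ * conj ((g : ℂ → ℂ) ζ * kerfun ν 0 (conj z * ζ))) (weightMeasure ν) := by
      refine integrable_mul_conj (ae_weightMeasure_mem_disc hν.toIsRadialWeight) hfi
        (hgd.continuousOn.mul hkd.continuousOn) (M := M * L) fun ζ hζ => ?_
      rw [norm_mul]
      exact mul_le_mul (hM ζ hζ) (hL ζ hζ) (norm_nonneg _) ((norm_nonneg _).trans (hM ζ hζ))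
    rw [weightMeasure_eq_polarMeasure hν.toIsRadialWeight] at h2 ⊢
    exact (integral_mul_conj_eq_pderiv (ae_radialPart ν) m hf (hgd.mul hkd) h2 h1).symm

/-! ### Dyadic polar rectangles. -/

/-- The index of the dyadic polar rectangle containing a point of the disc. -/
def cell (z : ℂ) : ℕ × ℕ := (lev z, ⌊2 ^ lev z * ((z.arg + Real.pi) / (2 * Real.pi))⌋₊)

/-- Dyadic polar rectangles. -/
def cellSet (k : ℕ × ℕ) : Set ℂ := {z | z ∈ disc ∧ cell z = k}

lemma measurable_cell : Measurable cell := by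
  unfold cell
  refine measurable_lev.prodMk (Nat.measurable_floor.comp ?_)
  have h1 : Measurable fun z => (2 : ℝ) ^ lev z := (measurable_from_top (f := fun n : ℕ => (2 : ℝ) ^ n)).comp measurable_lev
  have h2 := Complex.measurable_arg
  fun_prop

lemma measurableSet_cellSet (k : ℕ × ℕ) : MeasurableSet (cellSet k) :=
  Metric.isOpen_ball.measurableSet.inter (measurable_cell (measurableSet_singleton k))

lemma volume_Ico_inter_Ioo {a b c d : ℝ} (h1 : c ≤ a) (h2 : b ≤ d) :
    volume (Ico a b ∩ Ioo c d) = ENNReal.ofReal (b - a) := by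
  apply le_antisymm
  · exact (measure_mono inter_subset_left).trans (le_of_eq Real.volume_Ico)
  · rw [← Real.volume_Ioo]
    exact measure_mono fun x hx => ⟨⟨hx.1.le, hx.2⟩, h1.trans_lt hx.1, hx.2.trans_le h2⟩

lemma lev_eq_iff_mem {r : ℝ} (hr : r ∈ Ioo (0 : ℝ) 1) (i : ℕ) :
    lev r = i ↔ r ∈ Ico (1 - (1 / 2 : ℝ) ^ i) (1 - (1 / 2) ^ (i + 1)) := by
  have hd := ofReal_mem_disc hr.1.le hr.2
  have hn : ‖(r : ℂ)‖ = r := by rw [Complex.norm_real, Real.norm_eq_abs, abs_of_pos hr.1]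
  constructor
  · rintro rfl
    have := lev_spec hd
    rw [hn] at this
    exact ⟨by linarith [this.2], by linarith [this.1]⟩
  · intro h
    apply lev_eq_iff hd <;> rw [hn]
    · linarith [h.2]
    · linarith [h.1]

lemma arg_polar {r θ : ℝ} (hr : 0 < r) (hθ : θ ∈ Ioo (-Real.pi) Real.pi) : (polar (r, θ)).arg = θ := by
  rw [polar, Complex.exp_mul_I]
  exact Complex.arg_mul_cos_add_sin_mul_I hr ⟨hθ.1, hθ.2.le⟩

lemma cell_polar_eq_iff {r θ : ℝ} (hr : r ∈ Ioo (0 : ℝ) 1) (hθ : θ ∈ Ioo (-Real.pi) Real.pi) (i m : ℕ) :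
    cell (polar (r, θ)) = (i, m) ↔ r ∈ Ico (1 - (1 / 2 : ℝ) ^ i) (1 - (1 / 2) ^ (i + 1)) ∧
      θ ∈ Ico (-Real.pi + 2 * Real.pi * m / 2 ^ i) (-Real.pi + 2 * Real.pi * (m + 1) / 2 ^ i) := by
  have hpi := Real.pi_pos
  rw [cell, Prod.mk.injEq, lev_polar, ← lev_eq_iff_mem hr]
  refine and_congr_right fun h => ?_
  rw [h, arg_polar hr.1 hθ, Nat.floor_eq_iff (by have := hθ.1; have : 0 ≤ θ + Real.pi := by linarith
                                                 positivity)]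
  have e : (2 : ℝ) ^ i * ((θ + Real.pi) / (2 * Real.pi)) = (2 ^ i * (θ + Real.pi)) / (2 * Real.pi) := by ring
  rw [e, le_div_iff₀ (by positivity), div_lt_iff₀ (by positivity), mem_Ico, neg_add_le_iff_le_add, lt_neg_add_iff_add_lt,
    div_le_iff₀ (by positivity), lt_div_iff₀ (by positivity)]
  constructor <;> rintro ⟨h1, h2⟩ <;> constructor <;> linarith

/-- The measure is dr dθ/(2π), without Jacobian: radial length 2^(-i-1) times angular share 2^(-i).
The index m = 2^i does occur, for argument exactly π, but only on a null set. -/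
lemma area_cellSet (i m : ℕ) : polarMeasure (volume.restrict (Ioo 0 1)) (cellSet (i, m)) =
    if m < 2 ^ i then ENNReal.ofReal ((1 / 2) ^ (2 * i + 1)) else 0 := by
  have hpi := Real.pi_pos
  rw [← lintegral_indicator_one (measurableSet_cellSet _), lintegral_polarMeasure _
    ((measurable_one.indicator (measurableSet_cellSet _)).aemeasurable)]
  have hcirc : ∀ᵐ θ ∂circ, θ ∈ Ioo (-Real.pi) Real.pi :=
    Measure.ae_smul_measure (ae_restrict_mem measurableSet_Ioo) _
  set I := Ico (1 - (1 / 2 : ℝ) ^ i) (1 - (1 / 2) ^ (i + 1))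
  set J := Ico (-Real.pi + 2 * Real.pi * m / 2 ^ i) (-Real.pi + 2 * Real.pi * (m + 1) / 2 ^ i)
  have h1 : ∀ r ∈ Ioo (0 : ℝ) 1, ∫⁻ θ, (cellSet (i, m)).indicator (1 : ℂ → ℝ≥0∞) (polar (r, θ)) ∂circ =
      I.indicator (fun _ => circ J) r := by
    intro r hr
    rw [← lintegral_indicator_one measurableSet_Ico]
    by_cases hrI : r ∈ I
    · rw [indicator_of_mem hrI]
      apply lintegral_congr_ae
      filter_upwards [hcirc] with θ hθ
      have : polar (r, θ) ∈ cellSet (i, m) ↔ θ ∈ J := by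
        rw [cellSet, mem_ofPred_eq, cell_polar_eq_iff hr hθ]
        exact ⟨fun h => h.2.2, fun h => ⟨polar_mem_disc hr.1.le hr.2 θ, hrI, h⟩⟩
      simp only [indicator, this, Pi.one_apply]
      rfl
    · rw [indicator_of_notMem hrI, lintegral_eq_zero_iff' (by
        exact ((measurable_one.indicator (measurableSet_cellSet _)).comp
          (continuous_polar_right r).measurable).aemeasurable)]
      filter_upwards [hcirc] with θ hθ
      apply indicator_of_notMem
      intro h
      exact hrI ((cell_polar_eq_iff hr hθ i m).1 h.2).1
  rw [setLIntegral_congr_fun measurableSet_Ioo h1, lintegral_indicator_const measurableSet_Ico,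
    Measure.restrict_apply measurableSet_Ico, volume_Ico_inter_Ioo (one_sub_half_pow_nonneg i)
      (one_sub_half_pow_lt _).le]
  unfold circ
  rw [Measure.smul_apply, Measure.restrict_apply measurableSet_Ico, smul_eq_mul]
  split_ifs with hm
  · have hm' : ((m : ℝ) + 1) ≤ 2 ^ i := by exact_mod_cast hm
    rw [volume_Ico_inter_Ioo (by
        have : 0 ≤ 2 * Real.pi * m / 2 ^ i := by positivity
        linarith) (by
        have : 2 * Real.pi * (m + 1) / 2 ^ i ≤ 2 * Real.pi := by
          rw [div_le_iff₀ (by positivity)]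
          gcongr
        linarith), ← ENNReal.ofReal_inv_of_pos (by positivity), ← ENNReal.ofReal_mul (by positivity),
      ← ENNReal.ofReal_mul (by
        have : (-Real.pi + 2 * Real.pi * (m + 1) / 2 ^ i) - (-Real.pi + 2 * Real.pi * m / 2 ^ i) =
          2 * Real.pi / 2 ^ i := by ring
        rw [this]
        positivity)]
    congr 1
    rw [show 2 * i + 1 = i + (i + 1) by ring, pow_add _ i, pow_succ]
    simp only [one_div_pow]
    field_simp
    ring
  · have hm' : (2 : ℝ) ^ i ≤ m := by exact_mod_cast not_lt.1 hm
    have : J ∩ Ioo (-Real.pi) Real.pi = ∅ := by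
      rw [eq_empty_iff_forall_notMem]
      rintro θ ⟨h2, h3⟩
      have h4 : 2 * Real.pi ≤ 2 * Real.pi * m / 2 ^ i := by
        rw [le_div_iff₀ (by positivity)]
        gcongr
      linarith [h2.1, h3.2]
    rw [this]
    simp

/-- The radial difference is at most 2^(-i-1), the angular one at most 2π·2^(-i) ≤ 6.5·2^(-i). -/
lemma norm_sub_le_of_cell_eq {z ζ : ℂ} (hz : z ∈ disc) (hζ : ζ ∈ disc) (h : cell z = cell ζ) :
    ‖z - ζ‖ ≤ 7 * (1 / 2) ^ lev z := by
  have hpi := Real.pi_pos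
  obtain ⟨h1, h2⟩ := Prod.mk.inj h
  have hz1 := lev_spec hz
  have hζ1 := lev_spec hζ
  rw [← h1] at h2 hζ1
  set i := lev z
  have hb : ∀ w : ℂ, (⌊2 ^ i * ((w.arg + Real.pi) / (2 * Real.pi))⌋₊ : ℝ) ≤ 2 ^ i * ((w.arg + Real.pi) / (2 * Real.pi)) ∧
      2 ^ i * ((w.arg + Real.pi) / (2 * Real.pi)) < ⌊2 ^ i * ((w.arg + Real.pi) / (2 * Real.pi))⌋₊ + 1 := by
    intro w
    have : 0 ≤ w.arg + Real.pi := by linarith [w.neg_pi_lt_arg]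
    exact ⟨Nat.floor_le (by positivity), Nat.lt_floor_add_one _⟩
  have h3 := hb z
  have h4 := hb ζ
  rw [h2] at h3
  have h5 : |z.arg - ζ.arg| ≤ 7 * (1 / 2) ^ i - (1 / 2) ^ (i + 1) := by
    have e : z.arg - ζ.arg = (2 ^ i * ((z.arg + Real.pi) / (2 * Real.pi)) -
      2 ^ i * ((ζ.arg + Real.pi) / (2 * Real.pi))) * (2 * Real.pi / 2 ^ i) := by field_simp; ring
    have h6 : |2 ^ i * ((z.arg + Real.pi) / (2 * Real.pi)) - 2 ^ i * ((ζ.arg + Real.pi) / (2 * Real.pi))| ≤ 1 := by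
      rw [abs_le]
      constructor <;> linarith [h3.1, h3.2, h4.1, h4.2]
    rw [e, abs_mul, abs_of_pos (by positivity : 0 < 2 * Real.pi / 2 ^ i)]
    refine (mul_le_of_le_one_left (by positivity) h6).trans ?_
    rw [pow_succ, one_div_pow]
    have hp : (0 : ℝ) < 2 ^ i := by positivity
    rw [show 7 * (1 / 2 ^ i) - 1 / 2 ^ i * (1 / 2 : ℝ) = 6.5 / 2 ^ i by ring]
    gcongr
    linarith [Real.pi_lt_d2]
  have h7 : ‖Complex.exp (z.arg * Complex.I) - Complex.exp (ζ.arg * Complex.I)‖ ≤ |z.arg - ζ.arg| := by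
    have e : Complex.exp (z.arg * Complex.I) - Complex.exp (ζ.arg * Complex.I) =
        Complex.exp (ζ.arg * Complex.I) * (Complex.exp (Complex.I * (z.arg - ζ.arg : ℝ)) - 1) := by
      rw [mul_sub, ← Complex.exp_add, mul_one]
      congr 2
      push_cast
      ring
    rw [e, norm_mul, Complex.norm_exp_ofReal_mul_I, one_mul]
    exact Real.norm_exp_I_mul_ofReal_sub_one_le
  have e : z - ζ = ((‖z‖ - ‖ζ‖ : ℝ) : ℂ) * Complex.exp (z.arg * Complex.I) +
      ‖ζ‖ * (Complex.exp (z.arg * Complex.I) - Complex.exp (ζ.arg * Complex.I)) := by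
    nth_rw 1 [← Complex.norm_mul_exp_arg_mul_I z, ← Complex.norm_mul_exp_arg_mul_I ζ]
    push_cast
    ring
  rw [e]
  refine (norm_add_le _ _).trans ?_
  rw [norm_mul, norm_mul, Complex.norm_exp_ofReal_mul_I, Complex.norm_real, Complex.norm_real, norm_norm, mul_one,
    Real.norm_eq_abs]
  have h8 : |‖z‖ - ‖ζ‖| ≤ (1 / 2) ^ (i + 1) := by
    rw [abs_le]
    rw [pow_succ] at hz1 hζ1 ⊢
    constructor <;> linarith [hz1.1, hz1.2, hζ1.1, hζ1.2]
  have h9 : ‖ζ‖ * ‖Complex.exp (z.arg * Complex.I) - Complex.exp (ζ.arg * Complex.I)‖ ≤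
      7 * (1 / 2) ^ i - (1 / 2) ^ (i + 1) :=
    (mul_le_of_le_one_left (norm_nonneg _) (mem_ball_zero_iff.1 hζ).le).trans (h7.trans h5)
  linarith

/-- Moving z within its rectangle changes 1 - z̄ζ by at most 7·2^(-i) < 14(1-‖z‖) ≤ 14‖1 - z̄ζ‖. The
distance grows by a factor below 15 < 2^4, so the aperture passes from 2 to 6. -/
lemma kern_le_of_cell_eq (A : ℕ → ℝ) {z z' ζ : ℂ} (hz : z ∈ disc) (hz' : z' ∈ disc) (h : cell z = cell z')
    (hζ : ζ ∈ disc) : kern A 2 z ζ ≤ kern A 6 z' ζ := by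
  unfold kern
  apply ENNReal.tsum_le_tsum
  intro j
  by_cases h1 : ‖1 - conj z * ζ‖ < 2 ^ 2 * (1 / 2) ^ j
  · rw [indicator_of_mem (show (z, ζ) ∈ {p : ℂ × ℂ | ‖1 - conj p.1 * p.2‖ < 2 ^ 2 * (1 / 2) ^ j} from h1),
      indicator_of_mem (show (z', ζ) ∈ {p : ℂ × ℂ | ‖1 - conj p.1 * p.2‖ < 2 ^ 6 * (1 / 2) ^ j} from ?_)]
    rw [mem_ofPred_eq]
    have h2 := norm_sub_le_of_cell_eq hz hz' h
    have h3 := (lev_spec hz).1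
    have h4 := one_sub_norm_le' (z := z) hζ
    have h5 : ‖1 - conj z' * ζ‖ ≤ ‖1 - conj z * ζ‖ + ‖z - z'‖ := by
      calc ‖1 - conj z' * ζ‖ = ‖(1 - conj z * ζ) + conj (z - z') * ζ‖ := by rw [map_sub]; congr 1; ring
        _ ≤ ‖1 - conj z * ζ‖ + ‖conj (z - z') * ζ‖ := norm_add_le _ _
        _ ≤ _ := by
          gcongr
          rw [norm_mul, RCLike.norm_conj]
          exact mul_le_of_le_one_right (norm_nonneg _) (mem_ball_zero_iff.1 hζ).le
    rw [pow_succ] at h3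
    change ‖1 - conj z' * ζ‖ < _
    have h6 : (0 : ℝ) < (1 / 2) ^ j := by positivity
    linarith
  · rw [indicator_of_notMem (show (z, ζ) ∉ {p : ℂ × ℂ | ‖1 - conj p.1 * p.2‖ < 2 ^ 2 * (1 / 2) ^ j} from h1)]
    exact bot_le

/-! ### Choice of signs and norms of the test functions. -/

/-- A deterministic substitute for averaging over random signs. When an index is added with sign t,
the value is X + tY because t^2 = 1 on the new diagonal entry. Since X is the mean of X + Y and X -
Y, one of the two has modulus at least that of X. -/
lemma exists_signs {ι : Type*} [DecidableEq ι] (F : Finset ι) (b : ι → ι → ℂ) (c : ℂ) :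
    ∃ σ : ι → ℝ, (∀ k, |σ k| = 1) ∧
      ‖c + ∑ k ∈ F, b k k‖ ≤ ‖c + ∑ k ∈ F, ∑ l ∈ F, (σ k * σ l : ℂ) * b k l‖ := by
  induction F using Finset.induction_on generalizing c with
  | empty => exact ⟨fun _ => 1, by simp, by simp⟩
  | insert a F ha ih =>
    obtain ⟨σ, hσ, h⟩ := ih (c + b a a)
    set X := c + b a a + ∑ k ∈ F, ∑ l ∈ F, (σ k * σ l : ℂ) * b k l
    set Y := ∑ l ∈ F, (σ l : ℂ) * (b a l + b l a)
    have key : ∀ t : ℝ, t * t = 1 → c + ∑ k ∈ insert a F, ∑ l ∈ insert a F,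
        ((Function.update σ a t k : ℝ) * (Function.update σ a t l : ℝ) : ℂ) * b k l = X + t * Y := by
      intro t ht
      have hne : ∀ l ∈ F, Function.update σ a t l = σ l := fun l hl =>
        Function.update_of_ne (fun h : l = a => ha (by rwa [h] at hl)) _ _
      have ht' : (t : ℂ) * t = 1 := by exact_mod_cast ht
      rw [Finset.sum_insert ha, Finset.sum_insert ha, Function.update_self, ht', one_mul]
      have e1 : ∑ l ∈ F, ((t : ℂ) * (Function.update σ a t l : ℝ)) * b a l = ∑ l ∈ F, (t * σ l : ℂ) * b a l :=
        Finset.sum_congr rfl fun l hl => by rw [hne l hl]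
      have e2 : ∑ k ∈ F, ∑ l ∈ insert a F, ((Function.update σ a t k : ℝ) * (Function.update σ a t l : ℝ) : ℂ) * b k l =
          ∑ k ∈ F, (σ k * t : ℂ) * b k a + ∑ k ∈ F, ∑ l ∈ F, (σ k * σ l : ℂ) * b k l := by
        rw [← Finset.sum_add_distrib]
        refine Finset.sum_congr rfl fun k hk => ?_
        rw [Finset.sum_insert ha, Function.update_self, hne k hk]
        congr 1
        exact Finset.sum_congr rfl fun l hl => by rw [hne l hl]
      rw [e1, e2]
      simp only [X, Y, Finset.mul_sum, mul_add, Finset.sum_add_distrib]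
      have e3 : ∀ l, (t * σ l : ℂ) * b a l = t * (σ l * b a l) := fun l => by ring
      have e4 : ∀ l, (σ l * t : ℂ) * b l a = t * (σ l * b l a) := fun l => by ring
      simp_rw [e3, e4]
      ring
    have hX : ‖X‖ ≤ ‖X + (1 : ℝ) * Y‖ ∨ ‖X‖ ≤ ‖X + (-1 : ℝ) * Y‖ := by
      by_contra! hcon
      have : ‖(X + (1 : ℝ) * Y) + (X + (-1 : ℝ) * Y)‖ < ‖X‖ + ‖X‖ :=
        (norm_add_le _ _).trans_lt (add_lt_add hcon.1 hcon.2)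
      rw [show (X + (1 : ℝ) * Y) + (X + (-1 : ℝ) * Y) = 2 * X by push_cast; ring, norm_mul] at this
      norm_num at this
      linarith
    have hins : c + ∑ k ∈ insert a F, b k k = c + b a a + ∑ k ∈ F, b k k := by
      rw [Finset.sum_insert ha]; ring
    have hupd : ∀ t : ℝ, |t| = 1 → ∀ k, |Function.update σ a t k| = 1 := by
      intro t ht k
      by_cases hk : k = a
      · rw [hk, Function.update_self, ht]
      · rw [Function.update_of_ne hk, hσ]
    rcases hX with hX | hX
    · refine ⟨Function.update σ a 1, hupd 1 (by simp), ?_⟩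
      rw [key 1 (by norm_num), hins]
      exact h.trans hX
    · refine ⟨Function.update σ a (-1), hupd (-1) (by simp), ?_⟩
      rw [key (-1) (by norm_num), hins]
      exact h.trans hX

/-- Norm estimate for sums of kernels attached to dyadic polar rectangles. -/
lemma exists_lintegral_sum_le {A o : ℕ → ℝ} {p : ℝ} (hp : 1 < p) (hA : ∀ l, 0 < A l) (hAg : GeoGrowth A)
    {D : ℝ} (hD0 : 0 ≤ D) (hD : ∀ l, A (l + 1) ≤ D * A l) (ho : ∀ l, 0 < o l) (hod : GeoDecay o) {B : ℝ}
    (hB0 : 0 ≤ B) (hAo : ∀ l i, A l * o l ≤ B * (A (l + i) * o (l + i)))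
    {ρ : Measure ℝ} [SFinite ρ] (hρ : HasProfile ρ o) {Γ : ℂ → ℂ → ℂ} {K : ℝ} (hK0 : 0 ≤ K)
    (hΓ : ∀ z ∈ disc, ∀ ζ ∈ disc, ‖Γ z ζ‖ₑ ≤ ENNReal.ofReal K * kern A 2 z ζ) :
    ∃ C : ℝ, 0 ≤ C ∧ ∀ (F : Finset (ℕ × ℕ)) (z : ℕ × ℕ → ℂ) (a : ℕ × ℕ → ℝ) (c : ℕ × ℕ → ℂ),
      (∀ k ∈ F, k.2 < 2 ^ k.1) → (∀ k ∈ F, z k ∈ cellSet k) → (∀ k, 0 ≤ a k) → (∀ k, ‖c k‖ ≤ a k) →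
      ∫⁻ ζ, ‖∑ k ∈ F, c k * Γ (z k) ζ‖ₑ ^ p ∂(polarMeasure ρ) ≤
        ENNReal.ofReal (C * ∑ k ∈ F, a k ^ p * ((2 ^ k.1) ^ (p - 1) * A k.1 ^ p * o k.1)) := by
  obtain ⟨C, hC0, hC⟩ := exists_schur (m := fun l => (1 / 2) ^ l) 6 hp hA hAg hD0 hD ho hod hB0 hAo
    (fun l => by positivity) hasProfile_volume hρ
  refine ⟨K ^ p * (C * 2 ^ (p - 1)), by positivity, fun F z a c hF hz ha hc => ?_⟩
  have hp0 : 0 < p := by linarith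
  set σ := polarMeasure (volume.restrict (Ioo (0 : ℝ) 1))
  have hσd : ∀ᵐ ζ ∂σ, ζ ∈ disc := ae_polarMeasure_mem_disc (ae_restrict_mem measurableSet_Ioo)
  -- The step function with value a_k divided by the area of the rectangle. The integral of the
  -- model kernel of larger aperture against it dominates the discrete sum, and Schur's test applies
  -- to this integral.
  set U : ℕ × ℕ → ℝ≥0∞ := fun k => if k ∈ F then ENNReal.ofReal (a k * 2 ^ (2 * k.1 + 1)) else 0
  have hU : Measurable U := Measurable.of_discrete
  have hum : Measurable fun ζ => U (cell ζ) := hU.comp measurable_cell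
  have hcellsum : ∀ (v : ℕ × ℕ → ℝ≥0∞), ∀ ζ ∈ disc, ∑ k ∈ F, (cellSet k).indicator (fun _ => v k) ζ =
      if cell ζ ∈ F then v (cell ζ) else 0 := by
    intro v ζ hζ
    rw [← Finset.sum_ite_eq]
    refine Finset.sum_congr rfl fun k _ => ?_
    by_cases h : cell ζ = k
    · rw [indicator_of_mem (show ζ ∈ cellSet k from ⟨hζ, h⟩), if_pos h]
    · rw [indicator_of_notMem (fun h' => h h'.2), if_neg h]
  have hσ : ∀ k ∈ F, σ (cellSet k) = ENNReal.ofReal ((1 / 2) ^ (2 * k.1 + 1)) := fun k hk => by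
    have := area_cellSet k.1 k.2
    rwa [if_pos (hF k hk)] at this
  have hpt : ∀ ζ ∈ disc, ‖∑ k ∈ F, c k * Γ (z k) ζ‖ₑ ≤
      ENNReal.ofReal K * ∫⁻ ζ', kern A 6 ζ ζ' * U (cell ζ') ∂σ := by
    intro ζ hζ
    have hkm := measurable_kern_right A 6 ζ
    calc ‖∑ k ∈ F, c k * Γ (z k) ζ‖ₑ
        ≤ ∑ k ∈ F, ENNReal.ofReal K * (ENNReal.ofReal (a k) * kern A 2 (z k) ζ) := by
          refine (enorm_sum_le _ _).trans (Finset.sum_le_sum fun k hk => ?_)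
          rw [enorm_mul, mul_left_comm]
          refine mul_le_mul' ?_ (hΓ _ (hz k hk).1 _ hζ)
          rw [← ofReal_norm]
          exact ENNReal.ofReal_le_ofReal (hc k)
      _ = ENNReal.ofReal K * ∑ k ∈ F, ENNReal.ofReal (a k) * kern A 2 (z k) ζ := by rw [Finset.mul_sum]
      _ ≤ ENNReal.ofReal K * ∑ k ∈ F, ∫⁻ ζ', kern A 6 ζ ζ' *
            (cellSet k).indicator (fun _ => ENNReal.ofReal (a k * 2 ^ (2 * k.1 + 1))) ζ' ∂σ := by
          gcongr with k hk
          calc ENNReal.ofReal (a k) * kern A 2 (z k) ζ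
              = ∫⁻ ζ', (cellSet k).indicator
                  (fun _ => kern A 2 (z k) ζ * ENNReal.ofReal (a k * 2 ^ (2 * k.1 + 1))) ζ' ∂σ := by
                rw [lintegral_indicator_const (measurableSet_cellSet k), hσ k hk, mul_assoc,
                  ← ENNReal.ofReal_mul (by have := ha k; positivity), mul_assoc (a k), ← mul_pow]
                norm_num
                rw [mul_comm]
            _ ≤ _ := by
                apply lintegral_mono
                intro ζ'
                by_cases h : ζ' ∈ cellSet k
                · simp only [indicator_of_mem h]
                  gcongr
                  rw [kern_comm A 6 ζ ζ']
                  exact kern_le_of_cell_eq A (hz k hk).1 h.1 ((hz k hk).2.trans h.2.symm) hζ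
                · simp only [indicator_of_notMem h]
                  exact bot_le
      _ ≤ _ := by
          gcongr
          have hmk : ∀ k ∈ F, Measurable fun ζ' => kern A 6 ζ ζ' *
              (cellSet k).indicator (fun _ => ENNReal.ofReal (a k * 2 ^ (2 * k.1 + 1))) ζ' :=
            fun k _ => hkm.mul (measurable_const.indicator (measurableSet_cellSet k))
          rw [← lintegral_finsetSum _ hmk]
          apply lintegral_mono_ae
          filter_upwards [hσd] with ζ' hζ'
          rw [← Finset.mul_sum, hcellsum (fun k => ENNReal.ofReal (a k * 2 ^ (2 * k.1 + 1))) ζ' hζ']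
  calc ∫⁻ ζ, ‖∑ k ∈ F, c k * Γ (z k) ζ‖ₑ ^ p ∂(polarMeasure ρ)
      ≤ ∫⁻ ζ, ENNReal.ofReal (K ^ p) * (∫⁻ ζ', kern A 6 ζ ζ' * U (cell ζ') ∂σ) ^ p ∂(polarMeasure ρ) := by
        apply lintegral_mono_ae
        filter_upwards [ae_polarMeasure_mem_disc hρ.ae_mem] with ζ hζ
        rw [← ENNReal.ofReal_rpow_of_nonneg hK0 hp0.le, ← ENNReal.mul_rpow_of_nonneg _ _ hp0.le]
        exact ENNReal.rpow_le_rpow (hpt ζ hζ) hp0.le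
    _ ≤ ENNReal.ofReal (K ^ p) * (ENNReal.ofReal C * ∫⁻ ζ, U (cell ζ) ^ p *
          ENNReal.ofReal (A (lev ζ) ^ p * o (lev ζ) * ((1 / 2) ^ lev ζ) ^ (p - 1)) ∂σ) := by
        rw [lintegral_const_mul' _ _ ENNReal.ofReal_ne_top]
        gcongr
        exact hC _ hum
    _ = ENNReal.ofReal (K ^ p) * (ENNReal.ofReal C * ∑ k ∈ F, ENNReal.ofReal (2 ^ (p - 1) *
          (a k ^ p * ((2 ^ k.1) ^ (p - 1) * A k.1 ^ p * o k.1)))) := by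
        congr 2
        set v : ℕ × ℕ → ℝ≥0∞ := fun k => ENNReal.ofReal (a k * 2 ^ (2 * k.1 + 1)) ^ p *
          ENNReal.ofReal (A k.1 ^ p * o k.1 * ((1 / 2) ^ k.1) ^ (p - 1))
        have e : ∀ᵐ ζ ∂σ, U (cell ζ) ^ p * ENNReal.ofReal (A (lev ζ) ^ p * o (lev ζ) * ((1 / 2) ^ lev ζ) ^ (p - 1)) =
            ∑ k ∈ F, (cellSet k).indicator (fun _ => v k) ζ := by
          filter_upwards [hσd] with ζ hζ
          rw [hcellsum v ζ hζ]
          simp only [U, v]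
          split_ifs
          · rfl
          · rw [ENNReal.zero_rpow_of_pos hp0, zero_mul]
        rw [lintegral_congr_ae e, lintegral_finsetSum _ fun k _ => measurable_const.indicator (measurableSet_cellSet k)]
        refine Finset.sum_congr rfl fun k hk => ?_
        rw [lintegral_indicator_const (measurableSet_cellSet k), hσ k hk]
        have h1 := hA k.1
        have h2 := ho k.1
        have h3 := ha k
        simp only [v]
        rw [ENNReal.ofReal_rpow_of_nonneg (by positivity) hp0.le, ← ENNReal.ofReal_mul (by positivity),
          ← ENNReal.ofReal_mul (by positivity)]
        congr 1
        have hb : (0 : ℝ) < 2 ^ k.1 := by positivity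
        have e2 : (2 : ℝ) ^ (2 * k.1 + 1) = 2 * (2 ^ k.1) * 2 ^ k.1 := by ring
        rw [one_div_pow, one_div_pow, e2, Real.mul_rpow h3 (by positivity), one_div, one_div, Real.inv_rpow hb.le,
          show (2 * 2 ^ k.1 * 2 ^ k.1 : ℝ) ^ p = (2 * 2 ^ k.1 * 2 ^ k.1) ^ (p - 1) * (2 * 2 ^ k.1 * 2 ^ k.1) by
            rw [Real.rpow_sub_one (by positivity)]; field_simp,
          Real.mul_rpow (by positivity) hb.le, Real.mul_rpow zero_le_two hb.le]
        have : (0 : ℝ) < (2 ^ k.1) ^ (p - 1) := by positivity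
        field_simp
    _ = _ := by
        rw [← ENNReal.ofReal_sum_of_nonneg fun k _ => by
            have h1 := hA k.1
            have h2 := ho k.1
            have h3 := ha k
            positivity, ← ENNReal.ofReal_mul hC0, ← ENNReal.ofReal_mul (by positivity), ← Finset.mul_sum]
        congr 1
        ring

lemma GeoDecay.const_mul {x : ℕ → ℝ} (h : GeoDecay x) {c : ℝ} (hc : 0 ≤ c) : GeoDecay fun l => c * x l := by
  obtain ⟨C, ρ, hC, hρ, hρ1, h⟩ := h
  refine ⟨C, ρ, hC, hρ, hρ1, fun l i => ?_⟩
  calc c * x (l + i) ≤ c * (C * ρ ^ i * x l) := mul_le_mul_of_nonneg_left (h l i) hc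
    _ = _ := by ring

/-- Test functions for the domain space. -/
def testPow (γ : ℕ) (w : ℂ) : ℂ := ((1 - w) ^ γ)⁻¹

/-- Test functions for the dual of the target space. -/
def testKer (ν : ℂ → ℝ) (γ n : ℕ) (w : ℂ) : ℂ := (1 - w) ^ γ * kerfun ν n w

lemma one_sub_ne_zero_of_mem_disc {w : ℂ} (hw : w ∈ disc) : 1 - w ≠ 0 := by
  rw [sub_ne_zero]
  rintro rfl
  simp at hw

lemma testPow_mul_testKer (ν : ℂ → ℝ) (γ n : ℕ) {w : ℂ} (hw : w ∈ disc) :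
    testPow γ w * testKer ν γ n w = kerfun ν n w :=
  inv_mul_cancel_left₀ (pow_ne_zero _ (one_sub_ne_zero_of_mem_disc hw)) _

lemma differentiableOn_testPow (γ : ℕ) : DifferentiableOn ℂ (testPow γ) disc :=
  DifferentiableOn.inv (by fun_prop) fun _ hw => pow_ne_zero _ (one_sub_ne_zero_of_mem_disc hw)

lemma differentiableOn_testKer {ν : ℂ → ℝ} (hν : IsDoublingWeight ν) (γ n : ℕ) :
    DifferentiableOn ℂ (testKer ν γ n) disc :=
  DifferentiableOn.mul (by fun_prop) (differentiableOn_kerfun hν n)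

/-- The size of the test functions `testPow γ` at level `l`. -/
def powProfile (p : ℝ) (ω : ℂ → ℝ) (γ l : ℕ) : ℝ := (2 ^ l) ^ (p - 1) * ((2 ^ l) ^ (γ - 1)) ^ p * dyTail ω l

/-- The size of the test functions `testKer ν γ n` at level `l`. -/
def kerProfile (q : ℝ) (ν : ℂ → ℝ) (γ n l : ℕ) : ℝ :=
  (2 ^ l) ^ (q - 1) * ((2 ^ l) ^ (n - γ) * (dyTail ν l)⁻¹) ^ q * dyTail ν l

lemma powProfile_pos (p : ℝ) {ω : ℂ → ℝ} (hω : IsDoublingWeight ω) (γ l : ℕ) : 0 < powProfile p ω γ l := by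
  have := dyTail_pos hω l
  unfold powProfile
  positivity

lemma kerProfile_pos (q : ℝ) {ν : ℂ → ℝ} (hν : IsDoublingWeight ν) (γ n l : ℕ) : 0 < kerProfile q ν γ n l := by
  have := dyTail_pos hν l
  unfold kerProfile
  positivity

/-- With γ = β + 2 the size is 2^j · 2^(j(β+1)), so A l = 2^(l(β+1)). This grows geometrically even
for β = 0, and A ω̂ is almost increasing because ω̂ loses at most 2^β per level up to a constant. -/
lemma exists_lintegral_sum_testPow_le {ω : ℂ → ℝ} (hω : IsDoublingWeight ω) {p : ℝ} (hp : 1 < p) :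
    ∃ γ : ℕ, 1 ≤ γ ∧ ∃ C : ℝ, 0 ≤ C ∧ ∀ (F : Finset (ℕ × ℕ)) (z : ℕ × ℕ → ℂ) (a : ℕ × ℕ → ℝ) (c : ℕ × ℕ → ℂ),
      (∀ k ∈ F, k.2 < 2 ^ k.1) → (∀ k ∈ F, z k ∈ cellSet k) → (∀ k, 0 ≤ a k) → (∀ k, ‖c k‖ ≤ a k) →
      ∫⁻ ζ, ‖∑ k ∈ F, c k * testPow γ (conj (z k) * ζ)‖ₑ ^ p ∂(weightMeasure ω) ≤
        ENNReal.ofReal (C * ∑ k ∈ F, a k ^ p * powProfile p ω γ k.1) := by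
  obtain ⟨D, β, hD1, hD⟩ := exists_dyTail_le hω
  have hpos := dyTail_pos hω
  obtain ⟨C, hC0, hC⟩ := exists_lintegral_sum_le (A := fun l => (2 ^ l) ^ (β + 1)) (o := fun l => 2 * dyTail ω l) hp
    (fun l => by positivity)
    (by
      refine ⟨1, 1 / 2, zero_le_one, by norm_num, by norm_num, fun l i => ?_⟩
      have e : (1 / 2 : ℝ) ^ i * (2 ^ (l + i)) ^ (β + 1) = (2 ^ l) ^ (β + 1) * (2 ^ i) ^ β := by
        rw [one_div_pow, pow_add 2 l i, mul_pow, pow_succ (2 ^ i : ℝ) β]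
        field_simp
      rw [one_mul, e]
      exact le_mul_of_one_le_right (by positivity) (one_le_pow₀ (one_le_pow₀ one_le_two)))
    (D := 2 ^ (β + 1)) (by positivity) (fun l => by rw [pow_succ 2 l, mul_pow, mul_comm])
    (fun l => by have := hpos l; positivity) ((geoDecay_dyTail hω).const_mul zero_le_two) (B := D) (by linarith)
    (fun l i => by
      have h1 := hpos (l + i)
      have e : ((2 : ℝ) ^ (l + i)) ^ (β + 1) = (2 ^ l) ^ (β + 1) * 2 ^ (i * β) * 2 ^ i := by
        rw [pow_add 2 l i, mul_pow, pow_succ (2 ^ i : ℝ) β, ← pow_mul 2 i β, mul_assoc]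
      calc ((2 : ℝ) ^ l) ^ (β + 1) * (2 * dyTail ω l)
          ≤ (2 ^ l) ^ (β + 1) * (2 * (D * 2 ^ (i * β) * dyTail ω (l + i))) := by gcongr; exact hD l i
        _ = (D * ((2 ^ l) ^ (β + 1) * 2 ^ (i * β) * (2 * dyTail ω (l + i)))) * 1 := by ring
        _ ≤ (D * ((2 ^ l) ^ (β + 1) * 2 ^ (i * β) * (2 * dyTail ω (l + i)))) * 2 ^ i := by
            gcongr
            exact one_le_pow₀ one_le_two
        _ = _ := by rw [e]; ring)
    (hasProfile_radialPart hω) (Γ := fun z ζ => testPow (β + 2) (conj z * ζ)) zero_le_one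
    (fun z hz ζ hζ => enorm_comp_le_kern (G := testPow (β + 2)) zero_le_one (fun w _ j hj _ => by
      have h1 : (0 : ℝ) < (1 / 2) ^ j := by positivity
      rw [testPow, norm_inv, norm_pow, one_mul]
      calc (‖1 - w‖ ^ (β + 2))⁻¹ ≤ (((1 / 2 : ℝ) ^ j) ^ (β + 2))⁻¹ := by gcongr
        _ = 2 ^ j * (2 ^ j) ^ (β + 1) := by
          rw [one_div_pow, one_div, inv_pow, inv_inv]; ring) hz hζ)
  refine ⟨β + 2, by omega, C * 2, by positivity, fun F z a c h1 h2 h3 h4 => ?_⟩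
  rw [weightMeasure_eq_polarMeasure hω.toIsRadialWeight]
  refine (hC F z a c h1 h2 h3 h4).trans (le_of_eq ?_)
  congr 1
  rw [mul_assoc C, Finset.mul_sum _ _ 2]
  congr 1
  refine Finset.sum_congr rfl fun k _ => ?_
  rw [powProfile, show β + 2 - 1 = β + 1 by omega]
  ring

/-- The factor (1-w)^γ lowers the size to 2^j · 2^(j(n-γ)) / ν̂. For n ≥ γ the sequence A l =
2^(l(n-γ)) / ν̂ grows geometrically by the decay of ν̂, and A ν̂ increases. -/
lemma exists_lintegral_sum_testKer_le {ν : ℂ → ℝ} (hν : IsDoublingWeight ν) {q : ℝ} (hq : 1 < q) {γ n : ℕ}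
    (hγ : γ ≤ n) : ∃ C : ℝ, 0 ≤ C ∧ ∀ (F : Finset (ℕ × ℕ)) (z : ℕ × ℕ → ℂ) (a : ℕ × ℕ → ℝ) (c : ℕ × ℕ → ℂ),
      (∀ k ∈ F, k.2 < 2 ^ k.1) → (∀ k ∈ F, z k ∈ cellSet k) → (∀ k, 0 ≤ a k) → (∀ k, ‖c k‖ ≤ a k) →
      ∫⁻ ζ, ‖∑ k ∈ F, c k * (ζ ^ n * testKer ν γ n (conj (z k) * ζ))‖ₑ ^ q ∂(weightMeasure ν) ≤
        ENNReal.ofReal (C * ∑ k ∈ F, a k ^ q * kerProfile q ν γ n k.1) := by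
  obtain ⟨D, β, hD1, hD⟩ := exists_dyTail_le hν
  have hpos := dyTail_pos hν
  obtain ⟨K, hK0, hK⟩ := exists_norm_kernel_le hν n
  obtain ⟨m, rfl⟩ := Nat.exists_eq_add_of_le hγ
  obtain ⟨C₁, ρ, hC₁, hρ, hρ1, hinv⟩ := (geoDecay_dyTail hν).inv hpos
  have hmono : ∀ l i : ℕ, ((2 : ℝ) ^ l) ^ m ≤ (2 ^ (l + i)) ^ m := fun l i =>
    pow_le_pow_left₀ (by positivity) (pow_le_pow_right₀ one_le_two (Nat.le_add_right _ _)) _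
  obtain ⟨C, hC0, hC⟩ := exists_lintegral_sum_le (A := fun l => (2 ^ l) ^ m * (dyTail ν l)⁻¹)
    (o := fun l => 2 * dyTail ν l) hq
    (fun l => by have := hpos l; positivity)
    (by
      refine ⟨C₁, ρ, hC₁, hρ, hρ1, fun l i => ?_⟩
      have h1 := hpos l
      calc ((2 : ℝ) ^ l) ^ m * (dyTail ν l)⁻¹ ≤ (2 ^ (l + i)) ^ m * (C₁ * ρ ^ i * (dyTail ν (l + i))⁻¹) := by
            exact mul_le_mul (hmono l i) (hinv l i) (by positivity) (by positivity)
        _ = _ := by ring)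
    (D := 2 ^ m * (D * 2 ^ β)) (by positivity)
    (fun l => by
      have h1 := hpos l
      have h2 := hpos (l + 1)
      have h3 := hD l 1
      rw [one_mul] at h3
      have h4 : (dyTail ν (l + 1))⁻¹ ≤ D * 2 ^ β * (dyTail ν l)⁻¹ := by
        rw [← div_eq_mul_inv, le_div_iff₀ h1, inv_mul_le_iff₀ h2, mul_comm]
        exact h3
      calc ((2 : ℝ) ^ (l + 1)) ^ m * (dyTail ν (l + 1))⁻¹ ≤ (2 ^ (l + 1)) ^ m * (D * 2 ^ β * (dyTail ν l)⁻¹) := by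
            gcongr
        _ = _ := by rw [pow_succ 2 l, mul_pow]; ring)
    (fun l => by have := hpos l; positivity) ((geoDecay_dyTail hν).const_mul zero_le_two) (B := 1) zero_le_one
    (fun l i => by
      have h1 := hpos l
      have h2 := hpos (l + i)
      have := hmono l i
      field_simp
      linarith)
    (hasProfile_radialPart hν) (Γ := fun z ζ => ζ ^ (γ + m) * testKer ν γ (γ + m) (conj z * ζ)) (K := 2 ^ γ * K)
    (by positivity)
    (fun z hz ζ hζ => by
      have hζ1 : ‖ζ ^ (γ + m)‖ₑ ≤ 1 := by
        rw [← ofReal_norm, ENNReal.ofReal_le_one, norm_pow]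
        exact pow_le_one₀ (norm_nonneg _) (mem_ball_zero_iff.1 hζ).le
      rw [enorm_mul]
      refine (mul_le_of_le_one_left bot_le hζ1).trans
        (enorm_comp_le_kern (G := testKer ν γ (γ + m)) (by positivity) (fun w hw j hj hj2 => ?_) hz hζ)
      rw [testKer, norm_mul, norm_pow]
      have h1 : (0 : ℝ) < 2 ^ j := by positivity
      have h2 := hpos j
      calc ‖1 - w‖ ^ γ * ‖kerfun ν (γ + m) w‖
          ≤ (2 * (1 / 2) ^ j) ^ γ * (K * (2 ^ (j * (γ + m + 1)) / dyTail ν j)) := by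
            gcongr
            exact hK w hw j hj
        _ = _ := by
            rw [mul_pow, one_div_pow, one_div, inv_pow, pow_mul, pow_succ (2 ^ j : ℝ), pow_add]
            field_simp)
  refine ⟨C * 2, by positivity, fun F z a c h1 h2 h3 h4 => ?_⟩
  rw [weightMeasure_eq_polarMeasure hν.toIsRadialWeight]
  refine (hC F z a c h1 h2 h3 h4).trans (le_of_eq ?_)
  congr 1
  rw [mul_assoc C, Finset.mul_sum _ _ 2]
  congr 1
  refine Finset.sum_congr rfl fun k _ => ?_
  rw [kerProfile, show γ + m - γ = m by omega]
  ring

/-! ### The lower bound for the operator norm. -/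

lemma exists_unimodular (x : ℂ) : ∃ u : ℂ, ‖u‖ ≤ 1 ∧ u * x = ‖x‖ := by
  refine ⟨conj x / ‖x‖, ?_, ?_⟩
  · rw [norm_div, RCLike.norm_conj, Complex.norm_real, norm_norm]
    exact div_self_le_one _
  · rw [div_mul_eq_mul_div, mul_comm, Complex.mul_conj, Complex.normSq_eq_norm_sq]
    by_cases h : (‖x‖ : ℂ) = 0
    · simp [h]
    · push_cast; field_simp

lemma enorm_integral_mul_conj_le {μ : Measure ℂ} {p q : ℝ} (h : p.HolderConjugate q) {f g : ℂ → ℂ}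
    (hf : AEStronglyMeasurable f μ) (hg : AEStronglyMeasurable g μ) :
    ‖∫ z, f z * conj (g z) ∂μ‖ₑ ≤ (∫⁻ z, ‖f z‖ₑ ^ p ∂μ) ^ (1 / p) * (∫⁻ z, ‖g z‖ₑ ^ q ∂μ) ^ (1 / q) := by
  refine (enorm_integral_le_lintegral_enorm _).trans ?_
  simp_rw [enorm_mul, RCLike.enorm_conj]
  exact ENNReal.lintegral_mul_le_Lp_mul_Lq μ h hf.enorm hg.enorm

/-- The bilinear estimate behind the lower bound for the norm of the small Hankel operator. -/
lemma enorm_sum_mul_norm_iteratedDeriv_le {p q q' : ℝ} (hq : 1 < q) (hqq : q.HolderConjugate q') {ω ν : ℂ → ℝ}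
    (hω : IsDoublingWeight ω) (hν : IsDoublingWeight ν) (hp : 1 < p) (γ n : ℕ) {f : ℂ → ℂ}
    (hf : DifferentiableOn ℂ f disc)
    (hfi : Integrable f (weightMeasure ν)) {A : ℝ≥0} (hA : IsSmallHankelBound p q ω ν f A)
    (F : Finset (ℕ × ℕ)) (z : ℕ × ℕ → ℂ) (hz : ∀ k ∈ F, z k ∈ disc) (a b : ℕ × ℕ → ℝ)
    (ha : ∀ k, 0 ≤ a k) (hb : ∀ k, 0 ≤ b k) :
    ∃ c d : ℕ × ℕ → ℂ, (∀ k, ‖c k‖ ≤ a k) ∧ (∀ k, ‖d k‖ ≤ b k) ∧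
      ENNReal.ofReal (∑ k ∈ F, a k * b k * ‖iteratedDeriv n f (z k)‖) ≤
        A * (∫⁻ ζ, ‖∑ k ∈ F, c k * testPow γ (conj (z k) * ζ)‖ₑ ^ p ∂(weightMeasure ω)) ^ (1 / p) *
          (∫⁻ ζ, ‖∑ k ∈ F, d k * (ζ ^ n * testKer ν γ n (conj (z k) * ζ))‖ₑ ^ q' ∂(weightMeasure ν)) ^ (1 / q') := by
  obtain ⟨T, hT, hTA⟩ := hA
  have hae := ae_weightMeasure_mem_disc hν.toIsRadialWeight
  choose u hu1 hu2 using fun k => exists_unimodular (iteratedDeriv n f (z k))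
  have hPd := differentiableOn_testPow γ
  have hKd := differentiableOn_testKer hν γ n
  -- The matrix of pairings of the two families. On the diagonal the test functions multiply to the
  -- differentiated kernel, which reproduces the derivative; u l makes the entry nonnegative.
  set B : ℕ × ℕ → ℕ × ℕ → ℂ := fun k l => a k * b l * u l *
    ∫ ζ, f ζ * conj (testPow γ (conj (z k) * ζ)) * conj (ζ ^ n * testKer ν γ n (conj (z l) * ζ)) ∂(weightMeasure ν)
  have hBkk : ∀ k ∈ F, B k k = (a k * b k * ‖iteratedDeriv n f (z k)‖ : ℝ) := by
    intro k hk
    have e : ∫ ζ, f ζ * conj (testPow γ (conj (z k) * ζ)) * conj (ζ ^ n * testKer ν γ n (conj (z k) * ζ))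
        ∂(weightMeasure ν) = iteratedDeriv n f (z k) := by
      rw [← integral_mul_conj_pow_mul_kerfun hν hf hfi n (hz k hk)]
      apply integral_congr_ae
      filter_upwards [hae] with ζ hζ
      rw [← testPow_mul_testKer ν γ n (conj_mul_mem_disc (hz k hk) hζ)]
      simp only [map_mul]
      ring
    simp only [B]
    rw [e, mul_assoc, hu2]
    push_cast
    ring
  -- The same signs are put on both families, so the full pairing dominates the trace.
  obtain ⟨σ, hσ, hσB⟩ := exists_signs F B 0
  have hcbd : ∀ k, ‖(σ k * a k : ℂ)‖ ≤ a k := fun k => by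
    rw [norm_mul, Complex.norm_real, Complex.norm_real, Real.norm_eq_abs, hσ, one_mul, Real.norm_eq_abs, abs_of_nonneg (ha k)]
  have hdbd : ∀ k, ‖(σ k * b k * conj (u k) : ℂ)‖ ≤ b k := fun k => by
    rw [norm_mul, norm_mul, Complex.norm_real, Complex.norm_real, Real.norm_eq_abs, hσ, one_mul, Real.norm_eq_abs,
      abs_of_nonneg (hb k), RCLike.norm_conj]
    exact mul_le_of_le_one_right (hb k) (hu1 k)
  refine ⟨fun k => σ k * a k, fun k => σ k * b k * conj (u k), hcbd, hdbd, ?_⟩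
  set G : ℂ → ℂ := fun ζ => ∑ k ∈ F, (σ k * a k : ℂ) * testPow γ (conj (z k) * ζ)
  set h : ℕ × ℕ → ℂ → ℂ := fun l ζ => ζ ^ n * testKer ν γ n (conj (z l) * ζ) with hh
  have hGd : DifferentiableOn ℂ G disc := by
    apply DifferentiableOn.fun_sum
    intro k hk
    exact (differentiableOn_comp_conj_mul hPd (hz k hk)).const_mul _
  have hbdP : ∀ k : ℕ × ℕ, ∃ M, k ∈ F → ∀ ζ ∈ disc, ‖testPow γ (conj (z k) * ζ)‖ ≤ M := by
    intro k
    by_cases hk : k ∈ F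
    · obtain ⟨M, -, hM⟩ := exists_norm_comp_conj_mul_le (fun w hw => hasSum_coef hPd hw) (hz k hk)
      exact ⟨M, fun _ => hM⟩
    · exact ⟨0, fun h => absurd h hk⟩
  choose M hM using hbdP
  have hbdK : ∀ k ∈ F, ∃ M, ∀ ζ ∈ disc, ‖h k ζ‖ ≤ M := by
    intro k hk
    obtain ⟨M, hM0, hM⟩ := exists_norm_comp_conj_mul_le (fun w hw => hasSum_coef hKd hw) (hz k hk)
    refine ⟨M, fun ζ hζ => ?_⟩
    rw [hh, norm_mul, norm_pow]
    exact (mul_le_of_le_one_left (norm_nonneg _) (pow_le_one₀ (norm_nonneg _) (mem_ball_zero_iff.1 hζ).le)).trans (hM ζ hζ)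
  have hhc : ∀ k ∈ F, ContinuousOn (h k) disc := fun k hk =>
    (continuousOn_id.pow n).mul (differentiableOn_comp_conj_mul hKd (hz k hk)).continuousOn
  have hGb : ∀ ζ ∈ disc, ‖G ζ‖ ≤ ∑ k ∈ F, a k * M k := by
    intro ζ hζ
    refine (norm_sum_le _ _).trans (Finset.sum_le_sum fun k hk => ?_)
    rw [norm_mul]
    exact mul_le_mul (hcbd k) (hM k hk ζ hζ) (norm_nonneg _) (ha k)
  have hGmem : G ∈ bergmanSpace p ω := ⟨hGd, memLp_of_bounded hω.toIsRadialWeight hGd.continuousOn hGb _⟩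
  set TG : ℂ → ℂ := ((T ⟨G, hGmem⟩ : bergmanSpace q ν) : ℂ → ℂ)
  have hTG := (T ⟨G, hGmem⟩).2
  have := isFiniteMeasure_weightMeasure hν.toIsRadialWeight
  have hTGi : Integrable TG (weightMeasure ν) := hTG.2.integrable (by rw [ENNReal.one_le_ofReal]; exact hq.le)
  have hTGe : EqOn TG (smallHankel ν f G) disc := hT ⟨G, hGmem⟩ ⟨_, hGb⟩
  set H : ℂ → ℂ := fun ζ => ∑ k ∈ F, (σ k * b k * conj (u k) : ℂ) * h k ζ
  have hHc : ContinuousOn H disc := by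
    apply continuousOn_finsetSum
    intro k hk
    exact continuousOn_const.mul (hhc k hk)
  have hpair : ∫ ζ, TG ζ * conj (H ζ) ∂(weightMeasure ν) = ∑ k ∈ F, ∑ l ∈ F, (σ k * σ l : ℂ) * B k l := by
    have e1 : ∀ ζ, TG ζ * conj (H ζ) = ∑ l ∈ F, (σ l * b l * u l : ℂ) * (TG ζ * conj (h l ζ)) := by
      intro ζ
      simp only [H, map_sum, Finset.mul_sum, map_mul, Complex.conj_conj, Complex.conj_ofReal]
      refine Finset.sum_congr rfl fun l _ => ?_
      ring
    have e2 : ∀ ζ, ∀ l, f ζ * conj (G ζ) * conj (h l ζ) =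
        ∑ k ∈ F, (σ k * a k : ℂ) * (f ζ * conj (testPow γ (conj (z k) * ζ)) * conj (h l ζ)) := by
      intro ζ l
      simp only [G, map_sum, Finset.mul_sum, Finset.sum_mul, map_mul, Complex.conj_ofReal]
      refine Finset.sum_congr rfl fun l _ => ?_
      ring
    simp_rw [e1]
    rw [integral_finsetSum, Finset.sum_comm]
    · refine Finset.sum_congr rfl fun l hl => ?_
      rw [integral_const_mul, integral_mul_conj_pow_mul_comp_of_eqOn hν hfi hGd.continuousOn hGb hTG.1 hTGi hTGe hKd (hz l hl) n]
      have e3 : ∫ ζ, f ζ * conj (G ζ) * conj (ζ ^ n * testKer ν γ n (conj (z l) * ζ)) ∂(weightMeasure ν) =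
          ∑ k ∈ F, (σ k * a k : ℂ) * ∫ ζ, f ζ * conj (testPow γ (conj (z k) * ζ)) * conj (h l ζ) ∂(weightMeasure ν) := by
        refine (integral_congr_ae (Filter.Eventually.of_forall fun ζ => e2 ζ l)).trans ?_
        rw [integral_finsetSum]
        · simp_rw [integral_const_mul]
        · intro k hk
          obtain ⟨M', hM'⟩ := hbdK l hl
          exact (integrable_mul_conj hae (integrable_mul_conj hae hfi
            (differentiableOn_comp_conj_mul hPd (hz k hk)).continuousOn (hM k hk)) (hhc l hl) hM').const_mul _
      rw [e3, Finset.mul_sum]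
      refine Finset.sum_congr rfl fun k _ => ?_
      simp only [B, hh]
      ring
    · intro l hl
      obtain ⟨M', hM'⟩ := hbdK l hl
      exact (integrable_mul_conj hae hTGi (hhc l hl) hM').const_mul _
  have hsum0 : 0 ≤ ∑ k ∈ F, a k * b k * ‖iteratedDeriv n f (z k)‖ :=
    Finset.sum_nonneg fun k _ => mul_nonneg (mul_nonneg (ha k) (hb k)) (norm_nonneg _)
  have hq0 : 0 < q := by linarith
  calc ENNReal.ofReal (∑ k ∈ F, a k * b k * ‖iteratedDeriv n f (z k)‖)
      ≤ ENNReal.ofReal ‖∫ ζ, TG ζ * conj (H ζ) ∂(weightMeasure ν)‖ := by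
        apply ENNReal.ofReal_le_ofReal
        rw [hpair]
        rw [zero_add, zero_add, Finset.sum_congr rfl hBkk, ← Complex.ofReal_sum, Complex.norm_real, Real.norm_eq_abs,
          abs_of_nonneg hsum0] at hσB
        exact hσB
    _ ≤ (∫⁻ ζ, ‖TG ζ‖ₑ ^ q ∂(weightMeasure ν)) ^ (1 / q) * (∫⁻ ζ, ‖H ζ‖ₑ ^ q' ∂(weightMeasure ν)) ^ (1 / q') := by
        rw [ofReal_norm]
        exact enorm_integral_mul_conj_le hqq hTGi.1 (aestronglyMeasurable_of_continuousOn hae hHc)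
    _ ≤ _ := by
        gcongr
        rw [← weightedNorm_eq hq0, ← weightedNorm_eq (by linarith)]
        exact hTA ⟨G, hGmem⟩

/-- Here L = 2^l, o and d are the tails of ω and ν, and g = γ - 1, m = n - γ. In exponential form it
is an identity between exponents; the parameter γ drops out. -/
lemma profile_rpow_eq {p q q' L o d : ℝ} (hq : 1 < q) (hqp : q < p) (hqq : q' = q / (q - 1)) (hL : 0 < L) (ho : 0 < o)
    (hd : 0 < d) (g m : ℕ) :
    ((L ^ (p - 1) * (L ^ g) ^ p * o) ^ (1 / p) * (L ^ (q' - 1) * (L ^ m * d⁻¹) ^ q' * d) ^ (1 / q')) ^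
        (-(p * q / (p - q))) =
      (L⁻¹) ^ ((g + 1 + m : ℕ) * (p * q / (p - q)) - 1) * d ^ (p / (p - q)) * o ^ (-(q / (p - q))) * (L⁻¹) ^ (2 : ℝ) := by
  obtain ⟨a, rfl⟩ : ∃ a, L = Real.exp a := ⟨_, (Real.exp_log hL).symm⟩
  obtain ⟨b, rfl⟩ : ∃ a, o = Real.exp a := ⟨_, (Real.exp_log ho).symm⟩
  obtain ⟨c, rfl⟩ : ∃ a, d = Real.exp a := ⟨_, (Real.exp_log hd).symm⟩
  have h1 : p ≠ 0 := by linarith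
  have h2 : q ≠ 0 := by linarith
  have h3 : p - q ≠ 0 := by linarith
  have h4 : q - 1 ≠ 0 := by linarith
  subst hqq
  simp only [← Real.exp_neg, ← Real.exp_mul, ← Real.exp_add, ← Real.rpow_natCast]
  congr 1
  push_cast
  field_simp
  ring

/-- The rescaled weight of the symbol integral at dyadic radii, in terms of the sizes of the test functions. -/
lemma profile_mul_rpow_eq {p q q' : ℝ} (hq : 1 < q) (hqp : q < p) (hqq : q' = q / (q - 1)) {ω ν : ℂ → ℝ}
    (hω : IsDoublingWeight ω) (hν : IsDoublingWeight ν) {γ n : ℕ} (hγ : 1 ≤ γ) (hγn : γ ≤ n) (i : ℕ) :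
    (powProfile p ω γ i ^ (1 / p) * kerProfile q' ν γ n i ^ (1 / q')) ^ (-(p * q / (p - q))) =
      symWeight p q ω ν n (1 - (1 / 2) ^ i) * (1 / 2) ^ (2 * i) := by
  obtain ⟨g, rfl⟩ : ∃ g, γ = g + 1 := ⟨γ - 1, by omega⟩
  obtain ⟨m, rfl⟩ := Nat.exists_eq_add_of_le hγn
  have := profile_rpow_eq hq hqp hqq (L := 2 ^ i) (by positivity) (dyTail_pos hω i) (dyTail_pos hν i) g m
  rw [powProfile, kerProfile, Nat.add_sub_cancel, Nat.add_sub_cancel_left, this, symWeight, sub_sub_cancel, ← dyTail,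
    ← dyTail, ← inv_pow, ← one_div, Real.rpow_two, ← pow_mul, mul_comm i]

/-- Absorption, legitimate because S is a real number. This is why the sums are first taken over
finite families. -/
lemma le_rpow_of_le_mul_rpow {S K s : ℝ} (hS : 0 ≤ S) (hK : 0 ≤ K) (hs : 0 < s) (h : S ≤ K * S ^ (1 - 1 / s)) :
    S ≤ K ^ s := by
  rcases hS.eq_or_lt with rfl | hS
  · positivity
  · rw [Real.rpow_sub hS, Real.rpow_one, mul_div_assoc', le_div_iff₀ (by positivity), mul_comm, mul_le_mul_iff_left₀ hS] at h
    calc S = (S ^ (1 / s)) ^ s := by rw [← Real.rpow_mul hS.le, one_div_mul_cancel hs.ne', Real.rpow_one]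
      _ ≤ K ^ s := by gcongr

/-- The lower bound for the norm of the small Hankel operator in discrete form. -/
lemma exists_sum_rpow_le {p q : ℝ} (hq : 1 < q) (hqp : q < p) {ω ν : ℂ → ℝ} (hω : IsDoublingWeight ω)
    (hν : IsDoublingWeight ν) : ∃ N : ℕ, ∀ n : ℕ, N ≤ n → ∃ K : ℝ≥0, ∀ f : ℂ → ℂ, DifferentiableOn ℂ f disc →
      Integrable f (weightMeasure ν) → ∀ A : ℝ≥0, IsSmallHankelBound p q ω ν f A →
      ∀ (F : Finset (ℕ × ℕ)) (z : ℕ × ℕ → ℂ), (∀ k ∈ F, k.2 < 2 ^ k.1) → (∀ k ∈ F, z k ∈ cellSet k) →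
        ∑ k ∈ F, ‖iteratedDeriv n f (z k)‖ ^ (p * q / (p - q)) *
          (symWeight p q ω ν n (1 - (1 / 2) ^ k.1) * (1 / 2) ^ (2 * k.1)) ≤ (K * A : ℝ) ^ (p * q / (p - q)) := by
  have hp : 1 < p := by linarith
  have hp0 : 0 < p := by linarith
  have hq0 : 0 < q := by linarith
  have hpq : 0 < p - q := by linarith
  have hqq : q.HolderConjugate (q / (q - 1)) := Real.HolderConjugate.conjExponent hq
  obtain ⟨γ, hγ, C₁, hC₁, h₁⟩ := exists_lintegral_sum_testPow_le hω hp
  refine ⟨γ, fun n hn => ?_⟩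
  obtain ⟨C₂, hC₂, h₂⟩ := exists_lintegral_sum_testKer_le hν hqq.symm.lt hn
  set q' := q / (q - 1) with hq'
  have hq'0 : 0 < q' := hqq.symm.pos
  set s := p * q / (p - q)
  have hs : 0 < s := by positivity
  have hexp : 1 / p + 1 / q' = 1 - 1 / s := by
    have : q - 1 ≠ 0 := by linarith
    simp only [hq', s]
    field_simp
    ring
  refine ⟨(C₁ ^ (1 / p) * C₂ ^ (1 / q')).toNNReal, fun f hf hfi A hA F z hF hz => ?_⟩
  have hX := fun i => powProfile_pos p hω γ i
  have hY := fun i => kerProfile_pos q' hν γ n i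
  set X := powProfile p ω γ
  set Y := kerProfile q' ν γ n
  set t : ℕ × ℕ → ℝ := fun k => ‖iteratedDeriv n f (z k)‖
  have ht : ∀ k, 0 ≤ t k := fun k => norm_nonneg _
  -- The k-th term of the sum to be bounded, written with the test function profiles X and Y.
  set τ : ℕ × ℕ → ℝ := fun k => t k ^ s * (X k.1 ^ (1 / p) * Y k.1 ^ (1 / q')) ^ (-s)
  have hτ0 : ∀ k, 0 ≤ τ k := fun k => by
    have := ht k
    have := hX k.1
    have := hY k.1
    positivity
  have hτ : ∀ k, ‖iteratedDeriv n f (z k)‖ ^ s *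
          (symWeight p q ω ν n (1 - (1 / 2) ^ k.1) * (1 / 2) ^ (2 * k.1)) = τ k := fun k => by
    rw [← profile_mul_rpow_eq hq hqp hq' hω hν hγ hn k.1]
  rw [Finset.sum_congr rfl fun k _ => hτ k]
  set S := ∑ k ∈ F, τ k
  have hS0 : 0 ≤ S := Finset.sum_nonneg fun k _ => hτ0 k
  -- The equality case of the discrete Hölder inequality: a^p X = b^q' Y = τ, and then also a b t =
  -- τ because 1/p + 1/q' = 1 - 1/s. All three sums in the bilinear estimate become multiples of S.
  set a : ℕ × ℕ → ℝ := fun k => (τ k / X k.1) ^ (1 / p)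
  set b : ℕ × ℕ → ℝ := fun k => (τ k / Y k.1) ^ (1 / q')
  have ha : ∀ k, 0 ≤ a k := fun k => Real.rpow_nonneg (div_nonneg (hτ0 k) (hX _).le) _
  have hb : ∀ k, 0 ≤ b k := fun k => Real.rpow_nonneg (div_nonneg (hτ0 k) (hY _).le) _
  have haX : ∀ k, a k ^ p * X k.1 = τ k := fun k => by
    rw [← Real.rpow_mul (div_nonneg (hτ0 k) (hX _).le), one_div_mul_cancel hp0.ne', Real.rpow_one,
      div_mul_cancel₀ _ (hX _).ne']
  have hbY : ∀ k, b k ^ q' * Y k.1 = τ k := fun k => by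
    rw [← Real.rpow_mul (div_nonneg (hτ0 k) (hY _).le), one_div_mul_cancel hq'0.ne', Real.rpow_one,
      div_mul_cancel₀ _ (hY _).ne']
  have habt : ∀ k, a k * b k * t k = τ k := fun k => by
    have hXY : 0 < X k.1 ^ (1 / p) * Y k.1 ^ (1 / q') := mul_pos (Real.rpow_pos_of_pos (hX _) _) (Real.rpow_pos_of_pos (hY _) _)
    rcases (ht k).eq_or_lt with h0 | h0
    · simp only [τ]
      rw [← h0, Real.zero_rpow hs.ne', mul_zero, zero_mul]
    · have hτp : 0 < τ k := mul_pos (Real.rpow_pos_of_pos h0 _) (Real.rpow_pos_of_pos hXY _)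
      have e1 : τ k ^ (1 / s) = t k * (X k.1 ^ (1 / p) * Y k.1 ^ (1 / q'))⁻¹ := by
        simp only [τ]
        rw [Real.mul_rpow (by positivity) (by positivity), ← Real.rpow_mul h0.le, ← Real.rpow_mul hXY.le,
          mul_one_div_cancel hs.ne', neg_mul, mul_one_div_cancel hs.ne', Real.rpow_one, Real.rpow_neg_one]
      calc a k * b k * t k = τ k ^ (1 / p + 1 / q') * (t k * (X k.1 ^ (1 / p) * Y k.1 ^ (1 / q'))⁻¹) := by
            simp only [a, b]
            rw [Real.div_rpow (hτ0 k) (hX _).le, Real.div_rpow (hτ0 k) (hY _).le, Real.rpow_add hτp]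
            field_simp
        _ = τ k := by
            rw [← e1, ← Real.rpow_add hτp, hexp, sub_add_cancel, Real.rpow_one]
  obtain ⟨c, d, hc, hd, hcd⟩ := enorm_sum_mul_norm_iteratedDeriv_le hq hqq hω hν hp γ n hf hfi hA F z
    (fun k hk => (hz k hk).1) a b ha hb
  have h1 := h₁ F z a c hF hz ha hc
  have h2 := h₂ F z b d hF hz hb hd
  rw [Finset.sum_congr rfl fun k _ => haX k] at h1
  rw [Finset.sum_congr rfl fun k _ => hbY k] at h2
  rw [Finset.sum_congr rfl fun k _ => habt k] at hcd
  apply le_rpow_of_le_mul_rpow hS0 (by positivity) hs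
  have h3 : ENNReal.ofReal S ≤ ENNReal.ofReal (A * (C₁ * S) ^ (1 / p) * (C₂ * S) ^ (1 / q')) := by
    refine hcd.trans ?_
    rw [ENNReal.ofReal_mul (by positivity), ENNReal.ofReal_mul (by positivity), ENNReal.ofReal_coe_nnreal,
      ← ENNReal.ofReal_rpow_of_nonneg (by positivity) (by positivity),
      ← ENNReal.ofReal_rpow_of_nonneg (by positivity) (by positivity)]
    gcongr
  rw [ENNReal.ofReal_le_ofReal_iff (by positivity)] at h3
  refine h3.trans (le_of_eq ?_)
  rw [Real.mul_rpow hC₁ hS0, Real.mul_rpow hC₂ hS0, ← hexp, Real.rpow_add' hS0 (by positivity),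
    Real.coe_toNNReal _ (by positivity)]
  ring

/-- Some point of the rectangle has |h|^s at least equal to its mean. The mean is finite because the
rectangle lies in a smaller closed disc. No mean value property is needed. -/
lemma exists_setLIntegral_cellSet_le {h : ℂ → ℂ} (hh : ContinuousOn h disc) {s : ℝ} (hs : 0 ≤ s) {k : ℕ × ℕ}
    (hk : k.2 < 2 ^ k.1) : ∃ z ∈ cellSet k, ∫⁻ ζ in cellSet k, ‖h ζ‖ₑ ^ s ∂(polarMeasure (volume.restrict (Ioo 0 1))) ≤
      ENNReal.ofReal ((1 / 2) ^ (2 * k.1 + 1)) * ‖h z‖ₑ ^ s := by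
  set σ := polarMeasure (volume.restrict (Ioo (0 : ℝ) 1))
  have hσ : σ (cellSet k) = ENNReal.ofReal ((1 / 2) ^ (2 * k.1 + 1)) := by
    have := area_cellSet k.1 k.2
    rwa [if_pos hk] at this
  have hσ0 : σ (cellSet k) ≠ 0 := by rw [hσ]; simp
  have hσt : σ (cellSet k) ≠ ∞ := by rw [hσ]; exact ENNReal.ofReal_ne_top
  have hsub : cellSet k ⊆ Metric.closedBall 0 (1 - (1 / 2) ^ (k.1 + 1)) := by
    intro z hz
    have h1 := lev_spec hz.1
    have h2 : lev z = k.1 := congrArg Prod.fst hz.2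
    rw [h2] at h1
    rw [mem_closedBall_zero_iff]
    linarith [h1.1]
  obtain ⟨M, hM⟩ := (isCompact_closedBall (0 : ℂ) (1 - (1 / 2) ^ (k.1 + 1))).exists_bound_of_continuousOn
    (hh.mono (Metric.closedBall_subset_ball (sub_lt_self _ (by positivity))))
  have hfin : ∫⁻ ζ in cellSet k, ‖h ζ‖ₑ ^ s ∂σ ≠ ∞ := by
    refine ((setLIntegral_mono' (g := fun _ => ENNReal.ofReal M ^ s) (measurableSet_cellSet k) fun ζ hζ => ?_).trans_lt ?_).ne
    · rw [← ofReal_norm]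
      gcongr
      exact hM ζ (hsub hζ)
    · rw [setLIntegral_const]
      exact ENNReal.mul_lt_top (by finiteness) hσt.lt_top
  obtain ⟨z, hz, h⟩ := exists_setLAverage_le hσ0 (measurableSet_cellSet k).nullMeasurableSet hfin
  refine ⟨z, hz, ?_⟩
  rw [setLAverage_eq, hσ] at h
  rw [hσ] at hσ0 hσt
  rwa [ENNReal.div_le_iff hσ0 hσt, mul_comm] at h

lemma lintegral_eq_tsum_cellSet (h : ℂ → ℝ≥0∞) :
    ∫⁻ ζ, h ζ ∂(polarMeasure (volume.restrict (Ioo 0 1))) =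
      ∑' k, ∫⁻ ζ in cellSet k, h ζ ∂(polarMeasure (volume.restrict (Ioo 0 1))) := by
  set σ := polarMeasure (volume.restrict (Ioo (0 : ℝ) 1))
  have hσd : ∀ᵐ ζ ∂σ, ζ ∈ disc := ae_polarMeasure_mem_disc (ae_restrict_mem measurableSet_Ioo)
  have hU : ⋃ k, cellSet k = disc := by
    ext z
    simp [cellSet]
  rw [← lintegral_iUnion measurableSet_cellSet (fun i j hij => disjoint_left.2 fun z hi hj => hij (hi.2.symm.trans hj.2)),
    hU, Measure.restrict_eq_self_of_ae_mem hσd]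

/-- On a rectangle the almost decreasing weight is at most a constant times its value at the inner
radius, and |f^(n)|^s is represented by its value at a sample point chosen by averaging. -/
lemma exists_symbolIntegral_le {p q : ℝ} (hq : 1 < q) (hqp : q < p) {ω ν : ℂ → ℝ} (hω : IsDoublingWeight ω)
    (hν : IsDoublingWeight ν) : ∃ N : ℕ, ∀ n : ℕ, N ≤ n → ∃ C : ℝ≥0, ∀ f : ℂ → ℂ, DifferentiableOn ℂ f disc →
      Integrable f (weightMeasure ν) → ∀ A : ℝ≥0, IsSmallHankelBound p q ω ν f A →
        symbolIntegral p q ω ν f n ≤ C * (A : ℝ≥0∞) ^ (p * q / (p - q)) := by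
  have hp0 : 0 < p := by linarith
  have hq0 : 0 < q := by linarith
  have hpq : 0 < p - q := by linarith
  obtain ⟨N₁, -, hN₁⟩ := exists_symWeight_le hq hqp hω hν
  obtain ⟨N₂, hN₂⟩ := exists_sum_rpow_le hq hqp hω hν
  refine ⟨max N₁ N₂, fun n hn => ?_⟩
  obtain ⟨D, hD0, hD⟩ := hN₁ n ((le_max_left _ _).trans hn)
  obtain ⟨K, hK⟩ := hN₂ n ((le_max_right _ _).trans hn)
  set s := p * q / (p - q)
  have hs : 0 < s := by positivity
  refine ⟨(D * K ^ s).toNNReal, fun f hf hfi A hA => ?_⟩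
  set σ := polarMeasure (volume.restrict (Ioo (0 : ℝ) 1))
  have hdc := (differentiableOn_iteratedDeriv hf n).continuousOn
  set Φ := disc.indicator (iteratedDeriv n f)
  have hΦm : Measurable fun z => ‖Φ z‖ₑ ^ s := (measurable_indicator_of_continuousOn hdc).enorm.pow_const s
  have hΦ : ∀ z ∈ disc, Φ z = iteratedDeriv n f z := fun z hz => indicator_of_mem hz _
  have hΦc : ContinuousOn Φ disc := hdc.congr hΦ
  have hwm : Measurable fun r : ℝ => ENNReal.ofReal (2 * r) * ENNReal.ofReal (symWeight p q ω ν n r) :=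
    (by fun_prop : Measurable fun r : ℝ => ENNReal.ofReal (2 * r)).mul (measurable_symWeight p q ω ν n).ennreal_ofReal
  have hsw : ∀ i : ℕ, 0 < symWeight p q ω ν n (1 - (1 / 2) ^ i) := fun i =>
    symWeight_pos hω hν n (one_sub_half_pow_nonneg i) (one_sub_half_pow_lt i)
  have hpt : ∀ k : ℕ × ℕ, ∃ z, (k.2 < 2 ^ k.1 → z ∈ cellSet k) ∧
      ∫⁻ ζ in cellSet k, ENNReal.ofReal (2 * ‖ζ‖) * ENNReal.ofReal (symWeight p q ω ν n ‖ζ‖) * ‖Φ ζ‖ₑ ^ s ∂σ ≤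
        if k.2 < 2 ^ k.1 then ENNReal.ofReal (D * (‖iteratedDeriv n f z‖ ^ s *
          (symWeight p q ω ν n (1 - (1 / 2) ^ k.1) * (1 / 2) ^ (2 * k.1)))) else 0 := by
    intro k
    by_cases hk : k.2 < 2 ^ k.1
    · obtain ⟨z, hz, h⟩ := exists_setLIntegral_cellSet_le hΦc hs.le hk
      refine ⟨z, fun _ => hz, ?_⟩
      rw [if_pos hk]
      have h0 := hsw k.1
      calc ∫⁻ ζ in cellSet k, ENNReal.ofReal (2 * ‖ζ‖) * ENNReal.ofReal (symWeight p q ω ν n ‖ζ‖) * ‖Φ ζ‖ₑ ^ s ∂σ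
          ≤ ∫⁻ ζ in cellSet k, ENNReal.ofReal (2 * (D * symWeight p q ω ν n (1 - (1 / 2) ^ k.1))) * ‖Φ ζ‖ₑ ^ s ∂σ := by
            refine setLIntegral_mono' (measurableSet_cellSet k) fun ζ hζ => ?_
            have h1 := mem_ball_zero_iff.1 hζ.1
            have h2 := lev_spec hζ.1
            rw [show lev ζ = k.1 from congrArg Prod.fst hζ.2] at h2
            rw [ENNReal.ofReal_mul zero_le_two (q := D * _)]
            gcongr
            · linarith
            · exact hD _ _ (one_sub_half_pow_nonneg _) (by linarith [h2.2]) h1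
        _ ≤ ENNReal.ofReal (2 * (D * symWeight p q ω ν n (1 - (1 / 2) ^ k.1))) *
              (ENNReal.ofReal ((1 / 2) ^ (2 * k.1 + 1)) * ‖Φ z‖ₑ ^ s) := by
            rw [lintegral_const_mul' _ _ ENNReal.ofReal_ne_top]
            gcongr
        _ = _ := by
            rw [hΦ z hz.1, ← ofReal_norm, ENNReal.ofReal_rpow_of_nonneg (norm_nonneg _) hs.le,
              ← ENNReal.ofReal_mul (by positivity), ← ENNReal.ofReal_mul (by positivity)]
            congr 1
            ring
    · refine ⟨0, fun h => absurd h hk, ?_⟩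
      have h0 : σ (cellSet k) = 0 := by
        have := area_cellSet k.1 k.2
        rwa [if_neg hk] at this
      rw [setLIntegral_measure_zero _ _ h0]
      exact bot_le
  choose z hz hle using hpt
  have hI : symbolIntegral p q ω ν f n = ∫⁻ ζ, ENNReal.ofReal (2 * ‖ζ‖) * ENNReal.ofReal (symWeight p q ω ν n ‖ζ‖) *
      ‖Φ ζ‖ₑ ^ s ∂σ := by
    rw [symbolIntegral_eq hqp hω hν hf n, ← lintegral_polarMeasure_withDensity' hwm hΦm]
    apply lintegral_congr_ae
    filter_upwards [ae_polarMeasure_mem_disc (ae_withDensity_mem _)] with ζ hζ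
    rw [hΦ ζ hζ]
  rw [hI, lintegral_eq_tsum_cellSet]
  refine (ENNReal.tsum_le_tsum hle).trans ?_
  -- The discrete estimate is uniform over finite families, so it passes to the whole sum.
  rw [ENNReal.tsum_eq_iSup_sum]
  refine iSup_le fun F => ?_
  rw [← Finset.sum_filter]
  have h0 := hK f hf hfi A hA (F.filter fun k => k.2 < 2 ^ k.1) z (fun k hk => (Finset.mem_filter.1 hk).2)
    (fun k hk => hz k (Finset.mem_filter.1 hk).2)
  rw [← ENNReal.ofReal_sum_of_nonneg fun k _ => by
    have := hsw k.1
    positivity, ← Finset.mul_sum]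
  refine (ENNReal.ofReal_le_ofReal (mul_le_mul_of_nonneg_left h0 hD0)).trans (le_of_eq ?_)
  rw [Real.mul_rpow K.coe_nonneg A.coe_nonneg, ← mul_assoc, ENNReal.ofReal_mul (by positivity),
    ← ENNReal.ofReal_rpow_of_nonneg A.coe_nonneg hs.le, ENNReal.ofReal_coe_nnreal]
  rfl

/-- Pairing the image of the constant 1 with ζ^j gives the j-th Taylor coefficient of f times the
j-th moment; Hölder's inequality bounds this pairing by the operator bound. -/
lemma exists_enorm_iteratedDeriv_zero_le {p q : ℝ} (hq : 1 < q) {ω ν : ℂ → ℝ} (hω : IsDoublingWeight ω)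
    (hν : IsDoublingWeight ν) (j : ℕ) : ∃ C : ℝ≥0, ∀ f : ℂ → ℂ, DifferentiableOn ℂ f disc →
      Integrable f (weightMeasure ν) → ∀ A : ℝ≥0, IsSmallHankelBound p q ω ν f A →
        ‖iteratedDeriv j f 0‖ₑ ≤ C * A := by
  have hq0 : 0 < q := by linarith
  have hqq : q.HolderConjugate (q / (q - 1)) := Real.HolderConjugate.conjExponent hq
  set q' := q / (q - 1)
  have hq'0 : 0 < q' := hqq.symm.pos
  have := isFiniteMeasure_weightMeasure hν.toIsRadialWeight
  have hae := ae_weightMeasure_mem_disc hν.toIsRadialWeight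
  have hm := mom_pos hν j
  have h1c : ∀ z ∈ disc, ‖(fun _ : ℂ => (1 : ℂ)) z‖ ≤ 1 := fun z _ => by simp
  have h1mem : (fun _ : ℂ => (1 : ℂ)) ∈ bergmanSpace p ω :=
    ⟨differentiableOn_const 1, memLp_of_bounded hω.toIsRadialWeight continuousOn_const h1c _⟩
  have h1t : weightedNorm p ω (fun _ => 1) ≠ ∞ := h1mem.2.2.ne
  set W := weightedNorm p ω (fun _ => 1)
  set V := weightMeasure ν univ
  have hV : V ^ (1 / q') ≠ ∞ := by have := measure_ne_top (weightMeasure ν) univ; finiteness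
  refine ⟨(j.factorial / mom ν j).toNNReal * (W * V ^ (1 / q')).toNNReal, fun f hf hfi A hA => ?_⟩
  obtain ⟨T, hT, hTA⟩ := hA
  set F : ℂ → ℂ := ((T ⟨_, h1mem⟩ : bergmanSpace q ν) : ℂ → ℂ)
  have hF := (T ⟨_, h1mem⟩).2
  have hFi : Integrable F (weightMeasure ν) := hF.2.integrable (by rw [ENNReal.one_le_ofReal]; exact hq.le)
  have e := integral_mul_conj_pow_of_eqOn hν hfi continuousOn_const h1c hF.1 hFi (hT ⟨_, h1mem⟩ ⟨1, h1c⟩) j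
  simp only [map_one, mul_one] at e
  rw [integral_mul_conj_pow hν.toIsRadialWeight hf hfi] at e
  have h2 : ‖coef f j * mom ν j‖ₑ ≤ A * W * V ^ (1 / q') := by
    rw [← e]
    simp_rw [← map_pow]
    refine (enorm_integral_mul_conj_le hqq hFi.1 (by fun_prop)).trans ?_
    gcongr
    · rw [← weightedNorm_eq hq0]
      exact hTA ⟨_, h1mem⟩
    · calc ∫⁻ ζ, ‖ζ ^ j‖ₑ ^ q' ∂(weightMeasure ν) ≤ ∫⁻ ζ, 1 ∂(weightMeasure ν) := by
            apply lintegral_mono_ae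
            filter_upwards [hae] with ζ hζ
            apply ENNReal.rpow_le_one _ hq'0.le
            rw [← ofReal_norm, ENNReal.ofReal_le_one, norm_pow]
            exact pow_le_one₀ (norm_nonneg _) (mem_ball_zero_iff.1 hζ).le
        _ = V := by simp [V]
  have h3 : iteratedDeriv j f 0 = ((j.factorial / mom ν j : ℝ) : ℂ) * (coef f j * mom ν j) := by
    have h4 : (mom ν j : ℂ) ≠ 0 := by exact_mod_cast hm.ne'
    have h5 : (j.factorial : ℂ) ≠ 0 := by exact_mod_cast j.factorial_ne_zero
    rw [coef]
    push_cast
    field_simp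
  rw [h3, enorm_mul, ENNReal.coe_mul, ENNReal.coe_toNNReal (ENNReal.mul_ne_top h1t hV), mul_assoc]
  gcongr
  · rw [← ofReal_norm, Complex.norm_real, Real.norm_eq_abs, abs_of_nonneg (by positivity)]
    rfl
  · refine h2.trans (le_of_eq ?_)
    ring

lemma exists_symbolIntegral_add_sum_le {p q : ℝ} (hq : 1 < q) (hqp : q < p) {ω ν : ℂ → ℝ} (hω : IsDoublingWeight ω)
    (hν : IsDoublingWeight ν) : ∃ N : ℕ, ∀ n : ℕ, N ≤ n → ∃ C : ℝ≥0, ∀ f : ℂ → ℂ, DifferentiableOn ℂ f disc →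
      Integrable f (weightMeasure ν) → ∀ A : ℝ≥0, IsSmallHankelBound p q ω ν f A →
        symbolIntegral p q ω ν f n + ∑ j ∈ Finset.range n, ‖iteratedDeriv j f 0‖ₑ ^ (p * q / (p - q)) ≤
          C * (A : ℝ≥0∞) ^ (p * q / (p - q)) := by
  have hp0 : 0 < p := by linarith
  have hpq : 0 < p - q := by linarith
  obtain ⟨N, hN⟩ := exists_symbolIntegral_le hq hqp hω hν
  refine ⟨N, fun n hn => ?_⟩
  obtain ⟨C, hC⟩ := hN n hn
  choose D hD using exists_enorm_iteratedDeriv_zero_le (p := p) hq hω hν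
  set s := p * q / (p - q)
  have hs : 0 < s := by positivity
  refine ⟨C + ∑ j ∈ Finset.range n, D j ^ s, fun f hf hfi A hA => ?_⟩
  push_cast
  rw [add_mul, Finset.sum_mul]
  refine add_le_add (hC f hf hfi A hA) (Finset.sum_le_sum fun j _ => ?_)
  rw [ENNReal.coe_rpow_of_nonneg _ hs.le, ← ENNReal.mul_rpow_of_nonneg _ _ hs.le]
  exact ENNReal.rpow_le_rpow (hD j f hf hfi A hA) hs.le

end

end SmallHankel

open SmallHankel in
theorem theorem1 (p q : ℝ) (hq : 1 < q) (hqp : q < p) (ω ν : ℂ → ℝ)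
    (hω : IsDoublingWeight ω) (hν : IsDoublingWeight ν) :
    ∃ N : ℕ,
      (∀ f ∈ bergmanSpace 1 (logWeight ν),
        (SmallHankelBounded p q ω ν f ↔ ∃ n : ℕ, N ≤ n ∧ symbolIntegral p q ω ν f n < ∞) ∧
        (SmallHankelBounded p q ω ν f ↔ ∀ n : ℕ, N ≤ n → symbolIntegral p q ω ν f n < ∞)) ∧
      ∀ n : ℕ, N ≤ n → ∃ C : ℝ≥0, 0 < C ∧
        ∀ f ∈ bergmanSpace 1 (logWeight ν),
          smallHankelNorm p q ω ν f ^ (p * q / (p - q)) ≤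
              C * (symbolIntegral p q ω ν f n +
                ∑ j ∈ Finset.range n, ‖iteratedDeriv j f 0‖ₑ ^ (p * q / (p - q))) ∧
          symbolIntegral p q ω ν f n +
              ∑ j ∈ Finset.range n, ‖iteratedDeriv j f 0‖ₑ ^ (p * q / (p - q)) ≤
            C * smallHankelNorm p q ω ν f ^ (p * q / (p - q)) := by
  have hp0 : 0 < p := by linarith
  have hpq : 0 < p - q := by linarith
  have hs : 0 < p * q / (p - q) := by have : 0 < q := by linarith
                                      positivity
  obtain ⟨N₁, hN₁⟩ := exists_isSmallHankelBound hq hqp hω hν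
  obtain ⟨N₂, hN₂⟩ := exists_symbolIntegral_add_sum_le hq hqp hω hν
  set s := p * q / (p - q)
  have hint : ∀ f ∈ bergmanSpace 1 (logWeight ν), Integrable f (weightMeasure ν) := fun f hf =>
    integrable_of_mem_logWeight hν.toIsRadialWeight hf
  have hrpow : ∀ Q : ℝ≥0∞, Q ≠ ∞ → (((Q ^ (1 / s)).toNNReal : ℝ≥0) : ℝ≥0∞) ^ s = Q := by
    intro Q hQ
    rw [ENNReal.coe_toNNReal (ENNReal.rpow_ne_top_of_nonneg (by positivity) hQ), ← ENNReal.rpow_mul,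
      one_div_mul_cancel hs.ne', ENNReal.rpow_one]
  have hinit : ∀ (f : ℂ → ℂ) (n : ℕ), ∑ j ∈ Finset.range n, ‖iteratedDeriv j f 0‖ₑ ^ s ≠ ∞ := by
    intro f n
    exact ENNReal.sum_ne_top.2 fun j _ => ENNReal.rpow_ne_top_of_nonneg hs.le enorm_ne_top
  have hfin : ∀ f ∈ bergmanSpace 1 (logWeight ν), SmallHankelBounded p q ω ν f → ∀ n, max N₁ N₂ ≤ n →
      symbolIntegral p q ω ν f n < ∞ := by
    rintro f hf ⟨A, hA⟩ n hn
    obtain ⟨C, hC⟩ := hN₂ n ((le_max_right _ _).trans hn)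
    exact (le_self_add.trans (hC f hf.1 (hint f hf) A hA)).trans_lt
      (ENNReal.mul_lt_top ENNReal.coe_lt_top (ENNReal.rpow_lt_top_of_nonneg hs.le ENNReal.coe_ne_top))
  have hbdd : ∀ f ∈ bergmanSpace 1 (logWeight ν), (∃ n, max N₁ N₂ ≤ n ∧ symbolIntegral p q ω ν f n < ∞) →
      SmallHankelBounded p q ω ν f := by
    rintro f hf ⟨n, hn, h⟩
    obtain ⟨C, hC⟩ := hN₁ n ((le_max_left _ _).trans hn)
    exact ⟨_, hC f hf.1 (hint f hf) _ (hrpow _ (ENNReal.add_ne_top.2 ⟨h.ne, hinit f n⟩)).ge⟩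
  refine ⟨max N₁ N₂, fun f hf => ⟨⟨fun h => ⟨_, le_rfl, hfin f hf h _ le_rfl⟩, hbdd f hf⟩,
    ⟨hfin f hf, fun h => hbdd f hf ⟨_, le_rfl, h _ le_rfl⟩⟩⟩, fun n hn => ?_⟩
  obtain ⟨C₁, hC₁⟩ := hN₁ n ((le_max_left _ _).trans hn)
  obtain ⟨C₂, hC₂⟩ := hN₂ n ((le_max_right _ _).trans hn)
  -- One constant for both inequalities. The summand 1 keeps it nonzero, which is needed when the
  -- symbol side is infinite and when dividing by the constant.
  refine ⟨1 + C₁ ^ s + C₂, by positivity, fun f hf => ?_⟩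
  set Q := symbolIntegral p q ω ν f n + ∑ j ∈ Finset.range n, ‖iteratedDeriv j f 0‖ₑ ^ s
  have hC0 : ((1 + C₁ ^ s + C₂ : ℝ≥0) : ℝ≥0∞) ≠ 0 := ENNReal.coe_ne_zero.2 (by positivity)
  constructor
  · by_cases hQ : Q = ∞
    · rw [hQ, ENNReal.mul_top hC0]
      exact le_top
    · have h1 : smallHankelNorm p q ω ν f ≤ ((C₁ * (Q ^ (1 / s)).toNNReal : ℝ≥0) : ℝ≥0∞) :=
        iInf₂_le _ (hC₁ f hf.1 (hint f hf) _ (hrpow Q hQ).ge)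
      refine (ENNReal.rpow_le_rpow h1 hs.le).trans ?_
      rw [ENNReal.coe_mul, ENNReal.mul_rpow_of_nonneg _ _ hs.le, hrpow Q hQ, ← ENNReal.coe_rpow_of_nonneg _ hs.le]
      gcongr
      exact le_add_right le_add_self
  · have h1 : (Q / ((1 + C₁ ^ s + C₂ : ℝ≥0) : ℝ≥0∞)) ^ (1 / s) ≤ smallHankelNorm p q ω ν f := by
      refine le_iInf₂ fun A hA => ?_
      rw [one_div, ENNReal.rpow_inv_le_iff hs, ENNReal.div_le_iff hC0 ENNReal.coe_ne_top, mul_comm]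
      refine (hC₂ f hf.1 (hint f hf) A hA).trans ?_
      gcongr
      exact le_add_self
    rwa [one_div, ENNReal.rpow_inv_le_iff hs, ENNReal.div_le_iff hC0 ENNReal.coe_ne_top, mul_comm] at h1
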